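/- Let $p$ be an odd prime and let $\mathcal O$ be a complete discrete valuation ring of characteristic $0$ whose residue field is algebraically closed of characteristic $p$. Let $G$ be a finite group with a subgroup $G_{\bar 0}$ of index $2$. For a subgroup $N\le G$, the group algebra $\mathcal O N$ is a superalgebra, i.e. it is $\mathbb Z/2$-graded: $(\mathcal O N)_{\bar 0}$ and $(\mathcal O N)_{\bar 1}$ are the $\mathcal O$-spans of $N\cap G_{\bar 0}$ and of $N\setminus G_{\bar 0}$. All modules are finitely generated. An $\mathcal O N$-supermodule is an $\mathcal O N$-module $M$ with an $\mathcal O$-module decomposition $M=M_{\bar 0}\oplus M_{\bar 1}$ such that $(\mathcal O N)_\varepsilon M_\delta\subseteq M_{\varepsilon+\delta}$; $M\simeq M'$ means that there is an isomorphism of $\mathcal O N$-modules preserving the gradings (an even isomorphism). A supermodule is absolutely indecomposable if it is indecomposable as an ordinary module, and its vertices are those of the ordinary module (a vertex of an indecomposable $\mathcal O N$-module is a subgroup $Q\le N$ minimal such that the module is isomorphic to a direct summand of $\mathrm{Ind}_Q^N W$ for some $\mathcal O Q$-module $W$; it is determined up to $N$-conjugacy). For $V$ an $\mathcal O N$-supermodule,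 $\mathrm{Ind}_N^G V=\mathcal O G\otimes_{\mathcal O N}V$ is graded by $|g\otimes v|=|g|+|v|$. Write ${}^gP=gPg^{-1}$. **Theorem (super Green correspondence).** Let $P$ be a $p$-subgroup of $G$ and let $N_G(P)\le N\le G$ with $N\not\le G_{\bar 0}$. Then there is a bijection between the even isomorphism classes of absolutely indecomposable $\mathcal O G$-supermodules with vertex $P$ and the even isomorphism classes of absolutely indecomposable $\mathcal O N$-supermodules with vertex $P$ such that, for every absolutely indecomposable $\mathcal O G$-supermodule $U$ with vertex $P$ and every absolutely indecomposable $\mathcal O N$-supermodule $V$ with vertex $P$, the following are equivalent: 1. the classes of $U$ and $V$ correspond; 2. $\mathrm{Ind}_N^G V\simeq U\oplus M_G$ for some $\mathcal O G$-supermodule $M_G$ which, as an $\mathcal O G$-module, is a direct sum of indecomposable modules, each with a vertex contained in $P\cap{}^gP$ for some $g\in G\setminus N$ (depending on the summand); 3. $\mathrm{Res}^G_N U\simeq V\oplus M_N$ for some $\mathcal O N$-supermodule $M_N$ which, as an $\mathcal O N$-module, is a direct sum of indecomposable modules, each with a vertex contained in $N\cap{}^gP$ for some $g\in G\setminus N$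 (depending on the summand). In particular, each of the decompositions in 2 and 3 determines $U$ from $V$, and $V$ from $U$, up to even isomorphism. -/

import Mathlib

open scoped Pointwise

universe u v w

/-! ### Ordinary modules over group algebras

An `OG`-module is given by a representation of `G` on an `O`-module. -/

section Modules

variable {O : Type u} [CommRing O] {G : Type v} [Group G]

/-- An indecomposable `OG`-module: it is nonzero, and it is not the direct sum of two nonzero
submodules. -/
def IsIndecomposable {V : Type w} [AddCommGroup V] [Module O V] (ρ : Representation O G V) : Prop :=
  Nontrivial V ∧ ∀ W W' : Subrepresentation ρ, IsCompl W W' → W = ⊥ ∨ W' = ⊥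

/-- `M ∣ N`: the module `M` is isomorphic to a direct summand of the module `N`. -/
def IsDirectSummand {V : Type*} [AddCommGroup V] [Module O V] (ρ : Representation O G V)
    {V' : Type*} [AddCommGroup V'] [Module O V'] (ρ' : Representation O G V') : Prop :=
  ∃ W W' : Subrepresentation ρ', IsCompl W W' ∧ Nonempty (ρ.Equiv W.toRepresentation)

/-- Relative `Q`-projectivity of an `OG`-module: it is isomorphic to a direct summand of
`Ind_Q^G W` for some finitely generated `OQ`-module `W`. -/
def IsRelProjective {V : Type w} [AddCommGroup V] [Module O V] (ρ : Representation O G V)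
    (Q : Subgroup G) : Prop :=
  ∃ (W : Type w) (_ : AddCommGroup W) (_ : Module O W) (_ : Module.Finite O W)
    (τ : Representation O Q W), IsDirectSummand ρ (Representation.ind Q.subtype τ)

/-- `Q` is a vertex of the (indecomposable) `OG`-module: a minimal subgroup relative to which the
module is projective. -/
def IsVertex {V : Type w} [AddCommGroup V] [Module O V] (ρ : Representation O G V)
    (Q : Subgroup G) : Prop :=
  Minimal (IsRelProjective ρ) Q

/-- The `OG`-module is a finite direct sum of indecomposable modules, each of which has a vertex
belonging to the set `𝒬` of subgroups. -/
def IsSumWithVertices {V : Type w} [AddCommGroup V] [Module O V] (ρ : Representation O G V)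
    (𝒬 : Set (Subgroup G)) : Prop :=
  ∃ (n : ℕ) (W : Fin n → Subrepresentation ρ),
    DirectSum.IsInternal (fun i => (W i).toSubmodule) ∧
      ∀ i, IsIndecomposable (W i).toRepresentation ∧
        ∃ Q ∈ 𝒬, IsVertex (W i).toRepresentation Q

end Modules

/-! ### The group superalgebra and its supermodules -/

section Parity

variable {G : Type v} [Group G]

open Classical in
/-- The parity `|g|` of a group element: even if `g ∈ G₀` and odd otherwise. -/
noncomputable def parity (G₀ : Subgroup G) (g : G) : ZMod 2 := if g ∈ G₀ then 0 else 1

theorem parity_mul {G₀ : Subgroup G} (h : G₀.index = 2) (a b : G) :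
    parity G₀ (a * b) = parity G₀ a + parity G₀ b := by
  have := Subgroup.mul_mem_iff_of_index_two h (a := a) (b := b)
  have h2 : (1 : ZMod 2) + 1 = 0 := rfl
  unfold parity
  by_cases ha : a ∈ G₀ <;> by_cases hb : b ∈ G₀ <;> simp_all

theorem parity_inv (G₀ : Subgroup G) (a : G) : parity G₀ a⁻¹ = parity G₀ a := by
  unfold parity
  congr 1
  exact propext G₀.inv_mem_iff

theorem parity_subgroupOf (G₀ N : Subgroup G) (n : N) :
    parity (G₀.subgroupOf N) n = parity G₀ (n : G) := by
  unfold parity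
  congr 1

/-- The homogeneous component `(OG)_ε` of the superalgebra `OG`: the `O`-span of the group
elements of parity `ε`. -/
noncomputable def groupAlgebraPart (O : Type u) [CommRing O] (G₀ : Subgroup G) (ε : ZMod 2) :
    Submodule O (MonoidAlgebra O G) :=
  Submodule.span O (MonoidAlgebra.of O G '' {g | parity G₀ g = ε})

end Parity

/-- A supermodule over the group superalgebra `OG` (graded by the subgroup `G₀`): a finitely
generated `OG`-module `M` with a decomposition `M = M₀ ⊕ M₁` as an `O`-module such that
`(OG)_ε M_δ ⊆ M_{ε+δ}`. -/
structure SuperModule (O : Type u) [CommRing O] {G : Type v} [Group G] (G₀ : Subgroup G) where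
  carrier : Type (max u v)
  [addCommGroup : AddCommGroup carrier]
  [module : Module O carrier]
  [finite : Module.Finite O carrier]
  ρ : Representation O G carrier
  grade : ZMod 2 → Submodule O carrier
  isInternal : DirectSum.IsInternal grade
  smul_mem : ∀ (ε δ : ZMod 2) (a : MonoidAlgebra O G) (m : carrier),
    a ∈ groupAlgebraPart O G₀ ε → m ∈ grade δ → ρ.asAlgebraHom a m ∈ grade (ε + δ)

attribute [instance] SuperModule.addCommGroup SuperModule.module SuperModule.finite

namespace SuperModule

section Grading

variable {O : Type u} [CommRing O] {V : Type w} [AddCommGroup V] [Module O V]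

theorem isInternal_iff_isCompl (A : ZMod 2 → Submodule O V) :
    DirectSum.IsInternal A ↔ IsCompl (A 0) (A 1) :=
  DirectSum.isInternal_submodule_iff_isCompl A (by decide)
    (by
      have h : ∀ i : ZMod 2, i = 0 ∨ i = 1 := by decide
      ext i
      simpa using h i)

theorem smul_mem_of_group {G : Type v} [Group G] (G₀ : Subgroup G) (ρ : Representation O G V)
    (A : ZMod 2 → Submodule O V)
    (h : ∀ (g : G) (δ : ZMod 2) (m : V), m ∈ A δ → ρ g m ∈ A (parity G₀ g + δ))
    (ε δ : ZMod 2) (a : MonoidAlgebra O G) (m : V)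
    (ha : a ∈ groupAlgebraPart O G₀ ε) (hm : m ∈ A δ) : ρ.asAlgebraHom a m ∈ A (ε + δ) := by
  induction ha using Submodule.span_induction with
  | mem x hx =>
    obtain ⟨g, rfl, rfl⟩ := hx
    simpa using h g δ m hm
  | zero => simp
  | add x y _ _ hx hy => simpa using add_mem hx hy
  | smul c x _ hx => simpa using Submodule.smul_mem _ c hx

/-- The projection onto the homogeneous component of degree `ε`. -/
noncomputable def gradeProj (A : ZMod 2 → Submodule O V) (hA : DirectSum.IsInternal A)
    (ε : ZMod 2) : V →ₗ[O] V :=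
  (A ε).subtype ∘ₗ DirectSum.component O (ZMod 2) (fun i => A i) ε ∘ₗ
    (LinearEquiv.ofBijective (DirectSum.coeLinearMap A) hA).symm.toLinearMap

theorem gradeProj_mem (A : ZMod 2 → Submodule O V) (hA : DirectSum.IsInternal A) (ε : ZMod 2)
    (x : V) : gradeProj A hA ε x ∈ A ε := by
  simp [gradeProj]

theorem gradeProj_of_mem (A : ZMod 2 → Submodule O V) (hA : DirectSum.IsInternal A)
    {ε δ : ZMod 2} {x : V} (hx : x ∈ A δ) :
    gradeProj A hA ε x = if δ = ε then x else 0 := by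
  have h : (LinearEquiv.ofBijective (DirectSum.coeLinearMap A) hA).symm x
      = DirectSum.lof O (ZMod 2) (fun i => A i) δ ⟨x, hx⟩ := by
    rw [LinearEquiv.symm_apply_eq]
    exact (DirectSum.coeLinearMap_lof A δ ⟨x, hx⟩).symm
  simp only [gradeProj, LinearMap.comp_apply, LinearEquiv.coe_coe, h]
  by_cases hd : δ = ε
  · subst hd; simp [DirectSum.component.lof_self]
  · rw [DirectSum.component.of, dif_neg hd]; simp [hd]

theorem grade_induction (A : ZMod 2 → Submodule O V) (hA : DirectSum.IsInternal A)
    {p : V → Prop} (x : V) (hadd : ∀ x y, p x → p y → p (x + y))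
    (h : ∀ δ, ∀ x ∈ A δ, p x) : p x := by
  have hc := ((isInternal_iff_isCompl A).1 hA).sup_eq_top
  have hx : x ∈ A 0 ⊔ A 1 := hc ▸ Submodule.mem_top
  obtain ⟨y, hy, z, hz, rfl⟩ := Submodule.mem_sup.1 hx
  exact hadd _ _ (h _ _ hy) (h _ _ hz)

end Grading

variable {O : Type u} [CommRing O] {G : Type v} [Group G] {G₀ : Subgroup G}

theorem apply_mem (M : SuperModule O G₀) (g : G) {δ : ZMod 2} {m : M.carrier}
    (hm : m ∈ M.grade δ) : M.ρ g m ∈ M.grade (parity G₀ g + δ) := by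
  have := M.smul_mem (parity G₀ g) δ (MonoidAlgebra.of O G g) m
    (Submodule.subset_span ⟨g, rfl, rfl⟩) hm
  simpa using this

/-- Isomorphism `M ≃ N` of supermodules (always even). -/
def Iso (M N : SuperModule O G₀) : Prop :=
  ∃ e : M.ρ.Equiv N.ρ, ∀ (ε : ZMod 2) (m : M.carrier), m ∈ M.grade ε ↔ e m ∈ N.grade ε

theorem Iso.refl (M : SuperModule O G₀) : M.Iso M :=
  ⟨.refl _, fun _ _ => Iff.rfl⟩

theorem Iso.symm {M N : SuperModule O G₀} : M.Iso N → N.Iso M := by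
  rintro ⟨e, he⟩
  refine ⟨e.symm, fun ε m => ?_⟩
  rw [he, e.apply_symm_apply]

theorem Iso.trans {M N L : SuperModule O G₀} : M.Iso N → N.Iso L → M.Iso L := by
  rintro ⟨e, he⟩ ⟨f, hf⟩
  exact ⟨e.trans f, fun ε m => (he ε m).trans (hf ε _)⟩

/-- The direct sum of two supermodules. -/
noncomputable def directSum (M N : SuperModule O G₀) : SuperModule O G₀ where
  carrier := M.carrier × N.carrier
  ρ := M.ρ.prod N.ρ
  grade ε := (M.grade ε).prod (N.grade ε)
  isInternal := by
    have hM := (isInternal_iff_isCompl _).1 M.isInternal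
    have hN := (isInternal_iff_isCompl _).1 N.isInternal
    rw [isInternal_iff_isCompl]
    refine ⟨?_, ?_⟩
    · rw [disjoint_iff, Submodule.prod_inf_prod, hM.inf_eq_bot, hN.inf_eq_bot, Submodule.prod_bot]
    · rw [codisjoint_iff, Submodule.prod_sup_prod, hM.sup_eq_top, hN.sup_eq_top,
        Submodule.prod_top]
  smul_mem := smul_mem_of_group _ _ _ fun g _ _ hm =>
    ⟨M.apply_mem g hm.1, N.apply_mem g hm.2⟩

/-- Restriction `Res^G_N M`, a supermodule over `ON`, where `ON` inherits the superalgebra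
structure from `OG`, i.e. is graded by `N ∩ G₀`. -/
noncomputable def res (M : SuperModule O G₀) (N : Subgroup G) :
    SuperModule O (G₀.subgroupOf N) where
  carrier := M.carrier
  ρ := M.ρ.comp N.subtype
  grade := M.grade
  isInternal := M.isInternal
  smul_mem := smul_mem_of_group _ _ _ fun n _ _ hm => by
    rw [parity_subgroupOf]
    exact M.apply_mem (n : G) hm

section Ind

open Representation

variable {N : Subgroup G} (V : SuperModule O (G₀.subgroupOf N))

/-- The grading of the induced module: the class of `g ⊗ m` has parity `|g| + |m|`. -/
noncomputable def indGrade (ε : ZMod 2) : Submodule O (IndV N.subtype V.ρ) :=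
  Submodule.span O {x | ∃ (g : G) (δ : ZMod 2) (m : V.carrier),
    m ∈ V.grade δ ∧ parity G₀ g + δ = ε ∧ x = IndV.mk N.subtype V.ρ g m}

theorem mk_mem_indGrade (g : G) {δ : ZMod 2} {m : V.carrier} (hm : m ∈ V.grade δ) :
    IndV.mk N.subtype V.ρ g m ∈ indGrade V (parity G₀ g + δ) :=
  Submodule.subset_span ⟨g, δ, m, hm, rfl, rfl⟩

theorem indV_induction {p : IndV N.subtype V.ρ → Prop} (x : IndV N.subtype V.ρ)
    (hadd : ∀ x y, p x → p y → p (x + y)) (h0 : p 0)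
    (h : ∀ (g : G) (m : V.carrier), p (IndV.mk N.subtype V.ρ g m)) : p x := by
  obtain ⟨x, rfl⟩ := Coinvariants.mk_surjective _ x
  induction x using TensorProduct.induction_on with
  | zero => simpa using h0
  | add x y hx hy => simpa using hadd _ _ hx hy
  | tmul a m =>
    induction a using MonoidAlgebra.induction_linear with
    | zero => simpa using h0
    | add a b ha hb => simpa [TensorProduct.add_tmul] using hadd _ _ ha hb
    | single g c =>
      have : (MonoidAlgebra.single g c : MonoidAlgebra O G) = c • MonoidAlgebra.single g 1 := by
        simp
      rw [this, TensorProduct.smul_tmul]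
      exact h g (c • m)

theorem mk_mul_apply (g : G) (n : N) (m : V.carrier) :
    IndV.mk N.subtype V.ρ ((n : G) * g) (V.ρ n m) = IndV.mk N.subtype V.ρ g m := by
  have := Coinvariants.mk_self_apply
    (Representation.tprod ((leftRegular O G).comp N.subtype) V.ρ) n
    (TensorProduct.tmul O (MonoidAlgebra.single g 1) m)
  simpa using this

theorem gradeProj_apply (n : N) (ε : ZMod 2) (m : V.carrier) :
    gradeProj V.grade V.isInternal (parity G₀ (n : G) + ε) (V.ρ n m)
      = V.ρ n (gradeProj V.grade V.isInternal ε m) := by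
  refine grade_induction V.grade V.isInternal
    (p := fun m => gradeProj V.grade V.isInternal (parity G₀ (n : G) + ε) (V.ρ n m)
      = V.ρ n (gradeProj V.grade V.isInternal ε m)) m ?_ ?_
  · intro x y hx hy
    simp [hx, hy]
  · intro δ x hx
    have h1 := V.apply_mem n hx
    rw [parity_subgroupOf] at h1
    rw [gradeProj_of_mem _ _ hx, gradeProj_of_mem _ _ h1]
    by_cases hd : δ = ε <;> simp [hd]

/-- The projection of the induced module onto the component of degree `ε`. -/
noncomputable def indProj (hG₀ : G₀.index = 2) (ε : ZMod 2) :
    IndV N.subtype V.ρ →ₗ[O] IndV N.subtype V.ρ :=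
  Coinvariants.lift _
    (TensorProduct.lift ((Finsupp.lift _ _ _ fun g : G =>
        IndV.mk N.subtype V.ρ g ∘ₗ gradeProj V.grade V.isInternal (parity G₀ g + ε)) ∘ₗ
      (MonoidAlgebra.coeffLinearEquiv O).toLinearMap))
    fun n => by
      ext g m
      simp only [LinearMap.coe_comp, Function.comp_apply, MonoidAlgebra.lsingle_apply]
      have h := gradeProj_apply V n (parity G₀ g + ε) m
      rw [← add_assoc, ← parity_mul hG₀] at h
      have h2 := mk_mul_apply V g n (gradeProj V.grade V.isInternal (parity G₀ g + ε) m)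
      simp at h2
      simp [h, h2]

theorem indProj_mk (hG₀ : G₀.index = 2) (ε : ZMod 2) (g : G) (m : V.carrier) :
    indProj V hG₀ ε (IndV.mk N.subtype V.ρ g m) =
      IndV.mk N.subtype V.ρ g (gradeProj V.grade V.isInternal (parity G₀ g + ε) m) := by
  simp [indProj]

theorem indProj_of_mem (hG₀ : G₀.index = 2) {ε δ : ZMod 2} {x : IndV N.subtype V.ρ}
    (hx : x ∈ indGrade V δ) : indProj V hG₀ ε x = if δ = ε then x else 0 := by
  induction hx using Submodule.span_induction with
  | mem x hx =>
    obtain ⟨g, γ, m, hm, rfl, rfl⟩ := hx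
    rw [indProj_mk, gradeProj_of_mem _ _ hm]
    have : γ = parity G₀ g + ε ↔ parity G₀ g + γ = ε := by
      have key : ∀ a ε γ : ZMod 2, γ = a + ε ↔ a + γ = ε := by decide
      exact key _ _ _
    by_cases h : parity G₀ g + γ = ε
    · rw [if_pos h, if_pos (this.2 h)]
    · rw [if_neg h, if_neg (fun h' => h (this.1 h')), map_zero]
  | zero => simp
  | add x y _ _ hx hy => rw [map_add, hx, hy]; split_ifs <;> simp
  | smul c x _ hx => rw [map_smul, hx]; split_ifs <;> simp

/-- Induction `Ind_N^G V = OG ⊗_{ON} V`, with `|g ⊗ m| = |g| + |m|`. -/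
noncomputable def ind [Finite G] (hG₀ : G₀.index = 2) : SuperModule O G₀ where
  carrier := IndV N.subtype V.ρ
  finite := by
    have : Module.Finite O (MonoidAlgebra O G) :=
      Module.Finite.equiv (MonoidAlgebra.coeffLinearEquiv O).symm
    exact Module.Finite.of_surjective _ (Coinvariants.mk_surjective _)
  ρ := Representation.ind N.subtype V.ρ
  grade := indGrade V
  isInternal := by
    rw [isInternal_iff_isCompl]
    refine ⟨?_, ?_⟩
    · rw [Submodule.disjoint_def]
      intro x h0 h1
      have e0 := indProj_of_mem V hG₀ (ε := 0) h0
      have e1 := indProj_of_mem V hG₀ (ε := 0) h1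
      rw [e1] at e0
      simpa using e0.symm
    · rw [codisjoint_iff, eq_top_iff]
      rintro x -
      refine indV_induction V x (fun _ _ => add_mem) (zero_mem _) fun g m => ?_
      refine grade_induction V.grade V.isInternal
        (p := fun m => IndV.mk N.subtype V.ρ g m ∈ indGrade V 0 ⊔ indGrade V 1) m ?_ ?_
      · intro x y hx hy
        rw [map_add]
        exact add_mem hx hy
      · intro δ x hx
        have := mk_mem_indGrade V g hx
        have hle : ∀ ε : ZMod 2, indGrade V ε ≤ indGrade V 0 ⊔ indGrade V 1 := by
          intro ε
          fin_cases ε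
          · exact le_sup_left
          · exact le_sup_right
        exact hle _ this
  smul_mem := smul_mem_of_group _ _ _ fun h δ x hx => by
    induction hx using Submodule.span_induction with
    | mem x hx =>
      obtain ⟨g, γ, m, hm, rfl, rfl⟩ := hx
      have h1 := mk_mem_indGrade V (g * h⁻¹) hm
      rw [parity_mul hG₀, parity_inv, add_comm (parity G₀ g), add_assoc] at h1
      rw [ind_mk]
      exact h1
    | zero => simp
    | add x y _ _ hx hy => rw [map_add]; exact add_mem hx hy
    | smul c x _ hx => rw [map_smul]; exact Submodule.smul_mem _ c hx

end Ind

/-- A supermodule is absolutely indecomposable if it is indecomposable as an ordinary module. -/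
def IsAbsolutelyIndecomposable (M : SuperModule O G₀) : Prop :=
  IsIndecomposable M.ρ

end SuperModule

/-! ### The objects matched by the Green correspondence -/

section Green

/-- The absolutely indecomposable `OG`-supermodules with vertex `P`. -/
def AbsIndec (O : Type u) [CommRing O] {G : Type v} [Group G] (G₀ P : Subgroup G) :=
  {M : SuperModule O G₀ // M.IsAbsolutelyIndecomposable ∧ IsVertex M.ρ P}

instance absIndecSetoid (O : Type u) [CommRing O] {G : Type v} [Group G] (G₀ P : Subgroup G) :
    Setoid (AbsIndec O G₀ P) where
  r U U' := U.1.Iso U'.1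
  iseqv := ⟨fun U => .refl U.1, fun h => h.symm, fun h h' => h.trans h'⟩

/-- Even isomorphism classes of absolutely indecomposable `OG`-supermodules with vertex `P`. -/
def AbsIndecClass (O : Type u) [CommRing O] {G : Type v} [Group G] (G₀ P : Subgroup G) :=
  Quotient (absIndecSetoid O G₀ P)

variable {O : Type u} [CommRing O] {G : Type v} [Group G] [Finite G] {G₀ : Subgroup G}

/-- `Ind_N^G V ≃ U ⊕ M_G` for some supermodule `M_G` which, as an `OG`-module, is a direct sum of
indecomposable modules each with vertex contained in `P ∩ ᵍP` for some `g ∈ G ∖ N`. -/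
def HasIndDecomposition (hG₀ : G₀.index = 2) (P N : Subgroup G) (U : SuperModule O G₀)
    (V : SuperModule O (G₀.subgroupOf N)) : Prop :=
  ∃ M_G : SuperModule O G₀, (V.ind hG₀).Iso (U.directSum M_G) ∧
    IsSumWithVertices M_G.ρ {Q | ∃ g : G, g ∉ N ∧ Q ≤ P ⊓ MulAut.conj g • P}

/-- `Res^G_N U ≃ V ⊕ M_N` for some supermodule `M_N` which, as an `ON`-module, is a direct sum of
indecomposable modules each with vertex contained in `N ∩ ᵍP` for some `g ∈ G ∖ N`. -/
def HasResDecomposition (P N : Subgroup G) (U : SuperModule O G₀)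
    (V : SuperModule O (G₀.subgroupOf N)) : Prop :=
  ∃ M_N : SuperModule O (G₀.subgroupOf N), (U.res N).Iso (V.directSum M_N) ∧
    IsSumWithVertices M_N.ρ {Q | ∃ g : G, g ∉ N ∧ Q ≤ (N ⊓ MulAut.conj g • P).subgroupOf N}

end Green

/-! ### Fitting decompositions over complete local rings -/

section Fitting

/-! A module $M$ is studied through the algebra $A=\mathrm{End}_O(M)$ and the relative traces
$\mathrm{Tr}_Q^G\colon A^Q\to A^G$. By Higman's criterion (`isRelProjective_iff`), relative
projectivity says that $1$ is a trace; for a family of subgroups closed under passing to subgroups,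
being a sum of indecomposables with vertices in the family says that $1$ lies in the sum of the
trace ideals (`IsSumWithVertices.one_mem_traceIdeal`, `isSumWithVertices_of_one_mem`). Completeness
of $O$ makes the fixed ring of an indecomposable module local, so Rosenberg's lemma
(`HasLocalFixed.exists_one_mem`) is available.

Let $\mathrm{Tr}_P^G(c)=1$ and $b=\mathrm{Tr}_P^N(c)$. Mackey's formula gives $b\equiv 1$ modulo the
traces from `greenY`, and then $x\equiv\mathrm{Tr}_N^G(bx)$ for every $N$-fixed $x$, while
$\mathrm{Tr}_N^G(b\,\cdot)$ carries traces from `greenY` to traces from `greenX`. Thus $A^G$ and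
$A^N$ agree modulo these ideals. It follows that for $\mathrm{Ind}\,V$ and for $\mathrm{Res}\,U$
each idempotent $x$ of the fixed ring has $x$ or $1-x$ in the ideal (`mem_or_one_sub_mem_greenX`,
`HasLocalFixed.mem_or_one_sub_mem_greenY`): there is one relevant summand, and the rest has small
vertices.

The super ingredient is `exists_even_isPrimitiveIdem`: that summand can be chosen graded. An
idempotent $f$ outside the ideal, primitive among the even ones, stays primitive among all: if $g\le
f$ lies in the ideal, its even part $x$ is topologically nilpotent, its odd part satisfies
$y=xy+yx$, hence $y=(1-x)^{-1}yx$, and iteration forces $y=0$.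

Uniqueness is cancellation (`IsEvenRetract.of_directSum`): $V$ is an even summand of
$\mathrm{Res}\,\mathrm{Ind}\,V$, a correspondent $U$ of $V$ is an even summand of $\mathrm{Ind}\,V$
(`isEvenRetract_ind_of_hasResDecomposition`), and neither can be a summand of a complement with
small vertices. -/

theorem isAdicComplete_of_finite {R : Type*} [CommRing R] [IsNoetherianRing R] [IsLocalRing R]
    [IsAdicComplete (IsLocalRing.maximalIdeal R) R] (M : Type*) [AddCommGroup M] [Module R M]
    [Module.Finite R M] : IsAdicComplete (IsLocalRing.maximalIdeal R) M := by
  have h : IsPrecomplete (IsLocalRing.maximalIdeal R) M := by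
    rw [← AdicCompletion.of_surjective_iff]
    intro y
    -- As $M$ is finite, $\hat R\otimes M$ surjects onto $\hat M$; as $R$ is complete, each pure
    -- tensor already comes from $M$.
    obtain ⟨t, rfl⟩ := AdicCompletion.ofTensorProduct_surjective_of_finite
      (IsLocalRing.maximalIdeal R) M y
    induction t using TensorProduct.induction_on with
    | zero => exact ⟨0, by simp⟩
    | add a b ha hb =>
      obtain ⟨a', ha'⟩ := ha
      obtain ⟨b', hb'⟩ := hb
      exact ⟨a' + b', by simp [ha', hb']⟩
    | tmul r x =>
      obtain ⟨s, rfl⟩ := AdicCompletion.of_surjective (IsLocalRing.maximalIdeal R) R r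
      refine ⟨s • x, ?_⟩
      rw [AdicCompletion.ofTensorProduct_tmul]
      ext n
      rfl
  exact { toIsHausdorff := inferInstance, toIsPrecomplete := h }

/-- In a finite commutative algebra over a complete noetherian local ring, every element is
invertible in one block and topologically nilpotent in the complementary one. -/
theorem exists_fitting_idempotent {R : Type*} [CommRing R] [IsNoetherianRing R] [IsLocalRing R]
    [IsAdicComplete (IsLocalRing.maximalIdeal R) R] {A : Type*} [CommRing A] [Algebra R A]
    [Module.Finite R A] (x : A) :
    ∃ e y : A, ∃ n : ℕ, e * e = e ∧ x * y = e ∧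
      x ^ n * (1 - e) ∈ (IsLocalRing.maximalIdeal R).map (algebraMap R A) := by
  set I := (IsLocalRing.maximalIdeal R).map (algebraMap R A) with hI
  have hc : IsAdicComplete I A := by
    rw [hI, IsAdicComplete.map_algebraMap_iff]
    exact isAdicComplete_of_finite A
  have hH : HenselianRing A I := inferInstance
  have hart : IsArtinianRing (A ⧸ I) := by
    let := Ideal.Quotient.field (IsLocalRing.maximalIdeal R)
    exact IsArtinianRing.of_finite (R ⧸ IsLocalRing.maximalIdeal R) _
  -- The powers of $x$ stabilise in the artinian quotient: $x^{n+1}z=x^n$ modulo $I$.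
  obtain ⟨n, z, hz⟩ := IsArtinian.exists_pow_succ_smul_dvd (Ideal.Quotient.mk I x) (1 : A ⧸ I)
  obtain ⟨z, rfl⟩ := Ideal.Quotient.mk_surjective z
  set q := Ideal.Quotient.mk I with hq
  have hk : ∀ k, q x ^ n * (q x * q z) ^ k = q x ^ n := by
    intro k
    induction k with
    | zero => simp
    | succ k ih =>
      calc q x ^ n * (q x * q z) ^ (k + 1) = (q x ^ n.succ • q z) * (q x * q z) ^ k := by
            rw [smul_eq_mul, Nat.succ_eq_add_one]; ring
        _ = q x ^ n := by rw [hz, smul_eq_mul, mul_one, ih]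
  -- The exponent $n+1$ instead of $n$ keeps $e_0$ divisible by $x$ when $n=0$; the quasi-inverse of
  -- $x$ needs this.
  set e₀ := (x * z) ^ (n + 1) with he₀
  have hid : q e₀ * q e₀ = q e₀ := by
    simp only [he₀, map_pow, map_mul]
    calc (q x * q z) ^ (n + 1) * (q x * q z) ^ (n + 1)
        = (q x ^ n * (q x * q z) ^ (n + 1)) * (q x * q z ^ (n + 1)) := by ring
      _ = _ := by rw [hk]; ring
  have hx : q x ^ n * (1 - q e₀) = 0 := by
    rw [mul_sub, mul_one, he₀, map_pow, map_mul, hk, sub_self]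
  obtain ⟨e, he, hee⟩ := hH.is_henselian (Polynomial.X ^ 2 - Polynomial.X)
    (by monicity!) e₀
    (by
      rw [← Ideal.Quotient.eq_zero_iff_mem]
      simp [← hq, sq, hid])
    (by
      -- The derivative $2e_0-1$ squares to $1$ modulo $I$, so Hensel's lemma applies to $X^2-X$ in
      -- any residue characteristic.
      refine IsUnit.of_mul_eq_one (q (2 * e₀ - 1)) ?_
      simp only [Polynomial.derivative_X_pow, Polynomial.derivative_X,
        Polynomial.eval_sub, Polynomial.eval_mul, Polynomial.eval_one, ← hq, map_sub, map_mul,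
        map_one]
      simp only [Nat.cast_ofNat, map_ofNat, Nat.add_one_sub_one, pow_one, Polynomial.eval_X,
        Polynomial.eval_ofNat]
      linear_combination 4 * hid)
  have he1 : e * e = e := by
    have : e ^ 2 - e = 0 := by simpa using he
    linear_combination this
  -- $e-e_0$ lies in the Jacobson radical. This unit $w$ satisfies $ew=ee_0$, so $w^{-1}$ turns the
  -- approximate relation $x\cdot z(xz)^n=e_0$ into an exact one for $e$.
  have hw : IsUnit (1 - (e - e₀)) := by
    have := Ideal.mem_jacobson_bot.1 (hH.jac hee) (-1)
    convert this using 1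
    ring
  obtain ⟨w, hw⟩ := hw
  refine ⟨e, e * (z * (x * z) ^ n) * (↑w⁻¹ : A), n, he1, ?_, ?_⟩
  · have h1 : e * w = e * e₀ := by
      rw [hw]; linear_combination -he1
    have h2 : (w : A) * (↑w⁻¹ : A) = 1 := w.mul_inv
    calc x * (e * (z * (x * z) ^ n) * (↑w⁻¹ : A)) = e * e₀ * (↑w⁻¹ : A) := by rw [he₀]; ring
      _ = e := by rw [← h1, mul_assoc, h2, mul_one]
  · rw [← Ideal.Quotient.eq_zero_iff_mem] at hee ⊢
    rw [map_mul, map_sub, map_one, map_pow, sub_eq_zero.1 ((map_sub _ _ _).symm.trans hee)]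
    exact hx

end Fitting

/-! ### Primitive idempotents in subalgebras of endomorphism rings -/

section PrimitiveIdempotents

variable {O : Type*} [CommRing O] {M : Type*} [AddCommGroup M] [Module O M]

/-- A primitive idempotent of a subalgebra. -/
structure IsPrimitiveIdem (S : Subalgebra O (Module.End O M)) (f : Module.End O M) : Prop where
  mem : f ∈ S
  idem : f * f = f
  ne_zero : f ≠ 0
  eq_or : ∀ g ∈ S, g * g = g → f * g = g → g * f = g → g = 0 ∨ g = f

variable [IsNoetherianRing O] [Module.Finite O M]

/-- An idempotent lying outside an additive subgroup can be shrunk to a primitive one. -/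
theorem exists_isPrimitiveIdem_notMem (S : Subalgebra O (Module.End O M))
    (J : AddSubgroup (Module.End O M)) (hJ : (1 : Module.End O M) ∉ J) :
    ∃ f, IsPrimitiveIdem S f ∧ f ∉ J := by
  -- A maximal kernel means a minimal idempotent. In $f=g+(f-g)$ one of the two terms is outside
  -- $J$, and by minimality that term is $f$; no more than additivity of $J$ is needed.
  let T : Set (Submodule O M) := {K | ∃ f ∈ S, f * f = f ∧ f ∉ J ∧ LinearMap.ker f = K}
  obtain ⟨K, ⟨f, hf, hff, hfJ, rfl⟩, hmax⟩ := set_has_maximal_iff_noetherian.2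
    (inferInstance : IsNoetherian O M) T ⟨_, 1, one_mem _, one_mul _, hJ, rfl⟩
  have key : ∀ g ∈ S, g * g = g → f * g = g → g * f = g → g ∉ J → f - g = 0 := by
    intro g hg hgg hfg hgf hgJ
    have hle : LinearMap.ker f ≤ LinearMap.ker g := fun v hv => by
      rw [LinearMap.mem_ker] at hv ⊢
      rw [← hgf, Module.End.mul_apply, hv, map_zero]
    have heq := eq_of_le_of_not_lt hle (hmax _ ⟨g, hg, hgg, hgJ, rfl⟩)
    have h0 : f * (f - g) = 0 := by
      ext v
      have : (f - g) v ∈ LinearMap.ker f := by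
        rw [heq, LinearMap.mem_ker, ← Module.End.mul_apply, mul_sub, hgf, hgg, sub_self]
        rfl
      exact this
    rwa [mul_sub, hff, hfg] at h0
  refine ⟨f, ⟨hf, hff, fun h => hfJ (h ▸ zero_mem J), fun g hg hgg hfg hgf => ?_⟩, hfJ⟩
  by_cases hgJ : g ∈ J
  · left
    have := key (f - g) (sub_mem hf hg) (by noncomm_ring [hff, hgg, hfg, hgf])
      (by rw [mul_sub, hff, hfg])
      (by rw [sub_mul, hff, hgf]) fun h => hfJ (by simpa using add_mem h hgJ)
    simpa using this
  · right
    exact (sub_eq_zero.1 (key g hg hgg hfg hgf hgJ)).symm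

/-- Every idempotent of a subalgebra is a sum of orthogonal primitive idempotents. -/
theorem exists_sum_isPrimitiveIdem (S : Subalgebra O (Module.End O M)) (f : Module.End O M)
    (hf : f ∈ S) (hff : f * f = f) :
    ∃ (ι : Type) (_ : Fintype ι) (e : ι → Module.End O M),
      (∀ i, IsPrimitiveIdem S (e i)) ∧ (∀ i j, i ≠ j → e i * e j = 0) ∧ ∑ i, e i = f := by
  suffices ∀ K : Submodule O M, ∀ f ∈ S, f * f = f → LinearMap.ker f = K →
      ∃ (ι : Type) (_ : Fintype ι) (e : ι → Module.End O M),
      (∀ i, IsPrimitiveIdem S (e i)) ∧ (∀ i j, i ≠ j → e i * e j = 0) ∧ ∑ i, e i = f from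
    this _ f hf hff rfl
  intro K
  -- Passing to a proper idempotent below $f$ strictly enlarges the kernel, so noetherianity of $M$
  -- ends the splitting.
  induction K using WellFoundedGT.induction with
  | ind K ih =>
  rintro f hf hff rfl
  by_cases hp : IsPrimitiveIdem S f
  · exact ⟨Unit, inferInstance, fun _ => f, fun _ => hp, fun i j h => (h rfl).elim, by simp⟩
  by_cases h0 : f = 0
  · exact ⟨Empty, inferInstance, fun _ => f, fun i => i.elim, fun i => i.elim, by simp [h0]⟩
  have : ∃ g ∈ S, g * g = g ∧ f * g = g ∧ g * f = g ∧ g ≠ 0 ∧ g ≠ f := by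
    by_contra! hcon
    exact hp ⟨hf, hff, h0, fun g h1 h2 h3 h4 => or_iff_not_imp_left.2 (hcon g h1 h2 h3 h4)⟩
  obtain ⟨g, hg, hgg, hfg, hgf, hg0, hgf'⟩ := this
  have key : ∀ g ∈ S, g * g = g → f * g = g → g * f = g → g ≠ f →
      LinearMap.ker f < LinearMap.ker g := by
    intro g hg hgg hfg hgf hne
    refine lt_of_le_of_ne (fun v hv => ?_) fun heq => ?_
    · rw [LinearMap.mem_ker] at hv ⊢
      rw [← hgf, Module.End.mul_apply, hv, map_zero]
    · have h0 : f * (f - g) = 0 := by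
        ext v
        have : (f - g) v ∈ LinearMap.ker f := by
          rw [heq, LinearMap.mem_ker, ← Module.End.mul_apply, mul_sub, hgf, hgg, sub_self]
          rfl
        exact this
      rw [mul_sub, hff, hfg] at h0
      exact hne (sub_eq_zero.1 h0).symm
  have hg' : (f - g) * (f - g) = f - g := by
    rw [mul_sub, sub_mul, sub_mul, hff, hgf, hfg, hgg, sub_self, sub_zero]
  obtain ⟨ι, _, e, he, heo, hes⟩ := ih _ (key g hg hgg hfg hgf hgf') g hg hgg rfl
  obtain ⟨κ, _, e', he', heo', hes'⟩ := ih _ (key (f - g) (sub_mem hf hg) hg'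
    (by rw [mul_sub, hff, hfg]) (by rw [sub_mul, hff, hgf]) (by simpa using hg0))
    (f - g) (sub_mem hf hg) hg' rfl
  have hleft : ∀ {κ : Type} [Fintype κ] (e : κ → Module.End O M) (he : ∀ i, IsPrimitiveIdem S (e i))
      (heo : ∀ i j, i ≠ j → e i * e j = 0) (i : κ),
      (∑ j, e j) * e i = e i ∧ e i * (∑ j, e j) = e i := by
    classical
    intro κ _ e he heo i
    rw [Finset.sum_mul, Finset.mul_sum]
    constructor
    · rw [Finset.sum_eq_single i (fun j _ h => heo _ _ h) (by simp), (he i).idem]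
    · rw [Finset.sum_eq_single i (fun j _ h => heo _ _ h.symm) (by simp), (he i).idem]
  refine ⟨ι ⊕ κ, inferInstance, Sum.elim e e', ?_, ?_, ?_⟩
  · rintro (i | i)
    · exact he i
    · exact he' i
  · have hz : g * (f - g) = 0 := by rw [mul_sub, hgf, hgg, sub_self]
    have hz' : (f - g) * g = 0 := by rw [sub_mul, hfg, hgg, sub_self]
    rintro (i | i) (j | j) hij
    · exact heo i j fun h => hij (h ▸ rfl)
    · change e i * e' j = 0
      rw [← (hleft e he heo i).2, ← (hleft e' he' heo' j).1, hes, hes', mul_assoc,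
        ← mul_assoc g, hz, zero_mul, mul_zero]
    · change e' i * e j = 0
      rw [← (hleft e he heo j).1, ← (hleft e' he' heo' i).2, hes, hes', mul_assoc,
        ← mul_assoc (f - g), hz', zero_mul, mul_zero]
    · exact heo' i j fun h => hij (h ▸ rfl)
  · rw [Fintype.sum_sum_type]
    simp [hes, hes']

end PrimitiveIdempotents

/-! ### Topological nilpotence and local corner rings -/

section TopNilpotent

variable {O : Type*} [CommRing O] [IsNoetherianRing O] [IsLocalRing O]
  {M : Type*} [AddCommGroup M] [Module O M]

/-- An endomorphism of `M` some power of which maps `M` to `𝔪M`. -/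
def IsTopNilpotent (x : Module.End O M) : Prop :=
  ∃ n : ℕ, ∀ v, (x ^ n) v ∈ IsLocalRing.maximalIdeal O • (⊤ : Submodule O M)

variable [Module.Finite O M]

/-- The truncated geometric series inverts $1-x$ modulo $\mathfrak m M$, so $1-x$ is surjective by
Nakayama, and a surjective endomorphism of a noetherian module is bijective. -/
theorem IsTopNilpotent.isUnit_one_sub {x : Module.End O M} (hx : IsTopNilpotent x) :
    IsUnit (1 - x) := by
  obtain ⟨n, hn⟩ := hx
  rw [Module.End.isUnit_iff]
  refine IsNoetherian.bijective_of_surjective_endomorphism _ ?_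
  rw [← LinearMap.range_eq_top, eq_top_iff]
  refine Submodule.le_of_le_smul_of_le_jacobson_bot Module.Finite.fg_top
    (IsLocalRing.maximalIdeal_le_jacobson _) fun v _ => ?_
  have h : v = (1 - x) ((∑ i ∈ Finset.range n, x ^ i) v) + (x ^ n) v := by
    rw [← Module.End.mul_apply, mul_neg_geom_sum]
    simp
  rw [h]
  exact add_mem (Submodule.mem_sup_left ⟨_, rfl⟩) (Submodule.mem_sup_right (hn v))

/-- Iteration gives $d=w^kdx^k$ for all $k$, so the image of $d$ lies in every $\mathfrak m^jM$, and
Krull's intersection theorem applies. This is what kills the odd part of an idempotent. -/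
theorem IsTopNilpotent.eq_zero {x d w : Module.End O M} (hx : IsTopNilpotent x)
    (h : d = w * d * x) : d = 0 := by
  obtain ⟨n, hn⟩ := hx
  have h1 : ∀ k, d = w ^ k * d * x ^ k := by
    intro k
    induction k with
    | zero => simp
    | succ k ih =>
      calc d = w * d * x := h
        _ = w * (w ^ k * d * x ^ k) * x := by rw [← ih]
        _ = _ := by rw [pow_succ' w, pow_succ x]; simp only [mul_assoc]
  have h2 : ∀ k v, ((x ^ n) ^ k) v ∈ IsLocalRing.maximalIdeal O ^ k • (⊤ : Submodule O M) := by
    intro k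
    induction k with
    | zero => simp
    | succ k ih =>
      intro v
      have h3 : ∀ u ∈ IsLocalRing.maximalIdeal O ^ k • (⊤ : Submodule O M), (x ^ n) u ∈
          IsLocalRing.maximalIdeal O ^ (k + 1) • (⊤ : Submodule O M) := by
        intro u hu
        induction hu using Submodule.smul_induction_on' with
        | smul r hr u _ =>
          rw [map_smul, pow_succ, mul_smul]
          exact Submodule.smul_mem_smul hr (hn u)
        | add u _ u' _ hu hu' => rw [map_add]; exact add_mem hu hu'
      rw [pow_succ' (x ^ n), Module.End.mul_apply]
      exact h3 _ (ih v)
  ext v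
  have h4 : d v ∈ (⨅ k : ℕ, IsLocalRing.maximalIdeal O ^ k • ⊤ : Submodule O M) := by
    rw [Submodule.mem_iInf]
    intro k
    rw [h1 (n * k), Module.End.mul_apply, pow_mul x]
    have h5 := Submodule.mem_map_of_mem (f := w ^ (n * k) * d) (h2 k v)
    rw [Submodule.map_smul''] at h5
    exact Submodule.smul_mono le_rfl le_top h5
  rwa [Ideal.iInf_pow_smul_eq_bot_of_isLocalRing _ (Ideal.IsPrime.ne_top inferInstance)] at h4

/-- The commutative statement is applied to $O[x]$. Keeping $e$ and $y$ there places them in every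
subalgebra containing $x$ and makes them commute with whatever commutes with $x$. -/
theorem exists_fitting_end [IsAdicComplete (IsLocalRing.maximalIdeal O) O] (x : Module.End O M) :
    ∃ e ∈ Algebra.adjoin O {x}, ∃ y ∈ Algebra.adjoin O {x}, ∃ n : ℕ, e * e = e ∧ x * y = e ∧
      ∀ v, (x ^ n * (1 - e)) v ∈ IsLocalRing.maximalIdeal O • (⊤ : Submodule O M) := by
  have : IsMulCommutative (Algebra.adjoin O {x}) := Algebra.isMulCommutative_adjoin O (by simp)
  have : Module.Finite O (Algebra.adjoin O {x}) :=
    Module.Finite.of_injective (Algebra.adjoin O {x}).val.toLinearMap Subtype.val_injective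
  obtain ⟨e, y, n, he, hy, hn⟩ := exists_fitting_idempotent (R := O)
    (A := Algebra.adjoin O {x}) ⟨x, Algebra.self_mem_adjoin_singleton O x⟩
  have key : ∀ a ∈ (IsLocalRing.maximalIdeal O).map (algebraMap O (Algebra.adjoin O {x})), ∀ v,
      (a : Module.End O M) v ∈ IsLocalRing.maximalIdeal O • (⊤ : Submodule O M) := by
    intro a ha
    induction ha using Submodule.span_induction with
    | mem a ha =>
      obtain ⟨r, hr, rfl⟩ := ha
      exact fun v => Submodule.smul_mem_smul hr Submodule.mem_top
    | zero => simp
    | add a b _ _ ha hb => exact fun v => add_mem (ha v) (hb v)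
    | smul b a _ ha =>
      intro v
      rw [smul_eq_mul, mul_comm]
      exact ha ((b : Module.End O M) v)
  exact ⟨e, e.2, y, y.2, n, congrArg Subtype.val he, congrArg Subtype.val hy, key _ hn⟩

/-- The corner $fSf$ is local because the Fitting idempotent of $x$, cut down by $f$, can only be
$0$ or $f$. -/
theorem IsPrimitiveIdem.isUnit_or_isTopNilpotent [IsAdicComplete (IsLocalRing.maximalIdeal O) O]
    {S : Subalgebra O (Module.End O M)} {f x : Module.End O M} (hf : IsPrimitiveIdem S f)
    (hx : x ∈ S) (h1 : f * x = x) (h2 : x * f = x) :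
    (∃ y ∈ S, f * y = y ∧ y * f = y ∧ x * y = f ∧ y * x = f) ∨ IsTopNilpotent x := by
  obtain ⟨e, he, y, hy, n, hee, hxy, hn⟩ := exists_fitting_end x
  have hS : Algebra.adjoin O {x} ≤ S := Algebra.adjoin_le (by simpa using hx)
  have hfc : ∀ z ∈ Algebra.adjoin O {x}, f * z = z * f := by
    have : Algebra.adjoin O {x} ≤ Subalgebra.centralizer O {f} :=
      Algebra.adjoin_le (by
        rw [Set.singleton_subset_iff, SetLike.mem_coe, Subalgebra.mem_centralizer_iff]
        simp [h1, h2])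
    intro z hz
    simpa [Subalgebra.mem_centralizer_iff] using this hz
  have hxc : x * y = y * x := by
    have : Algebra.adjoin O {x} ≤ Subalgebra.centralizer O {x} :=
      Algebra.adjoin_le (by
        rw [Set.singleton_subset_iff, SetLike.mem_coe, Subalgebra.mem_centralizer_iff]
        simp)
    simpa [Subalgebra.mem_centralizer_iff] using this hy
  have hfe := hfc e he
  have hfy := hfc y hy
  -- $O[x]$ contains the scalars, so $e$ itself need not lie below $f$; $ef$ does.
  rcases hf.eq_or (e * f) (mul_mem (hS he) hf.mem)
    (by rw [mul_assoc, ← mul_assoc f, hfe, mul_assoc, hf.idem, ← mul_assoc, hee])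
    (by rw [← mul_assoc, hfe, mul_assoc, hf.idem]) (by rw [mul_assoc, hf.idem]) with h | h
  · right
    refine ⟨n + 1, fun v => ?_⟩
    have : x ^ (n + 1) = x ^ n * (1 - e) * x := by
      have hex : e * x = 0 := by rw [← h1, ← mul_assoc, h, zero_mul]
      rw [mul_assoc, sub_mul, hex, one_mul, sub_zero, pow_succ]
    rw [this]
    exact hn (x v)
  · left
    refine ⟨y * f, mul_mem (hS hy) hf.mem, ?_, ?_, ?_, ?_⟩
    · rw [← mul_assoc, hfy, mul_assoc, hf.idem]
    · rw [mul_assoc, hf.idem]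
    · rw [← mul_assoc, hxy, h]
    · rw [mul_assoc, h1, ← hxc, hxy, ← h, ← hxy, mul_assoc, ← hfy, ← mul_assoc, h2]

end TopNilpotent

/-! ### Relative traces in interior `G`-algebras -/

section RelativeTrace

variable {A : Type*} [Ring A] {G : Type*} [Group G] (ρ : G →* A)

/-- `a` is fixed under conjugation by the images of the elements of `Q`. -/
def IsFixed (Q : Subgroup G) (a : A) : Prop := ∀ q ∈ Q, ρ q * a = a * ρ q

/-- The conjugate of `a` by a representative of a coset. -/
noncomputable def conjOut (Q : Subgroup G) (a : A) (x : G ⧸ Q) : A := ρ x.out * a * ρ x.out⁻¹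

/-- The relative trace from `Q` to `G`. -/
noncomputable def relTrace [Finite G] (Q : Subgroup G) (a : A) : A :=
  letI := Fintype.ofFinite (G ⧸ Q)
  ∑ x, conjOut ρ Q a x

/-- The additive subgroup generated by the relative traces from the subgroups in `𝒬`. -/
def traceIdeal [Finite G] (𝒬 : Set (Subgroup G)) : AddSubgroup A :=
  AddSubgroup.closure {y | ∃ Q ∈ 𝒬, ∃ a, IsFixed ρ Q a ∧ y = relTrace ρ Q a}

variable {ρ}

theorem map_mul_map_inv (g : G) : ρ g * ρ g⁻¹ = 1 := by rw [← map_mul, mul_inv_cancel, map_one]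

theorem map_inv_mul_map (g : G) : ρ g⁻¹ * ρ g = 1 := by rw [← map_mul, inv_mul_cancel, map_one]

theorem IsFixed.conj_eq {Q : Subgroup G} {a : A} (h : IsFixed ρ Q a) {q : G} (hq : q ∈ Q) :
    ρ q * a * ρ q⁻¹ = a := by
  rw [h q hq, mul_assoc, map_mul_map_inv, mul_one]

theorem isFixed_of_conj_eq {Q : Subgroup G} {a : A} (h : ∀ q ∈ Q, ρ q * a * ρ q⁻¹ = a) :
    IsFixed ρ Q a := fun q hq => by
  conv_rhs => rw [← h q hq, mul_assoc, map_inv_mul_map, mul_one]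

theorem IsFixed.mono {Q R : Subgroup G} (h : R ≤ Q) {a : A} (ha : IsFixed ρ Q a) :
    IsFixed ρ R a := fun q hq => ha q (h hq)

theorem IsFixed.one {Q : Subgroup G} : IsFixed ρ Q 1 := fun q _ => by simp

theorem IsFixed.mul {Q : Subgroup G} {a b : A} (ha : IsFixed ρ Q a) (hb : IsFixed ρ Q b) :
    IsFixed ρ Q (a * b) := fun q hq => by
  rw [← mul_assoc, ha q hq, mul_assoc, hb q hq, mul_assoc]

theorem IsFixed.add {Q : Subgroup G} {a b : A} (ha : IsFixed ρ Q a) (hb : IsFixed ρ Q b) :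
    IsFixed ρ Q (a + b) := fun q hq => by rw [mul_add, add_mul, ha q hq, hb q hq]

theorem IsFixed.sub {Q : Subgroup G} {a b : A} (ha : IsFixed ρ Q a) (hb : IsFixed ρ Q b) :
    IsFixed ρ Q (a - b) := fun q hq => by rw [mul_sub, sub_mul, ha q hq, hb q hq]

theorem IsFixed.restrict {N : Subgroup G} {Q : Subgroup G} {a : A} (ha : IsFixed ρ Q a) :
    IsFixed (ρ.comp N.subtype) (Q.subgroupOf N) a := fun q hq => ha q hq

theorem isFixed_restrict_top {N : Subgroup G} {a : A} :
    IsFixed (ρ.comp N.subtype) ⊤ a ↔ IsFixed ρ N a :=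
  ⟨fun h q hq => h ⟨q, hq⟩ trivial, fun h q _ => h q q.2⟩

/-- Independence of the coset representative, which requires $a$ to be $Q$-fixed. Without that,
`conjOut` and `relTrace` depend on choices. -/
theorem conjOut_mk {Q : Subgroup G} {a : A} (ha : IsFixed ρ Q a) (g : G) :
    conjOut ρ Q a (g : G ⧸ Q) = ρ g * a * ρ g⁻¹ := by
  obtain ⟨q, hq⟩ := QuotientGroup.mk_out_eq_mul Q g
  rw [conjOut, hq]
  calc ρ (g * q) * a * ρ (g * q)⁻¹ = ρ g * (ρ q * a * ρ (q : G)⁻¹) * ρ g⁻¹ := by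
        rw [mul_inv_rev]; simp only [map_mul, mul_assoc]
    _ = _ := by rw [ha.conj_eq q.2]

theorem conjOut_smul {Q : Subgroup G} {a : A} (ha : IsFixed ρ Q a) (g : G) (x : G ⧸ Q) :
    conjOut ρ Q a (g • x) = ρ g * conjOut ρ Q a x * ρ g⁻¹ := by
  obtain ⟨h, rfl⟩ := QuotientGroup.mk_surjective x
  rw [MulAction.Quotient.smul_coe, conjOut_mk ha, conjOut_mk ha, smul_eq_mul, mul_inv_rev]
  simp only [map_mul, mul_assoc]

theorem stabilizer_restrict_mk (Q N : Subgroup G) (g : G) :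
    MulAction.stabilizer N (g : G ⧸ Q) = (MulAut.conj g • Q).subgroupOf N := by
  ext n
  rw [MulAction.mem_stabilizer_iff, Subgroup.mem_subgroupOf,
    Subgroup.mem_pointwise_smul_iff_inv_smul_mem]
  change ((n : G) • (g : G ⧸ Q)) = _ ↔ _
  rw [MulAction.Quotient.smul_coe, eq_comm, QuotientGroup.eq]
  simp [mul_assoc]

variable [Finite G]

theorem relTrace_eq_sum {Q : Subgroup G} [Fintype (G ⧸ Q)] (a : A) :
    relTrace ρ Q a = ∑ x, conjOut ρ Q a x := by
  unfold relTrace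
  congr
  exact Subsingleton.elim _ _

/-- The sum of an equivariant function over an orbit is a relative trace. -/
theorem sum_orbit_eq_relTrace {X : Type*} [MulAction G X] (F : X → A)
    (hF : ∀ (g : G) x, F (g • x) = ρ g * F x * ρ g⁻¹) (x₀ : X) (Y : Finset X)
    (hY : ∀ x, x ∈ Y ↔ x ∈ MulAction.orbit G x₀) :
    ∑ x ∈ Y, F x = relTrace ρ (MulAction.stabilizer G x₀) (F x₀) ∧
      IsFixed ρ (MulAction.stabilizer G x₀) (F x₀) := by
  have hfix : IsFixed ρ (MulAction.stabilizer G x₀) (F x₀) :=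
    isFixed_of_conj_eq fun q hq => by rw [← hF, MulAction.mem_stabilizer_iff.1 hq]
  refine ⟨?_, hfix⟩
  let := Fintype.ofFinite (G ⧸ MulAction.stabilizer G x₀)
  rw [relTrace_eq_sum]
  symm
  refine Finset.sum_bij (fun x _ => MulAction.ofQuotientStabilizer G x₀ x)
    (fun x _ => (hY _).2 (MulAction.ofQuotientStabilizer_mem_orbit G x₀ x))
    (fun x _ y _ h => MulAction.injective_ofQuotientStabilizer G x₀ h) ?_ ?_
  · intro y hy
    obtain ⟨g, rfl⟩ := (hY y).1 hy
    exact ⟨(g : G ⧸ _), Finset.mem_univ _, rfl⟩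
  · intro x _
    obtain ⟨g, rfl⟩ := QuotientGroup.mk_surjective x
    rw [conjOut_mk hfix, MulAction.ofQuotientStabilizer_mk, hF]

/-- The abstract form of Mackey's formula: an invariant finite set splits into orbits, and each
orbit contributes a trace from a stabilizer. -/
theorem sum_mem_traceIdeal {X : Type*} [MulAction G X] (F : X → A)
    (hF : ∀ (g : G) x, F (g • x) = ρ g * F x * ρ g⁻¹) (Y : Finset X)
    (hY : ∀ (g : G), ∀ x ∈ Y, g • x ∈ Y) (𝒬 : Set (Subgroup G))
    (h𝒬 : ∀ x ∈ Y, MulAction.stabilizer G x ∈ 𝒬) : ∑ x ∈ Y, F x ∈ traceIdeal ρ 𝒬 := by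
  classical
  induction Y using Finset.strongInduction with
  | H Y ih =>
  rcases Y.eq_empty_or_nonempty with rfl | ⟨x₀, hx₀⟩
  · simp [zero_mem]
  have hsplit := Finset.sum_filter_add_sum_filter_not Y (fun x => x ∈ MulAction.orbit G x₀) F
  rw [← hsplit]
  refine add_mem ?_ (ih _ ?_ ?_ ?_)
  · obtain ⟨h1, h2⟩ := sum_orbit_eq_relTrace F hF x₀ (Y.filter fun x => x ∈ MulAction.orbit G x₀)
      fun x => by
        rw [Finset.mem_filter, and_iff_right_iff_imp]
        rintro ⟨g, rfl⟩
        exact hY g x₀ hx₀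
    rw [h1]
    exact AddSubgroup.subset_closure ⟨_, h𝒬 x₀ hx₀, _, h2, rfl⟩
  · refine Finset.filter_ssubset.2 ⟨x₀, hx₀, ?_⟩
    simp
  · intro g x hx
    rw [Finset.mem_filter] at hx ⊢
    refine ⟨hY g x hx.1, fun h => hx.2 ?_⟩
    simpa using MulAction.mem_orbit_of_mem_orbit g⁻¹ h
  · exact fun x hx => h𝒬 x (Finset.mem_filter.1 hx).1

theorem isFixed_relTrace {Q : Subgroup G} {a : A} (ha : IsFixed ρ Q a) :
    IsFixed ρ ⊤ (relTrace ρ Q a) := by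
  refine isFixed_of_conj_eq fun g _ => ?_
  let := Fintype.ofFinite (G ⧸ Q)
  rw [relTrace_eq_sum, Finset.mul_sum, Finset.sum_mul]
  simp_rw [← conjOut_smul ha]
  exact Fintype.sum_equiv (MulAction.toPerm g) _ _ fun _ => rfl

theorem isFixed_relTrace_restrict {N : Subgroup G} {Q : Subgroup N} {a : A}
    (ha : IsFixed (ρ.comp N.subtype) Q a) : IsFixed ρ N (relTrace (ρ.comp N.subtype) Q a) :=
  isFixed_restrict_top.1 (isFixed_relTrace ha)

theorem relTrace_add {Q : Subgroup G} (a b : A) :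
    relTrace ρ Q (a + b) = relTrace ρ Q a + relTrace ρ Q b := by
  simp [relTrace, conjOut, mul_add, add_mul, Finset.sum_add_distrib]

theorem relTrace_zero {Q : Subgroup G} : relTrace ρ Q 0 = 0 := by
  simp [relTrace, conjOut]

theorem relTrace_neg {Q : Subgroup G} (a : A) : relTrace ρ Q (-a) = -relTrace ρ Q a := by
  simp [relTrace, conjOut]

theorem relTrace_mul {Q : Subgroup G} {a b : A} (hb : IsFixed ρ ⊤ b) :
    relTrace ρ Q (a * b) = relTrace ρ Q a * b := by
  rw [relTrace, relTrace, Finset.sum_mul]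
  refine Finset.sum_congr rfl fun x _ => ?_
  simp only [conjOut, mul_assoc]
  rw [hb _ trivial]

theorem mul_relTrace {Q : Subgroup G} {a b : A} (hb : IsFixed ρ ⊤ b) :
    relTrace ρ Q (b * a) = b * relTrace ρ Q a := by
  rw [relTrace, relTrace, Finset.mul_sum]
  refine Finset.sum_congr rfl fun x _ => ?_
  simp only [conjOut, ← mul_assoc]
  rw [hb _ trivial]

theorem isFixed_of_mem_traceIdeal {𝒬 : Set (Subgroup G)} {a : A} (ha : a ∈ traceIdeal ρ 𝒬) :
    IsFixed ρ ⊤ a := by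
  induction ha using AddSubgroup.closure_induction with
  | mem a ha => obtain ⟨Q, -, a, ha, rfl⟩ := ha; exact isFixed_relTrace ha
  | zero => intro; simp
  | add a b _ _ ha hb => exact ha.add hb
  | neg a _ ha => intro q hq; simp [ha q hq]

theorem traceIdeal_mono {𝒬 ℛ : Set (Subgroup G)} (h : 𝒬 ⊆ ℛ) :
    traceIdeal ρ 𝒬 ≤ traceIdeal ρ ℛ :=
  AddSubgroup.closure_mono fun _ ⟨Q, hQ, ha⟩ => ⟨Q, h hQ, ha⟩

/-- To map `traceIdeal ρ 𝒬` into an additive subgroup by an additive map, it is enough to map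
the traces. -/
theorem traceIdeal_induction {𝒬 : Set (Subgroup G)} {B : Type*} [AddCommGroup B]
    (φ : A →+ B) (S : AddSubgroup B)
    (h : ∀ Q ∈ 𝒬, ∀ a, IsFixed ρ Q a → φ (relTrace ρ Q a) ∈ S) {a : A}
    (ha : a ∈ traceIdeal ρ 𝒬) : φ a ∈ S := by
  have : traceIdeal ρ 𝒬 ≤ S.comap φ := (AddSubgroup.closure_le _).2 (by
    rintro _ ⟨Q, hQ, a, ha, rfl⟩
    exact h Q hQ a ha)
  exact this ha

theorem relTrace_mem_traceIdeal {𝒬 : Set (Subgroup G)} {Q : Subgroup G} (hQ : Q ∈ 𝒬) {a : A}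
    (ha : IsFixed ρ Q a) : relTrace ρ Q a ∈ traceIdeal ρ 𝒬 :=
  AddSubgroup.subset_closure ⟨Q, hQ, a, ha, rfl⟩

theorem mul_mem_traceIdeal {𝒬 : Set (Subgroup G)} {a b : A} (hb : IsFixed ρ ⊤ b)
    (ha : a ∈ traceIdeal ρ 𝒬) : b * a ∈ traceIdeal ρ 𝒬 :=
  traceIdeal_induction (AddMonoidHom.mulLeft b) _ (fun Q hQ a ha => by
    rw [AddMonoidHom.coe_mulLeft, ← mul_relTrace hb]
    exact relTrace_mem_traceIdeal hQ ((hb.mono le_top).mul ha)) ha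

theorem traceIdeal_mul_mem {𝒬 : Set (Subgroup G)} {a b : A} (hb : IsFixed ρ ⊤ b)
    (ha : a ∈ traceIdeal ρ 𝒬) : a * b ∈ traceIdeal ρ 𝒬 :=
  traceIdeal_induction (AddMonoidHom.mulRight b) _ (fun Q hQ a ha => by
    rw [AddMonoidHom.coe_mulRight]
    beta_reduce
    rw [← relTrace_mul hb]
    exact relTrace_mem_traceIdeal hQ (ha.mul (hb.mono le_top))) ha

/-- Transitivity of the relative trace. -/
theorem relTrace_relTrace {Q N : Subgroup G} (h : Q ≤ N) {a : A} (ha : IsFixed ρ Q a) :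
    relTrace ρ N (relTrace (ρ.comp N.subtype) (Q.subgroupOf N) a) = relTrace ρ Q a := by
  let := Fintype.ofFinite (G ⧸ N)
  let := Fintype.ofFinite (G ⧸ Q)
  let := Fintype.ofFinite (N ⧸ Q.subgroupOf N)
  rw [relTrace_eq_sum (Q := Q), relTrace_eq_sum (Q := N),
    ← (Subgroup.quotientEquivProdOfLE h).symm.sum_comp, Fintype.sum_prod_type]
  refine Finset.sum_congr rfl fun x _ => ?_
  rw [conjOut, relTrace_eq_sum, Finset.mul_sum, Finset.sum_mul]
  refine Finset.sum_congr rfl fun y _ => ?_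
  obtain ⟨n, rfl⟩ := QuotientGroup.mk_surjective y
  have : (Subgroup.quotientEquivProdOfLE h).symm (x, (n : N ⧸ Q.subgroupOf N)) =
    ((x.out * n : G) : G ⧸ Q) := rfl
  rw [this, conjOut_mk ha, conjOut_mk ha.restrict, mul_inv_rev]
  simp [mul_assoc]

theorem relTrace_relTrace_map {N : Subgroup G} {R : Subgroup N} {a : A}
    (ha : IsFixed (ρ.comp N.subtype) R a) :
    relTrace ρ N (relTrace (ρ.comp N.subtype) R a) = relTrace ρ (R.map N.subtype) a ∧
      IsFixed ρ (R.map N.subtype) a := by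
  have hfix : IsFixed ρ (R.map N.subtype) a := by
    rintro _ ⟨r, hr, rfl⟩
    exact ha r hr
  have hR : (R.map N.subtype).subgroupOf N = R :=
    Subgroup.comap_map_eq_self_of_injective N.subtype_injective R
  refine ⟨?_, hfix⟩
  rw [← relTrace_relTrace (Subgroup.map_subtype_le R) hfix, hR]

theorem relTrace_mem_of_mem_restrict {N : Subgroup G} {ℛ : Set (Subgroup N)}
    {𝒬 : Set (Subgroup G)} (h : ∀ R ∈ ℛ, R.map N.subtype ∈ 𝒬) {a : A}
    (ha : a ∈ traceIdeal (ρ.comp N.subtype) ℛ) : relTrace ρ N a ∈ traceIdeal ρ 𝒬 :=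
  traceIdeal_induction (AddMonoidHom.mk' (relTrace ρ N) relTrace_add) _ (fun R hR a ha => by
    obtain ⟨h1, h2⟩ := relTrace_relTrace_map ha
    rw [AddMonoidHom.mk'_apply, h1]
    exact relTrace_mem_traceIdeal (h R hR) h2) ha

/-- Mackey's formula: the restriction to `N` of a trace from `Q`. -/
theorem relTrace_mem_traceIdeal_restrict {Q : Subgroup G} (N : Subgroup G) {a : A}
    (ha : IsFixed ρ Q a) : relTrace ρ Q a ∈
      traceIdeal (ρ.comp N.subtype) {R | ∃ g : G, R = (MulAut.conj g • Q).subgroupOf N} := by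
  let := Fintype.ofFinite (G ⧸ Q)
  rw [relTrace_eq_sum]
  refine sum_mem_traceIdeal (ρ := ρ.comp N.subtype) (X := G ⧸ Q) (conjOut ρ Q a)
    (fun n x => conjOut_smul ha (n : G) x) _ (fun _ _ _ => Finset.mem_univ _) _ fun x _ => ?_
  obtain ⟨g, rfl⟩ := QuotientGroup.mk_surjective x
  exact ⟨g, stabilizer_restrict_mk Q N g⟩

/-- Mackey's formula, with the trivial double coset split off. -/
theorem relTrace_sub_mem_traceIdeal_restrict {Q N : Subgroup G} {a : A}
    (ha : IsFixed ρ Q a) :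
    relTrace ρ Q a - relTrace (ρ.comp N.subtype) (Q.subgroupOf N) a ∈
      traceIdeal (ρ.comp N.subtype)
        {R | ∃ g : G, g ∉ N ∧ R = (MulAut.conj g • Q).subgroupOf N} := by
  classical
  let := Fintype.ofFinite (G ⧸ Q)
  have hF : ∀ (n : N) (x : G ⧸ Q), conjOut ρ Q a (n • x) =
      (ρ.comp N.subtype) n * conjOut ρ Q a x * (ρ.comp N.subtype) n⁻¹ :=
    fun n x => conjOut_smul ha (n : G) x
  have hsplit := Finset.sum_filter_add_sum_filter_not Finset.univ
    (fun x => x ∈ MulAction.orbit N ((1 : G) : G ⧸ Q)) (conjOut ρ Q a)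
  obtain ⟨h1, -⟩ := sum_orbit_eq_relTrace (conjOut ρ Q a) hF ((1 : G) : G ⧸ Q)
    (Finset.univ.filter fun x => x ∈ MulAction.orbit N ((1 : G) : G ⧸ Q)) (by simp)
  rw [stabilizer_restrict_mk, conjOut_mk ha] at h1
  simp only [map_one, one_smul, one_mul, inv_one, mul_one] at h1
  rw [relTrace_eq_sum, ← hsplit, h1, add_sub_cancel_left]
  refine sum_mem_traceIdeal (conjOut ρ Q a) hF _ ?_ _ ?_
  · intro n x hx
    rw [Finset.mem_filter] at hx ⊢
    refine ⟨Finset.mem_univ _, fun h => hx.2 ?_⟩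
    simpa using MulAction.mem_orbit_of_mem_orbit n⁻¹ h
  · intro x hx
    obtain ⟨g, rfl⟩ := QuotientGroup.mk_surjective x
    -- If $g$ were in $N$, the coset $gQ$ would be in the $N$-orbit of the trivial coset, which was
    -- removed.
    refine ⟨g, fun hg => (Finset.mem_filter.1 hx).2 ⟨⟨g, hg⟩, ?_⟩, stabilizer_restrict_mk Q N g⟩
    change (((g : G) • ((1 : G) : G ⧸ Q)) : G ⧸ Q) = _
    rw [MulAction.Quotient.smul_coe, smul_eq_mul, mul_one]

/-- The product of a trace from `Q` with traces from the subgroups in `ℛ`. -/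
theorem relTrace_mul_mem_traceIdeal {Q : Subgroup G} {ℛ 𝒬 : Set (Subgroup G)}
    (h : ∀ R ∈ ℛ, ∀ g : G, Q ⊓ MulAut.conj g • R ∈ 𝒬) {a b : A} (ha : IsFixed ρ Q a)
    (hb : b ∈ traceIdeal ρ ℛ) : relTrace ρ Q a * b ∈ traceIdeal ρ 𝒬 :=
  traceIdeal_induction (AddMonoidHom.mulLeft (relTrace ρ Q a)) _ (fun R hR b hb => by
    -- The $G$-fixed factor moves inside the trace from $Q$, where Mackey's formula rewrites it in
    -- terms of the subgroups $Q\cap{}^gR$.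
    rw [AddMonoidHom.coe_mulLeft, ← relTrace_mul (isFixed_relTrace hb)]
    refine relTrace_mem_of_mem_restrict (ℛ := {S | ∃ g : G, S = (MulAut.conj g • R).subgroupOf Q})
      ?_ (mul_mem_traceIdeal (isFixed_restrict_top.2 ha) (relTrace_mem_traceIdeal_restrict Q hb))
    rintro _ ⟨g, rfl⟩
    rw [Subgroup.subgroupOf_map_subtype, inf_comm]
    exact h R hR g) hb

/-- Restricting traces from the subgroups in `𝒬` to `N`. -/
theorem traceIdeal_le_restrict {N : Subgroup G} {𝒬 : Set (Subgroup G)} {ℛ : Set (Subgroup N)}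
    (h : ∀ Q ∈ 𝒬, ∀ g : G, (MulAut.conj g • Q).subgroupOf N ∈ ℛ) :
    traceIdeal ρ 𝒬 ≤ traceIdeal (ρ.comp N.subtype) ℛ := fun a ha =>
  traceIdeal_induction (AddMonoidHom.id A) _ (fun Q hQ a ha => by
    refine traceIdeal_mono ?_ (relTrace_mem_traceIdeal_restrict N ha)
    rintro _ ⟨g, rfl⟩
    exact h Q hQ g) ha

end RelativeTrace

/-! ### The Green correspondence for interior `G`-algebras -/

section GreenAlgebra

variable {G : Type*} [Group G]

/-- The subgroups of the intersections `P ∩ ᵍP`, for `g ∉ N`. -/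
def greenX (P N : Subgroup G) : Set (Subgroup G) :=
  {Q | ∃ g : G, g ∉ N ∧ Q ≤ P ⊓ MulAut.conj g • P}

/-- The subgroups of the intersections `N ∩ ᵍP`, for `g ∉ N`. -/
def greenY (P N : Subgroup G) : Set (Subgroup N) :=
  {Q | ∃ g : G, g ∉ N ∧ Q ≤ (N ⊓ MulAut.conj g • P).subgroupOf N}

variable {A : Type*} [Ring A] [Finite G] {ρ : G →* A} {P N : Subgroup G}

/-- In Mackey's formula for $1=\mathrm{Tr}_P^G(c)$ the trivial double coset contributes
$b=\mathrm{Tr}_P^N(c)$; all others have $g\notin N$. -/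
theorem one_sub_relTrace_mem_greenY {c : A} (hc : IsFixed ρ P c) (h1 : relTrace ρ P c = 1) :
    1 - relTrace (ρ.comp N.subtype) (P.subgroupOf N) c ∈
      traceIdeal (ρ.comp N.subtype) (greenY P N) := by
  rw [← h1]
  refine traceIdeal_mono ?_ (relTrace_sub_mem_traceIdeal_restrict hc)
  rintro _ ⟨g, hg, rfl⟩
  refine ⟨g, hg, fun x hx => ?_⟩
  rw [Subgroup.mem_subgroupOf] at hx ⊢
  exact ⟨x.2, hx⟩

/-- Multiplication by $b=\mathrm{Tr}_P^N(c)$ cuts a subgroup of $N\cap{}^gP$ down to one of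
$P\cap{}^{ng}P$ with $n\in N$, and $ng\notin N$. -/
theorem relTrace_mul_mem_greenX {c y : A} (hc : IsFixed ρ P c)
    (hy : y ∈ traceIdeal (ρ.comp N.subtype) (greenY P N)) :
    relTrace ρ N (relTrace (ρ.comp N.subtype) (P.subgroupOf N) c * y) ∈
      traceIdeal ρ (greenX P N) := by
  refine relTrace_mem_of_mem_restrict
    (ℛ := {S | ∃ g : G, g ∉ N ∧ S.map N.subtype ≤ P ⊓ MulAut.conj g • P}) (fun R hR => hR)
    (relTrace_mul_mem_traceIdeal ?_ hc.restrict hy)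
  rintro R ⟨g, hg, hR⟩ n
  refine ⟨n * g, fun h => hg ((Subgroup.mul_mem_cancel_left N n.2).1 h), ?_⟩
  rintro _ ⟨x, ⟨hx, hx'⟩, rfl⟩
  refine ⟨hx, ?_⟩
  replace hx' : x ∈ MulAut.conj n • R := hx'
  rw [Subgroup.mem_pointwise_smul_iff_inv_smul_mem] at hx'
  have h2 : (((MulAut.conj n)⁻¹ • x : N) : G) ∈ MulAut.conj g • P :=
    (Subgroup.mem_subgroupOf.1 (hR hx')).2
  change (x : G) ∈ MulAut.conj ((n : G) * g) • P
  rw [map_mul, mul_smul, Subgroup.mem_pointwise_smul_iff_inv_smul_mem,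
    Subgroup.mem_pointwise_smul_iff_inv_smul_mem]
  rw [Subgroup.mem_pointwise_smul_iff_inv_smul_mem] at h2
  simpa using h2

/-- For $G$-fixed $x$ one has $x=\mathrm{Tr}_N^G(b)\,x=\mathrm{Tr}_N^G(bx)$, so the previous
estimate applies. -/
theorem mem_greenX_of_mem_greenY (hPN : P ≤ N) {c x : A} (hc : IsFixed ρ P c)
    (h1 : relTrace ρ P c = 1) (hx : IsFixed ρ ⊤ x)
    (hy : x ∈ traceIdeal (ρ.comp N.subtype) (greenY P N)) : x ∈ traceIdeal ρ (greenX P N) := by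
  have := relTrace_mul_mem_greenX hc hy
  rwa [relTrace_mul hx, relTrace_relTrace hPN hc, h1, one_mul] at this

/-- Modulo traces from `greenY`,
$\mathrm{Tr}_N^G(bx)=\mathrm{Tr}_P^G(cx)\equiv\mathrm{Tr}_P^N(cx)=bx\equiv x$. So an $N$-fixed
element is congruent to a $G$-fixed one. -/
theorem sub_relTrace_mul_mem_greenY (hPN : P ≤ N) {c x : A} (hc : IsFixed ρ P c)
    (h1 : relTrace ρ P c = 1) (hx : IsFixed ρ N x) :
    x - relTrace ρ N (relTrace (ρ.comp N.subtype) (P.subgroupOf N) c * x) ∈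
      traceIdeal (ρ.comp N.subtype) (greenY P N) := by
  have hx' := isFixed_restrict_top.2 hx
  have hcx : IsFixed ρ P (c * x) := hc.mul (hx.mono hPN)
  rw [← relTrace_mul hx', relTrace_relTrace hPN hcx]
  have h2 : relTrace ρ P (c * x) - relTrace (ρ.comp N.subtype) (P.subgroupOf N) (c * x) ∈
      traceIdeal (ρ.comp N.subtype) (greenY P N) := by
    refine traceIdeal_mono ?_ (relTrace_sub_mem_traceIdeal_restrict hcx)
    rintro _ ⟨g, hg, rfl⟩
    refine ⟨g, hg, fun y hy => ?_⟩
    rw [Subgroup.mem_subgroupOf] at hy ⊢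
    exact ⟨y.2, hy⟩
  have h3 := traceIdeal_mul_mem hx' (one_sub_relTrace_mem_greenY (N := N) hc h1)
  have h4 := sub_mem h3 h2
  rw [sub_mul, one_mul, ← relTrace_mul hx'] at h4
  simpa using h4

end GreenAlgebra

/-! ### Local fixed rings and vertices -/

section LocalFixed

variable {G : Type*} [Group G] {A : Type*} [Ring A]

/-- The fixed ring of an interior `G`-algebra is local. -/
structure HasLocalFixed (ρ : G →* A) : Prop where
  ne : (1 : A) ≠ 0
  isUnit_or : ∀ x y : A, IsFixed ρ ⊤ x → IsFixed ρ ⊤ y → x + y = 1 → IsUnit x ∨ IsUnit y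

variable {ρ : G →* A}

/-- Because of this, invertibility in $A$ and in the fixed ring agree, and locality can be phrased
with units of $A$. -/
theorem IsFixed.units_inv {Q : Subgroup G} {u : Aˣ} (h : IsFixed ρ Q (u : A)) :
    IsFixed ρ Q ((u⁻¹ : Aˣ) : A) := fun q hq => by
  rw [Units.mul_inv_eq_iff_eq_mul, mul_assoc, h q hq, Units.inv_mul_cancel_left]

theorem HasLocalFixed.isUnit_or_of_add (h : HasLocalFixed ρ) {x y : A} (hx : IsFixed ρ ⊤ x)
    (hy : IsFixed ρ ⊤ y) (hxy : IsUnit (x + y)) : IsUnit x ∨ IsUnit y := by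
  obtain ⟨u, hu⟩ := hxy
  have hu' : IsFixed ρ ⊤ ((u⁻¹ : Aˣ) : A) := IsFixed.units_inv (hu ▸ hx.add hy)
  have := h.isUnit_or _ _ (hu'.mul hx) (hu'.mul hy)
    (by rw [← mul_add, ← hu, Units.inv_mul])
  simpa using this

variable [Finite G]

theorem mem_traceIdeal_singleton {Q : Subgroup G} {x : A} :
    x ∈ traceIdeal ρ {Q} ↔ ∃ a, IsFixed ρ Q a ∧ relTrace ρ Q a = x := by
  constructor
  · intro h
    induction h using AddSubgroup.closure_induction with
    | mem x hx => obtain ⟨_, rfl, a, ha, rfl⟩ := hx; exact ⟨a, ha, rfl⟩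
    | zero => exact ⟨0, fun _ _ => by simp, relTrace_zero⟩
    | add x y _ _ hx hy =>
      obtain ⟨a, ha, rfl⟩ := hx
      obtain ⟨b, hb, rfl⟩ := hy
      exact ⟨a + b, ha.add hb, relTrace_add a b⟩
    | neg x _ hx =>
      obtain ⟨a, ha, rfl⟩ := hx
      exact ⟨-a, fun q hq => by simp [ha q hq], relTrace_neg a⟩
  · rintro ⟨a, ha, rfl⟩
    exact relTrace_mem_traceIdeal (Set.mem_singleton _) ha

theorem one_mem_traceIdeal_of_isUnit {𝒬 : Set (Subgroup G)} {x : A} (hx : x ∈ traceIdeal ρ 𝒬)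
    (hu : IsUnit x) : (1 : A) ∈ traceIdeal ρ 𝒬 := by
  obtain ⟨u, rfl⟩ := hu
  have h := mul_mem_traceIdeal (IsFixed.units_inv (isFixed_of_mem_traceIdeal hx)) hx
  rwa [Units.inv_mul] at h

/-- Rosenberg's lemma. -/
theorem HasLocalFixed.exists_one_mem (h : HasLocalFixed ρ) {𝒬 : Set (Subgroup G)}
    (h1 : (1 : A) ∈ traceIdeal ρ 𝒬) : ∃ Q ∈ 𝒬, (1 : A) ∈ traceIdeal ρ {Q} := by
  by_contra! hcon
  -- In a local ring the nonunits are closed under addition, so if no single trace is a unit then no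
  -- sum of traces is.
  have key : ∀ x ∈ traceIdeal ρ 𝒬, ¬ IsUnit x := by
    intro x hx
    induction hx using AddSubgroup.closure_induction with
    | mem x hx =>
      obtain ⟨Q, hQ, a, ha, rfl⟩ := hx
      exact fun hu => hcon Q hQ
        (one_mem_traceIdeal_of_isUnit (relTrace_mem_traceIdeal (Set.mem_singleton _) ha) hu)
    | zero =>
      rw [isUnit_zero_iff]
      exact fun h0 => h.ne h0.symm
    | add x y hx hy ihx ihy =>
      exact fun hu => (h.isUnit_or_of_add (isFixed_of_mem_traceIdeal hx)
        (isFixed_of_mem_traceIdeal hy) hu).elim ihx ihy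
    | neg x _ ih => simpa using ih
  exact key 1 h1 isUnit_one

variable (ρ) in
/-- `P` is a minimal subgroup whose relative trace map is surjective. -/
def IsTraceVertex (P : Subgroup G) : Prop := Minimal (fun Q => (1 : A) ∈ traceIdeal ρ {Q}) P

/-- Multiplying $\mathrm{Tr}_P(a)=1$ by a trace from $Q$ equal to $1$ shows that $1$ is a trace from
some $P\cap{}^gQ$; minimality makes this all of $P$. -/
theorem HasLocalFixed.exists_le_conj (h : HasLocalFixed ρ) {P : Subgroup G}
    (hP : IsTraceVertex ρ P) {𝒬 : Set (Subgroup G)} (h1 : (1 : A) ∈ traceIdeal ρ 𝒬) :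
    ∃ Q ∈ 𝒬, ∃ g : G, P ≤ MulAut.conj g • Q := by
  obtain ⟨Q, hQ, hQ1⟩ := h.exists_one_mem h1
  obtain ⟨a, ha, ha1⟩ := mem_traceIdeal_singleton.1 hP.1
  have h2 := relTrace_mul_mem_traceIdeal (𝒬 := {R | ∃ g : G, R = P ⊓ MulAut.conj g • Q})
    (fun R hR g => ⟨g, by rw [Set.mem_singleton_iff.1 hR]⟩) ha hQ1
  rw [ha1, one_mul] at h2
  obtain ⟨_, ⟨g, rfl⟩, h3⟩ := h.exists_one_mem h2
  exact ⟨Q, hQ, g, (hP.2 h3 inf_le_left).trans inf_le_right⟩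

theorem Subgroup.mem_normalizer_of_le_conj {P : Subgroup G} {g : G}
    (h : P ≤ MulAut.conj g • P) : g ∈ Subgroup.normalizer (P : Set G) := by
  have heq : P = MulAut.conj g • P := by
    refine SetLike.coe_injective (Set.eq_of_subset_of_ncard_le h ?_ (Set.toFinite _))
    rw [Subgroup.coe_pointwise_smul, Set.ncard_smul_set]
  rw [Subgroup.mem_normalizer_iff]
  intro x
  conv_rhs => rw [heq, Subgroup.mem_pointwise_smul_iff_inv_smul_mem]
  simp [mul_assoc]

/-- Otherwise Rosenberg's lemma and minimality give $P\le{}^gP$ with $g\notin N$, whereas such a $g$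
normalizes the finite group $P$. -/
theorem HasLocalFixed.one_notMem_greenX {P N : Subgroup G}
    (hPN : Subgroup.normalizer (P : Set G) ≤ N) (h : HasLocalFixed ρ) (hP : IsTraceVertex ρ P) :
    (1 : A) ∉ traceIdeal ρ (greenX P N) := by
  intro h1
  obtain ⟨Q, ⟨g, hg, hQ⟩, h2⟩ := h.exists_one_mem h1
  have h3 : P ≤ Q := hP.2 h2 (hQ.trans inf_le_left)
  exact hg (hPN (Subgroup.mem_normalizer_of_le_conj (h3.trans (hQ.trans inf_le_right))))

end LocalFixed

/-! ### Relative projectivity and relative traces -/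

section Intertwines

variable {O : Type*} [CommRing O] {G : Type*} [Group G]
  {V W X : Type*} [AddCommGroup V] [Module O V] [AddCommGroup W] [Module O W]
  [AddCommGroup X] [Module O X]
  {ρ : Representation O G V} {σ : Representation O G W} {τ : Representation O G X}

variable (ρ σ) in
/-- The linear map `f` commutes with the actions of `G`. -/
def Intertwines (f : V →ₗ[O] W) : Prop := ∀ g, f ∘ₗ ρ g = σ g ∘ₗ f

theorem Intertwines.apply {f : V →ₗ[O] W} (hf : Intertwines ρ σ f) (g : G) (v : V) :
    f (ρ g v) = σ g (f v) := LinearMap.congr_fun (hf g) v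

theorem Intertwines.comp {f : V →ₗ[O] W} {f' : W →ₗ[O] X} (hf' : Intertwines σ τ f')
    (hf : Intertwines ρ σ f) : Intertwines ρ τ (f' ∘ₗ f) := fun g => by
  ext v
  simp [hf.apply, hf'.apply]

theorem Intertwines.restrict {f : V →ₗ[O] W} (hf : Intertwines ρ σ f) (N : Subgroup G) :
    Intertwines (ρ.comp N.subtype) (σ.comp N.subtype) f := fun n => hf n

theorem Representation.Equiv.intertwines (e : ρ.Equiv σ) :
    Intertwines ρ σ (e.toLinearEquiv : V →ₗ[O] W) := e.isIntertwining'

theorem Representation.Equiv.intertwines_symm (e : ρ.Equiv σ) :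
    Intertwines σ ρ (e.toLinearEquiv.symm : W →ₗ[O] V) := e.symm.isIntertwining'

theorem Subrepresentation.intertwines_subtype (W : Subrepresentation ρ) :
    Intertwines W.toRepresentation ρ W.toSubmodule.subtype := fun _ => rfl

theorem intertwines_self_iff {a : V →ₗ[O] V} :
    Intertwines ρ ρ a ↔ IsFixed (A := Module.End O V) ρ ⊤ a :=
  ⟨fun h g _ => (h g).symm, fun h g => (h g trivial).symm⟩

/-- The subalgebra of `G`-endomorphisms. -/
def fixedSubalgebra (ρ : Representation O G V) : Subalgebra O (Module.End O V) :=
  Subalgebra.centralizer O (Set.range ρ)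

theorem mem_fixedSubalgebra {a : Module.End O V} : a ∈ fixedSubalgebra ρ ↔ Intertwines ρ ρ a := by
  rw [fixedSubalgebra, Subalgebra.mem_centralizer_iff, Set.forall_mem_range]
  exact forall_congr' fun g => eq_comm

theorem conjOut_comp {Q : Subgroup G} {i : V →ₗ[O] W} {r : W →ₗ[O] V} (hi : Intertwines ρ σ i)
    (hr : Intertwines σ ρ r) (a : Module.End O W) (x : G ⧸ Q) :
    conjOut (A := Module.End O V) ρ Q (r ∘ₗ a ∘ₗ i) x =
      r ∘ₗ conjOut (A := Module.End O W) σ Q a x ∘ₗ i := by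
  ext v
  simp [conjOut, hi.apply, hr.apply]

theorem isFixed_comp {Q : Subgroup G} {i : V →ₗ[O] W} {r : W →ₗ[O] V} (hi : Intertwines ρ σ i)
    (hr : Intertwines σ ρ r) {a : Module.End O W} (ha : IsFixed (A := Module.End O W) σ Q a) :
    IsFixed (A := Module.End O V) ρ Q (r ∘ₗ a ∘ₗ i) := fun q hq => by
  ext v
  have := LinearMap.congr_fun (ha q hq) (i v)
  simp only [Module.End.mul_apply] at this
  simp [← hr.apply, hi.apply, this]

variable [Finite G]

theorem relTrace_comp {Q : Subgroup G} {i : V →ₗ[O] W} {r : W →ₗ[O] V} (hi : Intertwines ρ σ i)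
    (hr : Intertwines σ ρ r) (a : Module.End O W) :
    relTrace (A := Module.End O V) ρ Q (r ∘ₗ a ∘ₗ i) =
      r ∘ₗ relTrace (A := Module.End O W) σ Q a ∘ₗ i := by
  simp only [relTrace, conjOut_comp hi hr]
  ext v
  simp

/-- Transport of trace ideals along maps into and out of another module. -/
theorem comp_mem_traceIdeal {𝒬 : Set (Subgroup G)} {i : V →ₗ[O] W} {r : W →ₗ[O] V}
    (hi : Intertwines ρ σ i) (hr : Intertwines σ ρ r) {a : Module.End O W}
    (ha : a ∈ traceIdeal (A := Module.End O W) σ 𝒬) :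
    r ∘ₗ a ∘ₗ i ∈ traceIdeal (A := Module.End O V) ρ 𝒬 :=
  traceIdeal_induction (AddMonoidHom.mk' (fun a : Module.End O W => (r ∘ₗ a ∘ₗ i : Module.End O V))
    fun a b => by ext; simp) _ (fun Q hQ a ha => by
      rw [AddMonoidHom.mk'_apply, ← relTrace_comp hi hr]
      exact relTrace_mem_traceIdeal hQ (isFixed_comp hi hr ha)) ha

/-- Relative projectivity passes to direct summands, in the form used throughout. -/
theorem one_mem_traceIdeal_of_retract {𝒬 : Set (Subgroup G)} {i : V →ₗ[O] W} {r : W →ₗ[O] V}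
    (hi : Intertwines ρ σ i) (hr : Intertwines σ ρ r) (hri : r ∘ₗ i = LinearMap.id)
    (h : (1 : Module.End O W) ∈ traceIdeal (A := Module.End O W) σ 𝒬) :
    (1 : Module.End O V) ∈ traceIdeal (A := Module.End O V) ρ 𝒬 := by
  have := comp_mem_traceIdeal hi hr h
  rwa [Module.End.one_eq_id, LinearMap.id_comp, hri] at this

variable (ρ σ) in
/-- The relative trace of a linear map between two modules. -/
noncomputable def homTrace (Q : Subgroup G) (a : V →ₗ[O] W) : V →ₗ[O] W :=
  letI := Fintype.ofFinite (G ⧸ Q)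
  ∑ x : G ⧸ Q, σ x.out ∘ₗ a ∘ₗ ρ x.out⁻¹

theorem intertwines_homTrace {Q : Subgroup G} {a : V →ₗ[O] W}
    (ha : ∀ q ∈ Q, a ∘ₗ ρ q = σ q ∘ₗ a) : Intertwines ρ σ (homTrace ρ σ Q a) := by
  have key : ∀ (g : G), ∀ q ∈ Q, σ (g * q) ∘ₗ a ∘ₗ ρ (g * q)⁻¹ = σ g ∘ₗ a ∘ₗ ρ g⁻¹ := by
    intro g q hq
    ext v
    have := LinearMap.congr_fun (ha q hq) (ρ (g * q)⁻¹ v)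
    simp only [LinearMap.comp_apply] at this ⊢
    rw [map_mul σ, Module.End.mul_apply, ← this, ← Module.End.mul_apply, ← map_mul]
    simp
  intro h
  ext v
  simp only [homTrace, LinearMap.comp_apply, LinearMap.sum_apply, map_sum]
  let := Fintype.ofFinite (G ⧸ Q)
  refine (Fintype.sum_equiv (MulAction.toPerm h) _ _ fun x => ?_).symm
  obtain ⟨q, hq⟩ := QuotientGroup.mk_out_eq_mul Q (h * x.out)
  have h1 : (MulAction.toPerm h x).out = h * x.out * q := by
    rw [← hq]
    congr 1
    rw [MulAction.toPerm_apply, ← smul_eq_mul, ← MulAction.Quotient.smul_coe, QuotientGroup.out_eq']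
  rw [h1]
  have h2 := LinearMap.congr_fun (key (h * x.out) q q.2) (ρ h v)
  simp only [LinearMap.comp_apply] at h2
  rw [h2, mul_inv_rev, map_mul σ, map_mul ρ, Module.End.mul_apply, Module.End.mul_apply]
  simp

/-- Averaging produces $G$-maps into another module whose composite back is a prescribed relative
trace. This yields the splittings into induced modules. -/
theorem comp_homTrace {Q : Subgroup G} (a : V →ₗ[O] W) {b : W →ₗ[O] V} (hb : Intertwines σ ρ b) :
    b ∘ₗ homTrace ρ σ Q a = relTrace (A := Module.End O V) ρ Q (b ∘ₗ a) := by
  ext v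
  simp [homTrace, relTrace, conjOut, hb.apply]

end Intertwines

/-! ### Direct summands and idempotent endomorphisms -/

section Summands

variable {O : Type*} [CommRing O] {G : Type*} [Group G]
  {V W : Type*} [AddCommGroup V] [Module O V] [AddCommGroup W] [Module O W]
  {ρ : Representation O G V} {σ : Representation O G W}

theorem Subrepresentation.isCompl_iff {W W' : Subrepresentation ρ} :
    IsCompl W W' ↔ IsCompl W.toSubmodule W'.toSubmodule := by
  simp only [_root_.isCompl_iff, disjoint_iff, codisjoint_iff, Subrepresentation.ext_iff,
    Subrepresentation.toSubmodule_sup, Subrepresentation.toSubmodule_inf]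
  rfl

/-- The image of a `G`-endomorphism. -/
def rangeRep (f : Module.End O V) (hf : Intertwines ρ ρ f) : Subrepresentation ρ where
  toSubmodule := LinearMap.range f
  apply_mem_toSubmodule g := by
    rintro _ ⟨v, rfl⟩
    exact ⟨ρ g v, hf.apply g v⟩

theorem intertwines_rangeRestrict {f : Module.End O V} (hf : Intertwines ρ ρ f) :
    Intertwines ρ (rangeRep f hf).toRepresentation f.rangeRestrict := fun g => by
  ext v
  exact hf.apply g v

theorem apply_of_mem_range {f : Module.End O V} (hff : f * f = f) {v : V}
    (hv : v ∈ LinearMap.range f) : f v = v := by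
  obtain ⟨w, rfl⟩ := hv
  rw [← Module.End.mul_apply, hff]

theorem rangeRestrict_comp_subtype {f : Module.End O V} (hff : f * f = f) :
    f.rangeRestrict ∘ₗ (LinearMap.range f).subtype = LinearMap.id := by
  ext v
  exact apply_of_mem_range hff v.2

theorem Intertwines.projection {W W' : Subrepresentation ρ}
    (h : IsCompl W.toSubmodule W'.toSubmodule) :
    Intertwines ρ W.toRepresentation (W.toSubmodule.projectionOnto W'.toSubmodule h) := fun g => by
  ext v
  obtain ⟨a, ha, b, hb, rfl⟩ := Submodule.mem_sup.1 (h.sup_eq_top ▸ Submodule.mem_top (x := v))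
  have h1 := W.apply_mem_toSubmodule g ha
  have h2 := W'.apply_mem_toSubmodule g hb
  have e1 := Submodule.projectionOnto_apply_of_mem_left h ha
  have e2 := Submodule.projectionOnto_apply_of_mem_left h h1
  have e3 := (Submodule.projectionOnto_apply_eq_zero_iff h).2 hb
  have e4 := (Submodule.projectionOnto_apply_eq_zero_iff h).2 h2
  simp [e1, e2, e3, e4, Subrepresentation.toRepresentation]

theorem isIndecomposable_iff : IsIndecomposable ρ ↔ Nontrivial V ∧
    ∀ g : Module.End O V, Intertwines ρ ρ g → g * g = g → g = 0 ∨ g = 1 := by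
  refine and_congr_right fun _ => ⟨fun h g hg hgg => ?_, fun h W W' hW => ?_⟩
  · have hg' : Intertwines ρ ρ (1 - g : Module.End O V) := fun x => by
      have := hg x
      ext v
      simp [hg.apply]
    have hc : IsCompl (rangeRep g hg) (rangeRep (1 - g : Module.End O V) hg') := by
      rw [Subrepresentation.isCompl_iff]
      refine ⟨Submodule.disjoint_def.2 ?_, codisjoint_iff.2 (eq_top_iff.2 fun v _ => ?_)⟩
      · rintro v hv ⟨w, rfl⟩
        rw [← apply_of_mem_range hgg hv, ← Module.End.mul_apply, mul_sub, hgg, mul_one, sub_self]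
        rfl
      · exact Submodule.mem_sup.2 ⟨g v, ⟨v, rfl⟩, (1 - g : Module.End O V) v, ⟨v, rfl⟩, by simp⟩
    rcases h _ _ hc with h | h
    · left
      exact LinearMap.range_eq_bot.1 (congrArg Subrepresentation.toSubmodule h)
    · right
      have := LinearMap.range_eq_bot.1 (congrArg Subrepresentation.toSubmodule h)
      exact (sub_eq_zero.1 this).symm
  · rw [Subrepresentation.isCompl_iff] at hW
    have hp := Intertwines.projection hW
    have h1 := W.intertwines_subtype.comp hp
    rcases h (W.toSubmodule.projection W'.toSubmodule hW) h1
      (Submodule.isIdempotentElem_projection hW) with h | h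
    · left
      refine Subrepresentation.ext ?_
      rw [← Submodule.range_projection hW, h, LinearMap.range_zero]
      rfl
    · right
      refine Subrepresentation.ext ?_
      rw [← Submodule.ker_projection hW, h]
      exact LinearMap.ker_id

/-- $ir$ is an idempotent endomorphism of the indecomposable module, and it is nonzero because
$W\ne0$. -/
theorem IsIndecomposable.of_retract (hV : IsIndecomposable ρ) {i : W →ₗ[O] V} {r : V →ₗ[O] W}
    (hi : Intertwines σ ρ i) (hr : Intertwines ρ σ r) (hri : r ∘ₗ i = LinearMap.id)
    [Nontrivial W] : i ∘ₗ r = LinearMap.id := by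
  have h : ∀ w, r (i w) = w := LinearMap.congr_fun hri
  rcases (isIndecomposable_iff.1 hV).2 (i ∘ₗ r) (hi.comp hr) (by ext v; simp [h]) with h0 | h0
  · exfalso
    obtain ⟨w, hw⟩ := exists_ne (0 : W)
    have := LinearMap.congr_fun h0 (i w)
    simp only [LinearMap.comp_apply, h, LinearMap.zero_apply] at this
    exact hw (by rw [← h w, this, map_zero])
  · exact h0

/-- An idempotent $g$ of the $G$-endomorphisms of $fV$ extends by zero on $(1-f)V$ to a $G$-fixed
idempotent below $f$. -/
theorem IsPrimitiveIdem.isIndecomposable {f : Module.End O V}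
    (hf : IsPrimitiveIdem (fixedSubalgebra ρ) f) :
    IsIndecomposable (rangeRep f (mem_fixedSubalgebra.1 hf.mem)).toRepresentation := by
  have hfi := mem_fixedSubalgebra.1 hf.mem
  have hi := (rangeRep f hfi).intertwines_subtype
  have hr := intertwines_rangeRestrict hfi
  have hri := rangeRestrict_comp_subtype hf.idem
  have hir : (LinearMap.range f).subtype ∘ₗ f.rangeRestrict = f := rfl
  rw [isIndecomposable_iff]
  refine ⟨?_, fun g hg hgg => ?_⟩
  · change Nontrivial (LinearMap.range f)
    rw [Submodule.nontrivial_iff_ne_bot, Ne, LinearMap.range_eq_bot]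
    exact hf.ne_zero
  · change Module.End O (LinearMap.range f) at g
    have hgg' : ∀ v, g (g v) = g v := LinearMap.congr_fun hgg
    have hrx : ∀ v : LinearMap.range f, f.rangeRestrict v = v := LinearMap.congr_fun hri
    rcases hf.eq_or ((LinearMap.range f).subtype ∘ₗ g ∘ₗ f.rangeRestrict)
      (mem_fixedSubalgebra.2 (hi.comp (Intertwines.comp hg hr)))
      (by
        ext v
        change (g (f.rangeRestrict (g (f.rangeRestrict v) : V)) : V) = g (f.rangeRestrict v)
        rw [hrx, hgg'])
      (by
        ext v
        exact apply_of_mem_range hf.idem (g (f.rangeRestrict v)).2)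
      (by
        ext v
        change (g (f.rangeRestrict (f.rangeRestrict v : V)) : V) = g (f.rangeRestrict v)
        rw [hrx]) with h | h
    · left
      ext v
      have := LinearMap.congr_fun h (v : V)
      simp only [LinearMap.comp_apply, hrx] at this
      exact this
    · right
      ext v
      have := LinearMap.congr_fun h (v : V)
      simp only [LinearMap.comp_apply, hrx] at this
      exact this.trans (apply_of_mem_range hf.idem v.2)

theorem isDirectSummand_iff : IsDirectSummand ρ σ ↔ ∃ (i : V →ₗ[O] W) (r : W →ₗ[O] V),
    Intertwines ρ σ i ∧ Intertwines σ ρ r ∧ r ∘ₗ i = LinearMap.id := by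
  constructor
  · rintro ⟨X, X', hX, ⟨e⟩⟩
    rw [Subrepresentation.isCompl_iff] at hX
    refine ⟨X.toSubmodule.subtype ∘ₗ e.toLinearEquiv, e.toLinearEquiv.symm ∘ₗ
      X.toSubmodule.projectionOnto X'.toSubmodule hX, X.intertwines_subtype.comp e.intertwines,
      e.intertwines_symm.comp (Intertwines.projection hX), ?_⟩
    ext v
    simp only [LinearMap.comp_apply, LinearEquiv.coe_coe, Submodule.subtype_apply,
      Submodule.projectionOnto_apply_left]
    exact e.toLinearEquiv.symm_apply_apply v
  · rintro ⟨i, r, hi, hr, hri⟩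
    have h : ∀ v, r (i v) = v := LinearMap.congr_fun hri
    let K : Subrepresentation σ := ⟨LinearMap.ker r, fun g v hv => by
      rw [LinearMap.mem_ker] at hv ⊢; rw [hr.apply, hv, map_zero]⟩
    let R : Subrepresentation σ := ⟨LinearMap.range i, by
      rintro g _ ⟨v, rfl⟩; exact ⟨ρ g v, hi.apply g v⟩⟩
    refine ⟨R, K, ?_, ⟨Representation.Equiv.mk (LinearEquiv.ofInjective i fun a b hab => by
      rw [← h a, hab, h]) fun g => ?_⟩⟩
    · rw [Subrepresentation.isCompl_iff]
      refine ⟨Submodule.disjoint_def.2 ?_, codisjoint_iff.2 (eq_top_iff.2 fun w _ => ?_)⟩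
      · rintro _ ⟨v, rfl⟩ hv
        have : r (i v) = 0 := hv
        rw [← h v, this, map_zero]
      · refine Submodule.mem_sup.2 ⟨i (r w), ⟨_, rfl⟩, w - i (r w), ?_, by simp⟩
        change r (w - i (r w)) = 0
        rw [map_sub, h, sub_self]
    · ext v
      exact hi.apply g v

end Summands

/-! ### Induced modules -/

section Induced

open Representation

variable {O : Type*} [CommRing O] {G : Type*} [Group G] {N : Subgroup G}
  {V W : Type*} [AddCommGroup V] [Module O V] [AddCommGroup W] [Module O W]
  (τ : Representation O N V) {ρ : Representation O G W}

theorem IndV.mk_mul_apply (g : G) (n : N) (m : V) :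
    IndV.mk N.subtype τ ((n : G) * g) (τ n m) = IndV.mk N.subtype τ g m := by
  have := Coinvariants.mk_self_apply
    (Representation.tprod ((leftRegular O G).comp N.subtype) τ) n
    (TensorProduct.tmul O (MonoidAlgebra.single g 1) m)
  simpa using this

theorem ind_apply_mk (g h : G) (m : V) :
    Representation.ind N.subtype τ g (IndV.mk N.subtype τ h m) =
      IndV.mk N.subtype τ (h * g⁻¹) m := ind_mk _ _ _ _ _

/-- The linear map out of an induced module given by a compatible family of linear maps. -/
noncomputable def indLift (f : G → V →ₗ[O] W)
    (hf : ∀ (n : N) g m, f ((n : G) * g) (τ n m) = f g m) : IndV N.subtype τ →ₗ[O] W :=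
  Coinvariants.lift _
    (TensorProduct.lift ((Finsupp.lift _ _ _ f) ∘ₗ
      (MonoidAlgebra.coeffLinearEquiv O).toLinearMap))
    fun n => by
      ext g m
      simpa using hf n g m

theorem indLift_mk (f : G → V →ₗ[O] W)
    (hf : ∀ (n : N) g m, f ((n : G) * g) (τ n m) = f g m) (g : G) (m : V) :
    indLift τ f hf (IndV.mk N.subtype τ g m) = f g m := by
  simp [indLift]

/-- The map out of an induced module given by Frobenius reciprocity. -/
noncomputable def indCounit (f : V →ₗ[O] W) (hf : Intertwines τ (ρ.comp N.subtype) f) :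
    IndV N.subtype τ →ₗ[O] W :=
  indLift τ (fun g => ρ g⁻¹ ∘ₗ f) fun n g m => by
    have := hf.apply n m
    simp only [LinearMap.comp_apply, this, mul_inv_rev, map_mul]
    simp

theorem indCounit_mk (f : V →ₗ[O] W) (hf : Intertwines τ (ρ.comp N.subtype) f) (g : G) (m : V) :
    indCounit τ f hf (IndV.mk N.subtype τ g m) = ρ g⁻¹ (f m) := indLift_mk _ _ _ _ _

theorem intertwines_indCounit (f : V →ₗ[O] W) (hf : Intertwines τ (ρ.comp N.subtype) f) :
    Intertwines (Representation.ind N.subtype τ) ρ (indCounit τ f hf) := fun g => by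
  refine IndV.hom_ext _ _ fun h => LinearMap.ext fun m => ?_
  change indCounit τ f hf (Representation.ind N.subtype τ g (IndV.mk N.subtype τ h m)) =
    ρ g (indCounit τ f hf (IndV.mk N.subtype τ h m))
  rw [ind_apply_mk, indCounit_mk, indCounit_mk, mul_inv_rev, inv_inv, map_mul,
    Module.End.mul_apply]

open Classical in
/-- The projection of an induced module onto the given module. -/
noncomputable def indRetract : IndV N.subtype τ →ₗ[O] V :=
  indLift τ (fun g => if h : g ∈ N then τ ⟨g, h⟩⁻¹ else 0) fun n g m => by
    by_cases h : g ∈ N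
    · have h' : (n : G) * g ∈ N := N.mul_mem n.2 h
      rw [dif_pos h, dif_pos h', ← Module.End.mul_apply, ← map_mul]
      congr 2
      ext
      simp
    · rw [dif_neg h, dif_neg fun h' => h ((N.mul_mem_cancel_left n.2).1 h')]
      simp

theorem indRetract_mk_of_mem {g : G} (h : g ∈ N) (m : V) :
    indRetract τ (IndV.mk N.subtype τ g m) = τ ⟨g, h⟩⁻¹ m := by
  rw [indRetract, indLift_mk, dif_pos h]

theorem indRetract_mk_of_notMem {g : G} (h : g ∉ N) (m : V) :
    indRetract τ (IndV.mk N.subtype τ g m) = 0 := by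
  rw [indRetract, indLift_mk, dif_neg h, LinearMap.zero_apply]

theorem indRetract_comp_mk_one : indRetract τ ∘ₗ IndV.mk N.subtype τ 1 = LinearMap.id := by
  refine LinearMap.ext fun m => ?_
  refine (indRetract_mk_of_mem τ N.one_mem m).trans ?_
  have : (⟨1, N.one_mem⟩ : N)⁻¹ = 1 := by simp
  rw [this, map_one]
  rfl

theorem intertwines_indRetract : Intertwines ((Representation.ind N.subtype τ).comp N.subtype) τ
    (indRetract τ) := fun n => by
  refine IndV.hom_ext _ _ fun g => LinearMap.ext fun m => ?_
  change indRetract τ (Representation.ind N.subtype τ (n : G) (IndV.mk N.subtype τ g m)) =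
    τ n (indRetract τ (IndV.mk N.subtype τ g m))
  rw [ind_apply_mk]
  by_cases h : g ∈ N
  · have h' : g * (n : G)⁻¹ ∈ N := N.mul_mem h (N.inv_mem n.2)
    rw [indRetract_mk_of_mem τ h, indRetract_mk_of_mem τ h', ← Module.End.mul_apply, ← map_mul]
    congr 2
    ext
    simp
  · rw [indRetract_mk_of_notMem τ h, indRetract_mk_of_notMem τ
      fun h' => h ((N.mul_mem_cancel_right (N.inv_mem n.2)).1 h'), map_zero]

theorem intertwines_indMk_one : Intertwines τ ((Representation.ind N.subtype τ).comp N.subtype)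
    (IndV.mk N.subtype τ 1) := fun n => by
  refine LinearMap.ext fun m => ?_
  change IndV.mk N.subtype τ 1 (τ n m) =
    Representation.ind N.subtype τ (n : G) (IndV.mk N.subtype τ 1 m)
  rw [ind_apply_mk, ← IndV.mk_mul_apply τ _ n m]
  simp

theorem isFixed_indProjection : IsFixed (A := Module.End O (IndV N.subtype τ))
    (Representation.ind N.subtype τ) N (IndV.mk N.subtype τ 1 ∘ₗ indRetract τ) := by
  have h := (intertwines_indMk_one τ).comp (intertwines_indRetract τ)
  exact isFixed_restrict_top.1 (intertwines_self_iff.1 h)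

variable [Finite G]

theorem relTrace_indProjection : relTrace (A := Module.End O (IndV N.subtype τ))
    (Representation.ind N.subtype τ) N (IndV.mk N.subtype τ 1 ∘ₗ indRetract τ) = 1 := by
  refine IndV.hom_ext _ _ fun g => LinearMap.ext fun m => ?_
  let := Fintype.ofFinite (G ⧸ N)
  -- In this convention `IndV.mk g m` stands for $g^{-1}\otimes m$, so only the projection attached
  -- to the coset $g^{-1}N$ sees it.
  rw [relTrace_eq_sum, LinearMap.comp_apply, LinearMap.sum_apply,
    Fintype.sum_eq_single ((g⁻¹ : G) : G ⧸ N)]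
  · rw [conjOut_mk (isFixed_indProjection τ)]
    change Representation.ind N.subtype τ g⁻¹ (IndV.mk N.subtype τ 1 (indRetract τ
      (Representation.ind N.subtype τ g⁻¹⁻¹ (IndV.mk N.subtype τ g m)))) = _
    rw [ind_apply_mk τ g⁻¹⁻¹, inv_inv, mul_inv_cancel]
    have := LinearMap.congr_fun (indRetract_comp_mk_one τ) m
    rw [LinearMap.comp_apply] at this
    rw [this, ind_apply_mk]
    simp
  · intro x hx
    change Representation.ind N.subtype τ x.out (IndV.mk N.subtype τ 1 (indRetract τ
      (Representation.ind N.subtype τ x.out⁻¹ (IndV.mk N.subtype τ g m)))) = 0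
    rw [ind_apply_mk τ x.out⁻¹, inv_inv, indRetract_mk_of_notMem, map_zero, map_zero]
    intro h
    refine hx ?_
    rw [← QuotientGroup.out_eq' x, eq_comm, QuotientGroup.eq, inv_inv]
    exact h

/-- Higman's criterion. -/
theorem isRelProjective_iff {V : Type w} [AddCommGroup V] [Module O V] [Module.Finite O V]
    {ρ : Representation O G V} {Q : Subgroup G} : IsRelProjective ρ Q ↔
      (1 : Module.End O V) ∈ traceIdeal (A := Module.End O V) ρ {Q} := by
  constructor
  · rintro ⟨W, _, _, _, τ, h⟩
    obtain ⟨i, r, hi, hr, hri⟩ := isDirectSummand_iff.1 h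
    exact one_mem_traceIdeal_of_retract hi hr hri
      (mem_traceIdeal_singleton.2 ⟨_, isFixed_indProjection τ, relTrace_indProjection τ⟩)
  · intro h
    obtain ⟨a, ha, ha1⟩ := mem_traceIdeal_singleton.1 h
    have hid : Intertwines (ρ.comp Q.subtype) (ρ.comp Q.subtype) LinearMap.id := fun _ => rfl
    have hb := intertwines_indCounit (ρ := ρ) (ρ.comp Q.subtype) LinearMap.id hid
    -- The counit $\mathrm{Ind}\,\mathrm{Res}\,V\to V$ is split by the averaged map $v\mapsto
    -- 1\otimes a(v)$: the composite is $\mathrm{Tr}_Q^G(a)=1$.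
    refine ⟨V, _, _, inferInstance, ρ.comp Q.subtype, isDirectSummand_iff.2
      ⟨homTrace ρ _ Q (IndV.mk Q.subtype (ρ.comp Q.subtype) 1 ∘ₗ a), indCounit _ _ hid,
        intertwines_homTrace fun q hq => ?_, hb, ?_⟩⟩
    · refine LinearMap.ext fun v => ?_
      have h1 := LinearMap.congr_fun (ha q hq) v
      have h2 := (intertwines_indMk_one (ρ.comp Q.subtype)).apply ⟨q, hq⟩ (a v)
      change IndV.mk Q.subtype (ρ.comp Q.subtype) 1 (a (ρ q v)) = _
      exact (congrArg _ h1.symm).trans h2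
    · rw [comp_homTrace _ hb]
      refine Eq.trans (congrArg _ (LinearMap.ext fun v => ?_)) ha1
      change indCounit _ _ hid (IndV.mk Q.subtype (ρ.comp Q.subtype) 1 (a v)) = a v
      rw [indCounit_mk]
      simp

theorem isVertex_iff {V : Type w} [AddCommGroup V] [Module O V] [Module.Finite O V]
    {ρ : Representation O G V} {Q : Subgroup G} : IsVertex ρ Q ↔
      IsTraceVertex (A := Module.End O V) ρ Q := by
  unfold IsVertex IsTraceVertex
  have : IsRelProjective ρ = fun Q => (1 : Module.End O V) ∈
      traceIdeal (A := Module.End O V) ρ {Q} := funext fun Q => propext isRelProjective_iff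
  rw [this]

end Induced

/-! ### Direct sums of indecomposable modules -/

section Decompositions

variable {O : Type*} [CommRing O] {G : Type*} [Group G]
  {V : Type w} [AddCommGroup V] [Module O V] {ρ : Representation O G V}

theorem IsIndecomposable.isPrimitiveIdem (h : IsIndecomposable ρ) :
    IsPrimitiveIdem (fixedSubalgebra ρ) 1 := by
  obtain ⟨hV, h⟩ := isIndecomposable_iff.1 h
  exact ⟨one_mem _, one_mul 1, one_ne_zero, fun g hg hgg _ _ => h g (mem_fixedSubalgebra.1 hg) hgg⟩

/-- The endomorphism ring of an indecomposable module is local. -/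
theorem IsIndecomposable.hasLocalFixed [IsNoetherianRing O] [IsLocalRing O]
    [IsAdicComplete (IsLocalRing.maximalIdeal O) O] [Module.Finite O V] (h : IsIndecomposable ρ) :
    HasLocalFixed (A := Module.End O V) ρ where
  ne := h.isPrimitiveIdem.ne_zero
  isUnit_or x y hx _ hxy := by
    rcases h.isPrimitiveIdem.isUnit_or_isTopNilpotent
      (mem_fixedSubalgebra.2 (intertwines_self_iff.2 hx)) (one_mul x) (mul_one x) with
      ⟨z, -, -, -, h1, h2⟩ | h1
    · exact Or.inl ⟨⟨x, z, h1, h2⟩, rfl⟩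
    · right
      have h2 := h1.isUnit_one_sub
      rwa [← eq_sub_of_add_eq' hxy] at h2

theorem exists_isTraceVertex_le {A : Type*} [Ring A] [Finite G] {ρ : G →* A} {Q : Subgroup G}
    (h : (1 : A) ∈ traceIdeal ρ {Q}) : ∃ R ≤ Q, IsTraceVertex ρ R :=
  exists_minimal_le_of_wellFoundedLT _ Q h

variable [Finite G]

/-- The identity is the sum of the projections onto the summands, and each of them factors through
an identity that is a trace from a vertex. -/
theorem IsSumWithVertices.one_mem_traceIdeal [IsNoetherianRing O] [Module.Finite O V]
    {𝒬 : Set (Subgroup G)} (h : IsSumWithVertices ρ 𝒬) :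
    (1 : Module.End O V) ∈ traceIdeal (A := Module.End O V) ρ 𝒬 := by
  obtain ⟨n, W, hW, h⟩ := h
  let L := LinearEquiv.ofBijective (DirectSum.coeLinearMap fun i => (W i).toSubmodule) hW
  let π (i : Fin n) : V →ₗ[O] (W i).toSubmodule :=
    DirectSum.component O (Fin n) (fun i => (W i).toSubmodule) i ∘ₗ L.symm.toLinearMap
  have hLsymm : ∀ j (x : (W j).toSubmodule), L.symm (x : V) = DirectSum.lof O _ _ j x := by
    intro j x
    rw [LinearEquiv.symm_apply_eq]
    exact (DirectSum.coeLinearMap_lof (fun i => (W i).toSubmodule) j x).symm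
  have hπ : ∀ i, Intertwines ρ (W i).toRepresentation (π i) := by
    intro i g
    have : ∀ x, (π i ∘ₗ ρ g) (L x) = ((W i).toRepresentation g ∘ₗ π i) (L x) := by
      intro x
      induction x using DirectSum.induction_on with
      | zero => simp
      | add x y hx hy => rw [map_add, map_add, hx, hy, ← map_add, ← map_add]
      | of j x =>
        rw [← DirectSum.lof_eq_of O]
        have hx : L (DirectSum.lof O _ _ j x) = (x : V) :=
          DirectSum.coeLinearMap_lof (fun i => (W i).toSubmodule) j x
        have hgx : ρ g (x : V) = ((W j).toRepresentation g x : V) := rfl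
        rw [hx, LinearMap.comp_apply, LinearMap.comp_apply, hgx]
        simp only [π, LinearMap.comp_apply, LinearEquiv.coe_coe, hLsymm]
        by_cases hij : j = i
        · subst hij
          simp [DirectSum.component.lof_self]
        · rw [DirectSum.component.of, DirectSum.component.of, dif_neg hij, dif_neg hij, map_zero]
    ext v
    obtain ⟨x, rfl⟩ := L.surjective v
    exact congrArg _ (this x)
  have hsum : (1 : Module.End O V) = ∑ i, (W i).toSubmodule.subtype ∘ₗ LinearMap.id ∘ₗ π i := by
    ext v
    obtain ⟨x, rfl⟩ := L.surjective v
    induction x using DirectSum.induction_on with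
    | zero => simp
    | add x y hx hy => rw [map_add, map_add, map_add, hx, hy]
    | of j x =>
      rw [← DirectSum.lof_eq_of O]
      have hx : L (DirectSum.lof O _ _ j x) = (x : V) :=
        DirectSum.coeLinearMap_lof (fun i => (W i).toSubmodule) j x
      rw [hx, LinearMap.sum_apply, Finset.sum_eq_single j]
      · simp [π, hLsymm, DirectSum.component.lof_self]
      · intro i _ hij
        simp only [π, LinearMap.comp_apply, LinearEquiv.coe_coe, hLsymm, LinearMap.id_apply]
        rw [DirectSum.component.of, dif_neg hij.symm, map_zero]
      · simp
  rw [hsum]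
  refine sum_mem fun i _ => comp_mem_traceIdeal (hπ i) (W i).intertwines_subtype ?_
  obtain ⟨-, Q, hQ, hv⟩ := h i
  have h1 := (isVertex_iff.1 hv).1
  exact traceIdeal_mono (Set.singleton_subset_iff.2 hQ) h1

theorem isInternal_range_of_orthogonal {ι : Type*} [Fintype ι] [DecidableEq ι]
    (e : ι → Module.End O V) (h1 : ∀ i, e i * e i = e i) (h2 : ∀ i j, i ≠ j → e i * e j = 0)
    (h3 : ∑ i, e i = 1) : DirectSum.IsInternal fun i => LinearMap.range (e i) := by
  have key : ∀ (x : DirectSum ι fun i => LinearMap.range (e i)) i,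
      e i (DirectSum.coeLinearMap (fun i => LinearMap.range (e i)) x) = x i := by
    intro x i
    induction x using DirectSum.induction_on with
    | zero => simp
    | add x y hx hy => rw [map_add, map_add, hx, hy]; rfl
    | of j x =>
      rw [← DirectSum.lof_eq_of O, DirectSum.coeLinearMap_lof]
      obtain ⟨_, w, rfl⟩ := x
      by_cases hij : i = j
      · subst hij
        rw [DirectSum.lof_apply, ← Module.End.mul_apply, h1]
      · have : (DirectSum.lof O ι (fun i => LinearMap.range (e i)) j ⟨e j w, w, rfl⟩) i = 0 :=
          DirectSum.of_eq_of_ne _ _ _ hij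
        rw [this, ← Module.End.mul_apply, h2 i j hij]
        rfl
  refine ⟨fun x y hxy => ?_, fun v => ?_⟩
  · ext i
    rw [← key, ← key]
    exact congrArg _ hxy
  · refine ⟨∑ i, DirectSum.lof O ι (fun i => LinearMap.range (e i)) i ⟨e i v, v, rfl⟩, ?_⟩
    change DirectSum.coeLinearMap (fun i => LinearMap.range (e i)) _ = v
    rw [map_sum]
    simp only [DirectSum.coeLinearMap_lof]
    rw [← LinearMap.sum_apply, h3]
    rfl

/-- Split $1$ into primitive idempotents. Each summand has a local endomorphism ring, so Rosenberg's
lemma finds one $Q\in\mathcal Q$ for it; its vertex may be smaller than $Q$, which is why $\mathcal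
Q$ must be closed downwards. -/
theorem isSumWithVertices_of_one_mem [IsNoetherianRing O] [IsLocalRing O]
    [IsAdicComplete (IsLocalRing.maximalIdeal O) O] [Module.Finite O V] {𝒬 : Set (Subgroup G)}
    (h𝒬 : ∀ Q ∈ 𝒬, ∀ R ≤ Q, R ∈ 𝒬)
    (h : (1 : Module.End O V) ∈ traceIdeal (A := Module.End O V) ρ 𝒬) :
    IsSumWithVertices ρ 𝒬 := by
  obtain ⟨ι, _, e, he, heo, hes⟩ :=
    exists_sum_isPrimitiveIdem (fixedSubalgebra ρ) 1 (one_mem _) (one_mul 1)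
  classical
  have hei i := mem_fixedSubalgebra.1 (he i).mem
  let φ := Fintype.equivFin ι
  refine ⟨Fintype.card ι, fun k => rangeRep (e (φ.symm k)) (hei _),
    isInternal_range_of_orthogonal (fun k => e (φ.symm k)) (fun k => (he _).idem)
      (fun i j hij => heo _ _ fun h => hij (φ.symm.injective h))
      (by rw [φ.symm.sum_comp, hes]), fun k => ?_⟩
  have hind := (he (φ.symm k)).isIndecomposable
  refine ⟨hind, ?_⟩
  have h1 := one_mem_traceIdeal_of_retract (Subrepresentation.intertwines_subtype _)
    (intertwines_rangeRestrict (hei (φ.symm k))) (rangeRestrict_comp_subtype (he _).idem) h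
  obtain ⟨Q, hQ, hQ1⟩ := hind.hasLocalFixed.exists_one_mem h1
  obtain ⟨R, hR, hRv⟩ := exists_isTraceVertex_le hQ1
  exact ⟨R, h𝒬 Q hQ R hR, isVertex_iff.2 hRv⟩

end Decompositions

/-! ### Even parts of endomorphisms -/

section EvenPart

variable {A : Type*} [Ring A]

/-- The even part of `a` with respect to the decomposition given by the idempotent `p`. -/
def evenPart (p a : A) : A := p * a * p + (1 - p) * a * (1 - p)

variable {p : A}

theorem evenPart_add (a b : A) : evenPart p (a + b) = evenPart p a + evenPart p b := by
  simp only [evenPart, mul_add, add_mul]; abel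

theorem evenPart_of_commute (hp : p * p = p) {a : A} (ha : p * a = a * p) : evenPart p a = a := by
  have h : (1 - p) * (1 - p) = 1 - p := by simp [mul_sub, sub_mul, hp]
  have ha' : (1 - p) * a = a * (1 - p) := by simp [mul_sub, sub_mul, ha]
  rw [evenPart, ha, ha', mul_assoc, mul_assoc, hp, h, ← mul_add]
  simp

theorem evenPart_commute (hp : p * p = p) (a : A) : p * evenPart p a = evenPart p a * p := by
  have h1 : p * (1 - p) = 0 := by rw [mul_sub, mul_one, hp, sub_self]
  have h2 : (1 - p) * p = 0 := by rw [sub_mul, one_mul, hp, sub_self]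
  rw [evenPart, mul_add, add_mul]
  simp only [← mul_assoc, hp, h1, zero_mul]
  simp only [mul_assoc, hp, h2, mul_zero]

theorem evenPart_mul_left {f : A} (hf : p * f = f * p) (a : A) :
    evenPart p (f * a) = f * evenPart p a := by
  have hf' : (1 - p) * f = f * (1 - p) := by simp [mul_sub, sub_mul, hf]
  simp only [evenPart, mul_add, ← mul_assoc, hf, hf']

theorem evenPart_mul_right {f : A} (hf : p * f = f * p) (a : A) :
    evenPart p (a * f) = evenPart p a * f := by
  have hf' : (1 - p) * f = f * (1 - p) := by simp [mul_sub, sub_mul, hf]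
  simp only [evenPart, add_mul, mul_assoc, hf, hf']

theorem mul_sub_evenPart (hp : p * p = p) (a : A) :
    p * (a - evenPart p a) = (a - evenPart p a) * (1 - p) := by
  simp only [evenPart, mul_sub, sub_mul, mul_add, add_mul, mul_one, one_mul, ← mul_assoc, hp]
  simp only [mul_assoc, hp]
  abel

/-- This compares the odd parts of the two sides of $(x+y)^2=x+y$, for $x$ even and $y$ odd. -/
theorem odd_eq_of_add_idem (hp : p * p = p) {x y : A} (hpx : p * x = x * p)
    (hpy : p * y = y * (1 - p)) (h : (x + y) * (x + y) = x + y) : y = x * y + y * x := by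
  have hpx' : (1 - p) * x = x * (1 - p) := by rw [sub_mul, mul_sub, hpx]; simp
  have hpy' : (1 - p) * y = y * p := by rw [sub_mul, one_mul, hpy, mul_sub, mul_one]; abel
  have hpyy : p * (y * y) = y * y * p := by rw [← mul_assoc, hpy, mul_assoc, hpy', ← mul_assoc]
  have hpxx : p * (x * x) = x * x * p := by rw [← mul_assoc, hpx, mul_assoc, hpx, ← mul_assoc]
  have hpxy : p * (x * y) = x * y * (1 - p) := by
    rw [← mul_assoc, hpx, mul_assoc, hpy, ← mul_assoc]
  have hpyx : p * (y * x) = y * x * (1 - p) := by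
    rw [← mul_assoc, hpy, mul_assoc, hpx', ← mul_assoc]
  -- The left side is odd and the right side is even. An element $z$ of both kinds satisfies
  -- $zp=z(1-p)$, hence vanishes; no division by $2$ is involved.
  have hz : x * y + y * x - y = x - x * x - y * y := by
    rw [add_mul, mul_add, mul_add] at h
    rw [sub_eq_iff_eq_add]
    calc x * y + y * x = (x * x + x * y + (y * x + y * y)) - x * x - y * y := by abel
      _ = _ := by rw [h]; abel
  have h1 : p * (x * y + y * x - y) = (x * y + y * x - y) * (1 - p) := by
    rw [mul_sub, mul_add, hpxy, hpyx, hpy, sub_mul, add_mul]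
  have h2 : p * (x * y + y * x - y) = (x * y + y * x - y) * p := by
    rw [hz, mul_sub, mul_sub, hpx, hpxx, hpyy, sub_mul, sub_mul]
  rw [eq_comm, ← sub_eq_zero]
  generalize x * y + y * x - y = z at h1 h2
  rw [h2] at h1
  have h3 : z * p = 0 := by
    have := congrArg (· * p) h1
    simpa [mul_assoc, hp, mul_sub, sub_mul] using this
  rw [h3, mul_sub, mul_one, h3, sub_zero] at h1
  exact h1.symm

/-- The odd part of an idempotent. -/
theorem oddPart_eq_of_idem (hp : p * p = p) {g : A} (hg : g * g = g) :
    g - evenPart p g = evenPart p g * (g - evenPart p g) + (g - evenPart p g) * evenPart p g :=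
  odd_eq_of_add_idem hp (evenPart_commute hp g) (mul_sub_evenPart hp g) (by simpa using hg)

variable {G : Type*} [Group G] {ρ : G →* A}

/-- Each `ρ g` either commutes with `p` or exchanges `p` and `1 - p`. -/
structure IsSuperGrading (ρ : G →* A) (p : A) : Prop where
  idem : p * p = p
  comm_or : ∀ g, p * ρ g = ρ g * p ∨ p * ρ g = ρ g * (1 - p)

theorem IsSuperGrading.restrict (h : IsSuperGrading ρ p) (N : Subgroup G) :
    IsSuperGrading (ρ.comp N.subtype) p := ⟨h.idem, fun n => h.comm_or n⟩

/-- Conjugation by a group element preserves or exchanges the two diagonal blocks, so it commutes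
with taking their sum. Hence trace ideals are stable under even parts. -/
theorem IsSuperGrading.evenPart_conj (h : IsSuperGrading ρ p) (g : G) (a : A) :
    evenPart p (ρ g * a * ρ g⁻¹) = ρ g * evenPart p a * ρ g⁻¹ := by
  have h0 : p * ρ g⁻¹ = ρ g⁻¹ * (ρ g * p) * ρ g⁻¹ := by
    rw [← mul_assoc, map_inv_mul_map, one_mul]
  have h1 : ρ g⁻¹ * p = ρ g⁻¹ * (p * ρ g) * ρ g⁻¹ := by
    rw [mul_assoc, mul_assoc, map_mul_map_inv, mul_one]
  rcases h.comm_or g with hg | hg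
  · have hg2 : ρ g⁻¹ * p = p * ρ g⁻¹ := by rw [h0, h1, hg]
    have e1 : (1 - p) * ρ g = ρ g * (1 - p) := by rw [sub_mul, mul_sub, hg]; simp
    have e2 : ρ g⁻¹ * (1 - p) = (1 - p) * ρ g⁻¹ := by rw [sub_mul, mul_sub, hg2]; simp
    simp only [evenPart, mul_add, add_mul, ← mul_assoc, hg, e1]
    simp only [mul_assoc, hg2, e2]
  · have hg2 : ρ g⁻¹ * p = (1 - p) * ρ g⁻¹ := by
      rw [h1, hg, ← mul_assoc, map_inv_mul_map, one_mul]
    have e1 : (1 - p) * ρ g = ρ g * p := by rw [sub_mul, hg, mul_sub]; simp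
    have e2 : ρ g⁻¹ * (1 - p) = p * ρ g⁻¹ := by rw [mul_sub, hg2, sub_mul]; simp
    simp only [evenPart, mul_add, add_mul, ← mul_assoc, hg, e1]
    simp only [mul_assoc, hg2, e2]
    abel

theorem IsSuperGrading.isFixed_evenPart (h : IsSuperGrading ρ p) {Q : Subgroup G} {a : A}
    (ha : IsFixed ρ Q a) : IsFixed ρ Q (evenPart p a) :=
  isFixed_of_conj_eq fun q hq => by rw [← h.evenPart_conj, ha.conj_eq hq]

variable [Finite G]

theorem IsSuperGrading.evenPart_relTrace (h : IsSuperGrading ρ p) {Q : Subgroup G} (a : A) :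
    evenPart p (relTrace ρ Q a) = relTrace ρ Q (evenPart p a) := by
  have hsum : ∀ (s : Finset (G ⧸ Q)) (f : G ⧸ Q → A),
      evenPart p (∑ x ∈ s, f x) = ∑ x ∈ s, evenPart p (f x) := fun s f => by
    simp only [evenPart, Finset.mul_sum, Finset.sum_mul, Finset.sum_add_distrib]
  rw [relTrace, relTrace, hsum]
  exact Finset.sum_congr rfl fun x _ => h.evenPart_conj _ _

theorem IsSuperGrading.evenPart_mem_traceIdeal (h : IsSuperGrading ρ p) {𝒬 : Set (Subgroup G)}
    {a : A} (ha : a ∈ traceIdeal ρ 𝒬) : evenPart p a ∈ traceIdeal ρ 𝒬 :=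
  traceIdeal_induction (AddMonoidHom.mk' (evenPart p) evenPart_add) _ (fun Q hQ a ha => by
    rw [AddMonoidHom.mk'_apply, h.evenPart_relTrace]
    exact relTrace_mem_traceIdeal hQ (h.isFixed_evenPart ha)) ha

end EvenPart

/-! ### Even idempotents that are primitive in the full fixed algebra -/

section EvenIdempotents

variable {O : Type*} [CommRing O] [IsNoetherianRing O] [IsLocalRing O]
  [IsAdicComplete (IsLocalRing.maximalIdeal O) O] {G : Type*} [Group G] [Finite G]
  {V : Type*} [AddCommGroup V] [Module O V] [Module.Finite O V] {ρ : Representation O G V}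

/-- If the endomorphism ring of a graded module is local modulo a trace ideal, then the module
has an even indecomposable direct summand whose complement is killed modulo the ideal. -/
theorem exists_even_isPrimitiveIdem {p : Module.End O V}
    (hp : IsSuperGrading (A := Module.End O V) ρ p) {𝒬 : Set (Subgroup G)}
    (h1 : (1 : Module.End O V) ∉ traceIdeal (A := Module.End O V) ρ 𝒬)
    (hor : ∀ x : Module.End O V, IsFixed (A := Module.End O V) ρ ⊤ x → x * x = x →
      x ∈ traceIdeal (A := Module.End O V) ρ 𝒬 ∨ 1 - x ∈ traceIdeal (A := Module.End O V) ρ 𝒬) :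
    ∃ f, IsPrimitiveIdem (fixedSubalgebra ρ) f ∧ p * f = f * p ∧
      f ∉ traceIdeal (A := Module.End O V) ρ 𝒬 ∧
      1 - f ∈ traceIdeal (A := Module.End O V) ρ 𝒬 := by
  set J := traceIdeal (A := Module.End O V) ρ 𝒬 with hJ
  have hfix : ∀ {x : Module.End O V}, x ∈ fixedSubalgebra ρ ↔
      IsFixed (A := Module.End O V) ρ ⊤ x := fun {x} =>
    mem_fixedSubalgebra.trans intertwines_self_iff
  have hS₀ : ∀ {x : Module.End O V}, x ∈ fixedSubalgebra ρ ⊓ Subalgebra.centralizer O {p} ↔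
      IsFixed (A := Module.End O V) ρ ⊤ x ∧ p * x = x * p := fun {x} => by
    rw [Algebra.mem_inf, hfix, Subalgebra.mem_centralizer_iff]
    simp
  -- At this stage $f$ is primitive only among even idempotents.
  obtain ⟨f, hf, hfJ⟩ := exists_isPrimitiveIdem_notMem
    (fixedSubalgebra ρ ⊓ Subalgebra.centralizer O {p}) J h1
  obtain ⟨hff, hfp⟩ := hS₀.1 hf.mem
  have hfJ' : 1 - f ∈ J := (hor f hff hf.idem).resolve_left hfJ
  have key : ∀ g : Module.End O V, IsFixed (A := Module.End O V) ρ ⊤ g → g * g = g → f * g = g →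
      g * f = g → g ∈ J → g = 0 := by
    intro g hg hgg hfg hgf hgJ
    have heJ : evenPart p g ∈ J := hp.evenPart_mem_traceIdeal hgJ
    have heS := hS₀.2 ⟨hp.isFixed_evenPart hg, evenPart_commute hp.idem g⟩
    -- The even part of $g$ lies in the local corner at $f$. It is not invertible there, since it
    -- lies in $J$ and $f$ does not.
    rcases hf.isUnit_or_isTopNilpotent heS
      (by rw [← evenPart_mul_left hfp, hfg])
      (by rw [← evenPart_mul_right hfp, hgf]) with ⟨y, hy, -, -, h2, -⟩ | hnil
    · exact (hfJ (h2 ▸ traceIdeal_mul_mem (hS₀.1 hy).1 heJ)).elim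
    · obtain ⟨u, hu⟩ := hnil.isUnit_one_sub
      have hodd := oddPart_eq_of_idem hp.idem hgg
      -- With $x,y$ the even and odd parts of $g$, the relation $y=xy+yx$ reads $y=(1-x)^{-1}yx$,
      -- and $x$ is topologically nilpotent.
      have h0 : g - evenPart p g = 0 := by
        refine hnil.eq_zero (w := ((u⁻¹ : (Module.End O V)ˣ) : Module.End O V)) ?_
        rw [mul_assoc, Units.eq_inv_mul_iff_mul_eq, hu, sub_mul, one_mul, sub_eq_iff_eq_add']
        exact hodd
      rw [← sub_eq_zero.1 h0] at heS
      refine (hf.eq_or g heS hgg hfg hgf).resolve_right fun h => hfJ (h ▸ hgJ)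
  refine ⟨f, ⟨hfix.2 hff, hf.idem, hf.ne_zero, fun g hg hgg hfg hgf => ?_⟩, hfp, hfJ, hfJ'⟩
  rcases hor g (hfix.1 hg) hgg with h | h
  · exact Or.inl (key g (hfix.1 hg) hgg hfg hgf h)
  · right
    -- Now $1-g\in J$, so the complementary idempotent $f-g=f(1-g)$ lies in $J$ and must vanish.
    refine (sub_eq_zero.1 (key (f - g) (hff.sub (hfix.1 hg)) ?_ ?_ ?_ ?_)).symm
    · rw [mul_sub, sub_mul, sub_mul, hf.idem, hfg, hgf, hgg, sub_self, sub_zero]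
    · rw [mul_sub, hf.idem, hfg]
    · rw [sub_mul, hf.idem, hgf]
    · have := mul_mem_traceIdeal hff h
      rwa [mul_sub, mul_one, hfg] at this

end EvenIdempotents

/-! ### Even homomorphisms of supermodules -/

theorem zmod_two_eq (δ : ZMod 2) : δ = 0 ∨ δ = 1 := by
  revert δ
  decide

namespace SuperModule

section Basic

variable {O : Type u} [CommRing O] {G : Type v} [Group G] {G₀ : Subgroup G}

/-- The projection of a supermodule onto its even component. -/
noncomputable def evenProj (M : SuperModule O G₀) : Module.End O M.carrier :=
  gradeProj M.grade M.isInternal 0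

variable (M M' M'' : SuperModule O G₀)

theorem evenProj_of_mem {ε : ZMod 2} {m : M.carrier} (hm : m ∈ M.grade ε) :
    M.evenProj m = if ε = 0 then m else 0 := gradeProj_of_mem _ _ hm

theorem mem_grade_zero_iff {m : M.carrier} : m ∈ M.grade 0 ↔ M.evenProj m = m :=
  ⟨fun h => by rw [M.evenProj_of_mem h, if_pos rfl], fun h => h ▸ gradeProj_mem _ _ _ _⟩

theorem sub_evenProj_mem (m : M.carrier) : m - M.evenProj m ∈ M.grade 1 := by
  refine grade_induction M.grade M.isInternal (p := fun m => m - M.evenProj m ∈ M.grade 1) m ?_ ?_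
  · intro x y hx hy
    rw [map_add, add_sub_add_comm]
    exact add_mem hx hy
  · intro δ x hx
    rw [M.evenProj_of_mem hx]
    have := zmod_two_eq δ
    rcases this with rfl | rfl
    · simp
    · simpa using hx

theorem mem_grade_one_iff {m : M.carrier} : m ∈ M.grade 1 ↔ M.evenProj m = 0 :=
  ⟨fun h => by rw [M.evenProj_of_mem h, if_neg one_ne_zero],
    fun h => by simpa [h] using M.sub_evenProj_mem m⟩

variable {M M'} in
theorem map_mem_grade_iff {f : M.carrier →ₗ[O] M'.carrier} :
    (∀ (ε : ZMod 2), ∀ m ∈ M.grade ε, f m ∈ M'.grade ε) ↔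
      f ∘ₗ M.evenProj = M'.evenProj ∘ₗ f := by
  constructor
  · intro h
    ext m
    refine grade_induction M.grade M.isInternal
      (p := fun m => (f ∘ₗ M.evenProj) m = (M'.evenProj ∘ₗ f) m) m
      (fun x y hx hy => by rw [map_add, map_add, hx, hy]) fun δ x hx => ?_
    rw [LinearMap.comp_apply, LinearMap.comp_apply, M.evenProj_of_mem hx,
      M'.evenProj_of_mem (h δ x hx)]
    split_ifs <;> simp
  · intro h ε m hm
    have hm' : f (M.evenProj m) = M'.evenProj (f m) := LinearMap.congr_fun h m
    have := zmod_two_eq ε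
    rcases this with rfl | rfl
    · rw [mem_grade_zero_iff] at hm ⊢
      rw [← hm', hm]
    · rw [mem_grade_one_iff] at hm ⊢
      rw [← hm', hm, map_zero]

theorem isSuperGrading : IsSuperGrading (A := Module.End O M.carrier) M.ρ M.evenProj where
  idem := by
    ext m
    exact (M.mem_grade_zero_iff).1 (gradeProj_mem _ _ _ _)
  comm_or g := by
    have hpar := zmod_two_eq (parity G₀ g)
    refine hpar.imp (fun hg => ?_) fun hg => ?_ <;> ext m
    · refine grade_induction M.grade M.isInternal
        (p := fun m => (M.evenProj * M.ρ g) m = (M.ρ g * M.evenProj) m) m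
        (fun x y hx hy => by rw [map_add, map_add, hx, hy]) fun δ x hx => ?_
      have hgx := M.apply_mem g hx
      rw [hg, zero_add] at hgx
      rw [Module.End.mul_apply, Module.End.mul_apply, M.evenProj_of_mem hx,
        M.evenProj_of_mem hgx]
      split_ifs <;> simp
    · refine grade_induction M.grade M.isInternal
        (p := fun m => (M.evenProj * M.ρ g) m = (M.ρ g * (1 - M.evenProj)) m) m
        (fun x y hx hy => by rw [map_add, map_add, hx, hy]) fun δ x hx => ?_
      have hgx := M.apply_mem g hx
      rw [hg] at hgx
      rw [Module.End.mul_apply, Module.End.mul_apply, LinearMap.sub_apply, Module.End.one_apply,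
        M.evenProj_of_mem hx, M.evenProj_of_mem hgx]
      have := zmod_two_eq δ
      rcases this with rfl | rfl
      · simp
      · rw [if_pos (by decide), if_neg (by decide), sub_zero]

/-- An even homomorphism of supermodules. -/
structure IsEvenHom {M M' : SuperModule O G₀} (f : M.carrier →ₗ[O] M'.carrier) : Prop where
  intertwines : Intertwines M.ρ M'.ρ f
  even : f ∘ₗ M.evenProj = M'.evenProj ∘ₗ f

variable {M M' M''}

theorem IsEvenHom.comp {f : M.carrier →ₗ[O] M'.carrier} {f' : M'.carrier →ₗ[O] M''.carrier}
    (hf' : IsEvenHom f') (hf : IsEvenHom f) : IsEvenHom (f' ∘ₗ f) :=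
  ⟨hf'.intertwines.comp hf.intertwines, by
    rw [LinearMap.comp_assoc, hf.even, ← LinearMap.comp_assoc, hf'.even, LinearMap.comp_assoc]⟩

theorem isEvenHom_of_mem {f : M.carrier →ₗ[O] M'.carrier} (hf : Intertwines M.ρ M'.ρ f)
    (h : ∀ (ε : ZMod 2), ∀ m ∈ M.grade ε, f m ∈ M'.grade ε) : IsEvenHom f :=
  ⟨hf, map_mem_grade_iff.1 h⟩

theorem IsEvenHom.units_inv {u : (Module.End O M.carrier)ˣ}
    (hu : IsEvenHom (M := M) (M' := M) (u : Module.End O M.carrier)) :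
    IsEvenHom (M := M) (M' := M) ((u⁻¹ : (Module.End O M.carrier)ˣ) : Module.End O M.carrier) := by
  refine ⟨intertwines_self_iff.2 (IsFixed.units_inv (intertwines_self_iff.1 hu.intertwines)), ?_⟩
  have := hu.even
  change (u : Module.End O M.carrier) * M.evenProj = M.evenProj * u at this
  change ((u⁻¹ : (Module.End O M.carrier)ˣ) : Module.End O M.carrier) * M.evenProj =
    M.evenProj * (u⁻¹ : (Module.End O M.carrier)ˣ)
  rw [Units.eq_mul_inv_iff_mul_eq, mul_assoc, ← this, Units.inv_mul_cancel_left]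

theorem IsEvenHom.res {f : M.carrier →ₗ[O] M'.carrier} (hf : IsEvenHom f) (N : Subgroup G) :
    IsEvenHom (M := M.res N) (M' := M'.res N) f := ⟨hf.intertwines.restrict N, hf.even⟩

theorem isEvenHom_inl : IsEvenHom (M := M) (M' := M.directSum M')
    (LinearMap.inl O M.carrier M'.carrier) :=
  isEvenHom_of_mem (fun _ => LinearMap.ext fun _ => Prod.ext rfl (map_zero (M'.ρ _)).symm)
    fun _ _ hm => ⟨hm, zero_mem _⟩

theorem isEvenHom_inr : IsEvenHom (M := M') (M' := M.directSum M')
    (LinearMap.inr O M.carrier M'.carrier) :=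
  isEvenHom_of_mem (fun _ => LinearMap.ext fun _ => Prod.ext (map_zero (M.ρ _)).symm rfl)
    fun _ _ hm => ⟨zero_mem _, hm⟩

theorem isEvenHom_fst : IsEvenHom (M := M.directSum M') (M' := M)
    (LinearMap.fst O M.carrier M'.carrier) :=
  isEvenHom_of_mem (fun _ => rfl) fun _ _ hm => hm.1

theorem isEvenHom_snd : IsEvenHom (M := M.directSum M') (M' := M')
    (LinearMap.snd O M.carrier M'.carrier) :=
  isEvenHom_of_mem (fun _ => rfl) fun _ _ hm => hm.2

theorem iso_of_inverse {f : M.carrier →ₗ[O] M'.carrier} {f' : M'.carrier →ₗ[O] M.carrier}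
    (hf : IsEvenHom f) (hf' : IsEvenHom f') (h : f ∘ₗ f' = LinearMap.id)
    (h' : f' ∘ₗ f = LinearMap.id) : M.Iso M' := by
  refine ⟨Representation.Equiv.mk (LinearEquiv.ofLinearMap f f' h h') hf.intertwines, fun ε m =>
    ⟨fun hm => map_mem_grade_iff.2 hf.even ε m hm, fun hm => ?_⟩⟩
  have := map_mem_grade_iff.2 hf'.even ε (f m) hm
  rwa [← LinearMap.comp_apply, h'] at this

theorem Iso.exists_inverse (h : M.Iso M') : ∃ (f : M.carrier →ₗ[O] M'.carrier)
    (f' : M'.carrier →ₗ[O] M.carrier), IsEvenHom f ∧ IsEvenHom f' ∧ f ∘ₗ f' = LinearMap.id ∧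
      f' ∘ₗ f = LinearMap.id := by
  obtain ⟨e, he⟩ := h
  have h1 : ∀ m, e (e.symm m) = m := e.apply_symm_apply
  have h2 : ∀ m, e.symm (e m) = m := e.symm_apply_apply
  refine ⟨e.toLinearEquiv, e.symm.toLinearEquiv, isEvenHom_of_mem e.intertwines
    fun ε m hm => (he ε m).1 hm, isEvenHom_of_mem e.symm.intertwines fun ε m hm => ?_,
    LinearMap.ext h1, LinearMap.ext h2⟩
  refine (he ε _).2 ?_
  have : e (e.symm m) ∈ M'.grade ε := by rwa [h1]
  exact this

theorem Iso.directSum_congr {M₁ M₂ M₃ M₄ : SuperModule O G₀} (h : M₁.Iso M₂) (h' : M₃.Iso M₄) :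
    (M₁.directSum M₃).Iso (M₂.directSum M₄) := by
  obtain ⟨f, g, hf, hg, hfg, hgf⟩ := h.exists_inverse
  obtain ⟨f', g', hf', hg', hfg', hgf'⟩ := h'.exists_inverse
  refine iso_of_inverse (f := f.prodMap f') (f' := g.prodMap g') ?_ ?_ ?_ ?_
  · exact isEvenHom_of_mem (fun x => LinearMap.ext fun m =>
      Prod.ext (hf.intertwines.apply x m.1) (hf'.intertwines.apply x m.2)) fun ε m hm =>
      ⟨map_mem_grade_iff.2 hf.even ε _ hm.1, map_mem_grade_iff.2 hf'.even ε _ hm.2⟩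
  · exact isEvenHom_of_mem (fun x => LinearMap.ext fun m =>
      Prod.ext (hg.intertwines.apply x m.1) (hg'.intertwines.apply x m.2)) fun ε m hm =>
      ⟨map_mem_grade_iff.2 hg.even ε _ hm.1, map_mem_grade_iff.2 hg'.even ε _ hm.2⟩
  · exact LinearMap.ext fun m =>
      Prod.ext (LinearMap.congr_fun hfg m.1) (LinearMap.congr_fun hfg' m.2)
  · exact LinearMap.ext fun m =>
      Prod.ext (LinearMap.congr_fun hgf m.1) (LinearMap.congr_fun hgf' m.2)

theorem Iso.res (h : M.Iso M') (N : Subgroup G) : (M.res N).Iso (M'.res N) := by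
  obtain ⟨f, g, hf, hg, hfg, hgf⟩ := h.exists_inverse
  exact iso_of_inverse (hf.res N) (hg.res N) hfg hgf

/-! ### Even direct summands -/

/-- A submodule which is stable under the projection onto the even component. -/
noncomputable def ofSubrepresentation (M : SuperModule O G₀) (W : Subrepresentation M.ρ)
    [Module.Finite O W.toSubmodule] (hW : ∀ m ∈ W.toSubmodule, M.evenProj m ∈ W.toSubmodule) :
    SuperModule O G₀ where
  carrier := W.toSubmodule
  ρ := W.toRepresentation
  grade ε := (M.grade ε).comap W.toSubmodule.subtype
  isInternal := by
    rw [isInternal_iff_isCompl]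
    have hM := (isInternal_iff_isCompl _).1 M.isInternal
    refine ⟨Submodule.disjoint_def.2 fun x h0 h1 => Subtype.ext
      (Submodule.disjoint_def.1 hM.1 x h0 h1), codisjoint_iff.2 (eq_top_iff.2 ?_)⟩
    rintro ⟨w, hw⟩ -
    exact Submodule.mem_sup.2 ⟨⟨M.evenProj w, hW w hw⟩, gradeProj_mem _ _ _ _,
      ⟨w - M.evenProj w, sub_mem hw (hW w hw)⟩, M.sub_evenProj_mem _,
      Subtype.ext (add_sub_cancel _ _)⟩
  smul_mem := smul_mem_of_group _ _ _ fun g _ _ hm => M.apply_mem g hm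

instance (f : Module.End O M.carrier) (hf : Intertwines M.ρ M.ρ f) :
    Module.Finite O (rangeRep f hf).toSubmodule := Module.Finite.range f

/-- The image of an even endomorphism. -/
noncomputable def ofIdem (M : SuperModule O G₀) (f : Module.End O M.carrier)
    (hf : IsEvenHom (M := M) (M' := M) f) : SuperModule O G₀ :=
  M.ofSubrepresentation (rangeRep f hf.intertwines) fun m hm => by
    obtain ⟨w, rfl⟩ := hm
    exact ⟨M.evenProj w, LinearMap.congr_fun hf.even w⟩

variable {f : Module.End O M.carrier}

theorem isEvenHom_ofIdem_rangeRestrict (hf : IsEvenHom (M := M) (M' := M) f) :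
    IsEvenHom (M := M) (M' := M.ofIdem f hf) f.rangeRestrict :=
  isEvenHom_of_mem (intertwines_rangeRestrict hf.intertwines) fun ε m hm =>
    map_mem_grade_iff.2 hf.even ε m hm

theorem IsEvenHom.one_sub (hf : IsEvenHom (M := M) (M' := M) f) :
    IsEvenHom (M := M) (M' := M) (1 - f : Module.End O M.carrier) := by
  refine ⟨intertwines_self_iff.2 (IsFixed.one.sub (intertwines_self_iff.1 hf.intertwines)), ?_⟩
  have := hf.even
  change f * M.evenProj = M.evenProj * f at this
  change (1 - f) * M.evenProj = M.evenProj * (1 - f)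
  rw [sub_mul, mul_sub, this, one_mul, mul_one]

theorem iso_directSum_ofIdem (hf : IsEvenHom (M := M) (M' := M) f) (hff : f * f = f) :
    M.Iso ((M.ofIdem f hf).directSum (M.ofIdem (1 - f) hf.one_sub)) := by
  have hff' : (1 - f) * (1 - f) = 1 - f := by simp [mul_sub, sub_mul, hff]
  have h1 : f * (1 - f) = 0 := by rw [mul_sub, mul_one, hff, sub_self]
  have h2 : (1 - f) * f = 0 := by rw [sub_mul, one_mul, hff, sub_self]
  have e1 := isEvenHom_ofIdem_rangeRestrict hf
  have e2 := isEvenHom_ofIdem_rangeRestrict hf.one_sub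
  refine iso_of_inverse (f := f.rangeRestrict.prod (1 - f : Module.End O M.carrier).rangeRestrict)
    (f' := (LinearMap.range f).subtype.coprod (LinearMap.range (1 - f)).subtype) ?_ ?_ ?_ ?_
  · exact isEvenHom_of_mem (fun x => LinearMap.ext fun m =>
      Prod.ext (e1.intertwines.apply x m) (e2.intertwines.apply x m)) fun ε m hm =>
      ⟨map_mem_grade_iff.2 e1.even ε _ hm, map_mem_grade_iff.2 e2.even ε _ hm⟩
  · refine isEvenHom_of_mem (fun x => LinearMap.ext fun m => ?_) fun ε m hm => add_mem hm.1 hm.2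
    exact (map_add (M.ρ x) ((LinearMap.range f).subtype m.1)
      ((LinearMap.range (1 - f)).subtype m.2)).symm
  · refine LinearMap.ext ?_
    rintro ⟨⟨_, a, rfl⟩, ⟨_, b, rfl⟩⟩
    refine Prod.ext (Subtype.ext ?_) (Subtype.ext ?_)
    · change f (f a + (1 - f) b) = f a
      rw [map_add, ← Module.End.mul_apply, ← Module.End.mul_apply, hff, h1]
      simp
    · change (1 - f) (f a + (1 - f) b) = (1 - f) b
      rw [map_add, ← Module.End.mul_apply, ← Module.End.mul_apply, hff', h2]
      simp
  · refine LinearMap.ext fun m => ?_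
    change f m + (m - f m) = m
    abel

end Basic

/-! ### Even retracts and cancellation -/

section Retracts

variable {O : Type u} [CommRing O] {G : Type v} [Group G] {G₀ : Subgroup G}

/-- `M` is isomorphic to an even direct summand of `M'`. -/
def IsEvenRetract (M M' : SuperModule O G₀) : Prop :=
  ∃ (i : M.carrier →ₗ[O] M'.carrier) (r : M'.carrier →ₗ[O] M.carrier),
    IsEvenHom i ∧ IsEvenHom r ∧ r ∘ₗ i = LinearMap.id

variable {M M' M'' : SuperModule O G₀}

theorem IsEvenRetract.trans (h : M.IsEvenRetract M') (h' : M'.IsEvenRetract M'') :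
    M.IsEvenRetract M'' := by
  obtain ⟨i, r, hi, hr, h⟩ := h
  obtain ⟨i', r', hi', hr', h'⟩ := h'
  refine ⟨i' ∘ₗ i, r ∘ₗ r', hi'.comp hi, hr.comp hr', ?_⟩
  rw [LinearMap.comp_assoc, ← LinearMap.comp_assoc i, h', LinearMap.id_comp, h]

theorem Iso.isEvenRetract (h : M.Iso M') : M.IsEvenRetract M' := by
  obtain ⟨f, g, hf, hg, -, hgf⟩ := h.exists_inverse
  exact ⟨f, g, hf, hg, hgf⟩

theorem isEvenRetract_directSum_left : M.IsEvenRetract (M.directSum M') :=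
  ⟨_, _, isEvenHom_inl, isEvenHom_fst, LinearMap.fst_comp_inl ..⟩

theorem IsEvenRetract.iso (h : M.IsEvenRetract M') (hM : M.IsAbsolutelyIndecomposable)
    (hM' : M'.IsAbsolutelyIndecomposable) : M.Iso M' := by
  obtain ⟨i, r, hi, hr, h⟩ := h
  have := hM.1
  exact iso_of_inverse hi hr
    (IsIndecomposable.of_retract hM' hi.intertwines hr.intertwines h) h

/-- A relatively projective summand can be cancelled if the retract is not relatively
projective. -/
theorem IsEvenRetract.of_directSum [Finite G] (h : M.IsEvenRetract (M'.directSum M''))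
    (hM : HasLocalFixed (A := Module.End O M.carrier) M.ρ) {𝒬 : Set (Subgroup G)}
    (h1 : (1 : Module.End O M.carrier) ∉ traceIdeal (A := Module.End O M.carrier) M.ρ 𝒬)
    (h2 : (1 : Module.End O M''.carrier) ∈ traceIdeal (A := Module.End O M''.carrier) M''.ρ 𝒬) :
    M.IsEvenRetract M' := by
  obtain ⟨i, r, hi, hr, h⟩ := h
  have hi1 := (isEvenHom_fst (M := M') (M' := M'')).comp hi
  have hi2 := (isEvenHom_snd (M := M') (M' := M'')).comp hi
  have hr1 := hr.comp (isEvenHom_inl (M := M') (M' := M''))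
  have hr2 := hr.comp (isEvenHom_inr (M := M') (M' := M''))
  have hu1 := hr1.comp hi1
  have hu2 := hr2.comp hi2
  set i₁ := LinearMap.fst O M'.carrier M''.carrier ∘ₗ i
  set i₂ := LinearMap.snd O M'.carrier M''.carrier ∘ₗ i
  set r₁ := r ∘ₗ LinearMap.inl O M'.carrier M''.carrier
  set r₂ := r ∘ₗ LinearMap.inr O M'.carrier M''.carrier
  -- The identity of $M$ is the sum of the round trips through the two summands, so one of them is a
  -- unit. The second cannot be, as it lies in the trace ideal.
  have hsum : (r₁ ∘ₗ i₁ : Module.End O M.carrier) + (r₂ ∘ₗ i₂ : Module.End O M.carrier) = 1 := by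
    refine LinearMap.ext fun m => ?_
    change r ((i m).1, 0) + r (0, (i m).2) = m
    refine ((map_add r _ _).symm.trans ?_).trans (LinearMap.congr_fun h m)
    refine congrArg r (Prod.ext ?_ ?_)
    · exact add_zero _
    · exact zero_add _
  rcases hM.isUnit_or _ _ (intertwines_self_iff.1 hu1.intertwines)
    (intertwines_self_iff.1 hu2.intertwines) hsum with ⟨u, hu⟩ | hu
  · have hu' : IsEvenHom (M := M) (M' := M) (u : Module.End O M.carrier) := hu ▸ hu1
    refine ⟨i₁, ((u⁻¹ : (Module.End O M.carrier)ˣ) : Module.End O M.carrier) ∘ₗ r₁, hi1,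
      hu'.units_inv.comp hr1, ?_⟩
    have := u.inv_mul
    rw [hu] at this
    exact this
  · refine (h1 (one_mem_traceIdeal_of_isUnit ?_ hu)).elim
    exact comp_mem_traceIdeal hi2.intertwines hr2.intertwines h2

end Retracts

end SuperModule

/-! ### Orders of the subgroups occurring in the Green correspondence -/

section Orders

variable {G : Type*} [Group G] {A : Type*} [Ring A] {P N : Subgroup G}

theorem IsFixed.of_restrict {A : Type*} [Ring A] {ρ : G →* A} (hPN : P ≤ N) {c : A}
    (h : IsFixed (ρ.comp N.subtype) (P.subgroupOf N) c) : IsFixed ρ P c :=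
  fun x hx => h ⟨x, hPN hx⟩ hx

theorem greenX_mono {Q : Subgroup G} (hQ : Q ∈ greenX P N) {R : Subgroup G} (hR : R ≤ Q) :
    R ∈ greenX P N := by
  obtain ⟨g, hg, h⟩ := hQ
  exact ⟨g, hg, hR.trans h⟩

theorem greenY_mono {Q : Subgroup N} (hQ : Q ∈ greenY P N) {R : Subgroup N} (hR : R ≤ Q) :
    R ∈ greenY P N := by
  obtain ⟨g, hg, h⟩ := hQ
  exact ⟨g, hg, hR.trans h⟩

theorem Subgroup.card_conj_smul (g : G) (Q : Subgroup G) :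
    Nat.card (MulAut.conj g • Q : Subgroup G) = Nat.card Q :=
  (Nat.card_congr (Subgroup.equivSMul (MulAut.conj g) Q).toEquiv).symm

variable [Finite G]

theorem card_lt_of_mem_greenX (hPN : Subgroup.normalizer (P : Set G) ≤ N) {Q : Subgroup G}
    (hQ : Q ∈ greenX P N) : Nat.card Q < Nat.card P := by
  obtain ⟨g, hg, h⟩ := hQ
  by_contra! hcard
  have hQP := Subgroup.eq_of_le_of_card_ge (h.trans inf_le_left) hcard
  rw [hQP] at h
  exact hg (hPN (Subgroup.mem_normalizer_of_le_conj (h.trans inf_le_right)))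

/-- A bound on the order survives the conjugations and intersections in Mackey's formula, so it
gives a restriction-stable version of having small vertices. -/
theorem traceIdeal_le_restrict_card_lt {ρ : G →* A} {𝒬 : Set (Subgroup G)} {n : ℕ}
    (h : ∀ Q ∈ 𝒬, Nat.card Q < n) :
    traceIdeal ρ 𝒬 ≤ traceIdeal (ρ.comp N.subtype) {R | Nat.card R < n} := by
  refine traceIdeal_le_restrict fun Q hQ g => lt_of_le_of_lt ?_ (h Q hQ)
  rw [← Subgroup.card_conj_smul g Q]
  exact Nat.card_le_card_of_injective
    (fun x => (⟨x.1.1, x.2⟩ : (MulAut.conj g • Q : Subgroup G)))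
    fun x y hxy => by
      ext
      exact congrArg (fun z : (MulAut.conj g • Q : Subgroup G) => (z : G)) hxy

theorem HasLocalFixed.one_notMem_card_lt {ρ : G →* A} (h : HasLocalFixed ρ)
    (hP : IsTraceVertex ρ P) : (1 : A) ∉ traceIdeal ρ {R | Nat.card R < Nat.card P} := by
  intro h1
  obtain ⟨Q, hQ, g, hPQ⟩ := h.exists_le_conj hP h1
  have := Subgroup.card_le_of_le hPQ
  rw [Subgroup.card_conj_smul] at this
  exact absurd hQ this.not_gt

/-- Otherwise $P\le{}^{ng}P$ for some $n\in N$ and $g\notin N$; then $ng$ normalizes $P$, which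
forces $g\in N$. -/
theorem HasLocalFixed.one_notMem_greenY {ρ : N →* A}
    (hPN : Subgroup.normalizer (P : Set G) ≤ N) (h : HasLocalFixed ρ)
    (hP : IsTraceVertex ρ (P.subgroupOf N)) : (1 : A) ∉ traceIdeal ρ (greenY P N) := by
  intro h1
  obtain ⟨Q, ⟨g, hg, hQ⟩, n, hPQ⟩ := h.exists_le_conj hP h1
  refine hg ((N.mul_mem_cancel_left n.2).1
    (hPN (Subgroup.mem_normalizer_of_le_conj (g := (n : G) * g) fun x hx => ?_)))
  have hxN : x ∈ N := hPN (Subgroup.le_normalizer hx)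
  have h2 := hPQ (show (⟨x, hxN⟩ : N) ∈ P.subgroupOf N from hx)
  rw [Subgroup.mem_pointwise_smul_iff_inv_smul_mem] at h2
  have h3 : (((MulAut.conj n)⁻¹ • (⟨x, hxN⟩ : N) : N) : G) ∈ MulAut.conj g • P :=
    (Subgroup.mem_subgroupOf.1 (hQ h2)).2
  rw [map_mul, mul_smul, Subgroup.mem_pointwise_smul_iff_inv_smul_mem,
    Subgroup.mem_pointwise_smul_iff_inv_smul_mem]
  rw [Subgroup.mem_pointwise_smul_iff_inv_smul_mem] at h3
  simpa using h3

end Orders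

/-! ### Lifting and compressing idempotents modulo trace ideals -/

section Compression

variable {O : Type*} [CommRing O] {G : Type*} [Group G] [Finite G]
  {V W : Type*} [AddCommGroup V] [Module O V] [AddCommGroup W] [Module O W]
  {ρ : Representation O G V} {σ : Representation O G W}

theorem one_mem_traceIdeal_rangeRep {f : Module.End O V} (hf : Intertwines ρ ρ f)
    (hff : f * f = f) {𝒬 : Set (Subgroup G)}
    (h : f ∈ traceIdeal (A := Module.End O V) ρ 𝒬) :
    (1 : Module.End O (rangeRep f hf).toSubmodule) ∈
      traceIdeal (A := Module.End O (rangeRep f hf).toSubmodule)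
        (rangeRep f hf).toRepresentation 𝒬 := by
  have := comp_mem_traceIdeal (rangeRep f hf).intertwines_subtype (intertwines_rangeRestrict hf) h
  refine (congrArg (· ∈ traceIdeal (A := Module.End O (rangeRep f hf).toSubmodule)
        (rangeRep f hf).toRepresentation 𝒬) (LinearMap.ext fun v => Subtype.ext ?_)).mp this
  change f (f (v : V)) = v
  have hv : f (v : V) = v := apply_of_mem_range hff v.2
  rw [hv, hv]

theorem mem_traceIdeal_of_one_mem_rangeRep {f : Module.End O V} (hf : Intertwines ρ ρ f)
    {𝒬 : Set (Subgroup G)} (h : (1 : Module.End O (rangeRep f hf).toSubmodule) ∈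
      traceIdeal (A := Module.End O (rangeRep f hf).toSubmodule)
        (rangeRep f hf).toRepresentation 𝒬) :
    f ∈ traceIdeal (A := Module.End O V) ρ 𝒬 :=
  comp_mem_traceIdeal (intertwines_rangeRestrict hf) (rangeRep f hf).intertwines_subtype h

theorem mem_traceIdeal_of_isUnit_compression {j : V →ₗ[O] W} {q : W →ₗ[O] V}
    (hj : Intertwines ρ σ j) (hq : Intertwines σ ρ q) (hqj : q ∘ₗ j = LinearMap.id)
    {𝒬 : Set (Subgroup G)}
    (h1 : (1 - j ∘ₗ q : Module.End O W) ∈ traceIdeal (A := Module.End O W) σ 𝒬)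
    {x y : Module.End O W} (hx : Intertwines σ σ x) (hy : Intertwines σ σ y) (hxy : x * y = 0)
    (hu : IsUnit (q ∘ₗ y ∘ₗ j : Module.End O V)) :
    x ∈ traceIdeal (A := Module.End O W) σ 𝒬 := by
  have hqj' : ∀ v, q (j v) = v := LinearMap.congr_fun hqj
  have hxy' : ∀ w, x (y w) = 0 := LinearMap.congr_fun hxy
  have hxf := intertwines_self_iff.1 hx
  have hyf := intertwines_self_iff.1 hy
  have h2 := comp_mem_traceIdeal hj hq (mul_mem_traceIdeal hxf (traceIdeal_mul_mem hyf h1))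
  have h3 : (q ∘ₗ (x * ((1 - j ∘ₗ q : Module.End O W) * y)) ∘ₗ j : Module.End O V) =
      -((q ∘ₗ x ∘ₗ j : Module.End O V) * (q ∘ₗ y ∘ₗ j : Module.End O V)) := by
    refine LinearMap.ext fun v => ?_
    change q (x (y (j v) - j (q (y (j v))))) = -q (x (j (q (y (j v)))))
    rw [map_sub, hxy', zero_sub, map_neg]
  rw [h3, neg_mem_iff] at h2
  obtain ⟨u, hu⟩ := hu
  have hyj := intertwines_self_iff.1 (hq.comp (hy.comp hj))
  have h4 := traceIdeal_mul_mem (IsFixed.units_inv (u := u) (hu ▸ hyj)) h2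
  rw [← hu, Units.mul_inv_cancel_right] at h4
  have h5 := comp_mem_traceIdeal hq hj h4
  have h6 := traceIdeal_mul_mem (intertwines_self_iff.1 (hx.comp (hj.comp hq))) h1
  have h7 := mul_mem_traceIdeal hxf h1
  have h8 := add_mem (add_mem h5 h6) h7
  refine (congrArg (· ∈ traceIdeal (A := Module.End O W) σ 𝒬) (LinearMap.ext fun w => ?_)).mp h8
  change j (q (x (j (q w)))) + (x (j (q w)) - j (q (x (j (q w))))) + x (w - j (q w)) = x w
  rw [map_sub]
  abel

variable {N P : Subgroup G}

/-- The trace of an induced module from a vertex of the inducing module. -/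
theorem exists_relTrace_ind (hPN : P ≤ N) (τ : Representation O N V)
    (h : (1 : Module.End O V) ∈ traceIdeal (A := Module.End O V) τ {P.subgroupOf N}) :
    ∃ c : Module.End O (Representation.IndV N.subtype τ),
      IsFixed (A := Module.End O (Representation.IndV N.subtype τ))
        (Representation.ind N.subtype τ) P c ∧
      relTrace (A := Module.End O (Representation.IndV N.subtype τ))
        (Representation.ind N.subtype τ) P c = 1 ∧
      relTrace (A := Module.End O (Representation.IndV N.subtype τ))
        ((Representation.ind N.subtype τ).comp N.subtype) (P.subgroupOf N) c =
          Representation.IndV.mk N.subtype τ 1 ∘ₗ indRetract τ := by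
  obtain ⟨a, ha, ha1⟩ := mem_traceIdeal_singleton.1 h
  -- The witness is $j\circ a\circ q$, with $\mathrm{Tr}(a)=1$ on $V$ and $j$, $q$ the inclusion of
  -- and projection onto $1\otimes V$.
  have hc := IsFixed.of_restrict hPN
    (isFixed_comp (intertwines_indRetract τ) (intertwines_indMk_one τ) ha)
  have h1 := relTrace_comp (Q := P.subgroupOf N) (intertwines_indRetract τ)
    (intertwines_indMk_one τ) a
  rw [ha1, Module.End.one_eq_id, LinearMap.id_comp] at h1
  refine ⟨_, hc, ?_, h1⟩
  rw [← relTrace_relTrace hPN hc, h1, relTrace_indProjection]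

end Compression

/-! ### Existence of the correspondents -/

section Existence

variable {O : Type u} [CommRing O] [IsNoetherianRing O] [IsLocalRing O]
  [IsAdicComplete (IsLocalRing.maximalIdeal O) O] {G : Type v} [Group G] [Finite G]
  {P N : Subgroup G}

/-- The endomorphism ring of an induced module is local modulo the traces from smaller
subgroups. -/
theorem mem_or_one_sub_mem_greenX (hPN : Subgroup.normalizer (P : Set G) ≤ N) {V : Type w}
    [AddCommGroup V] [Module O V] [Module.Finite O V] {τ : Representation O N V}
    (hτ : IsIndecomposable τ) (hP : IsTraceVertex (A := Module.End O V) τ (P.subgroupOf N))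
    {x : Module.End O (Representation.IndV N.subtype τ)}
    (hx : IsFixed (A := Module.End O (Representation.IndV N.subtype τ))
      (Representation.ind N.subtype τ) ⊤ x) (hxx : x * x = x) :
    x ∈ traceIdeal (A := Module.End O (Representation.IndV N.subtype τ))
        (Representation.ind N.subtype τ) (greenX P N) ∨
      1 - x ∈ traceIdeal (A := Module.End O (Representation.IndV N.subtype τ))
        (Representation.ind N.subtype τ) (greenX P N) := by
  have hPN' : P ≤ N := Subgroup.le_normalizer.trans hPN
  obtain ⟨c, hc, hc1, hcb⟩ := exists_relTrace_ind hPN' τ hP.1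
  have h1 := one_sub_relTrace_mem_greenY (N := N) hc hc1
  rw [hcb] at h1
  have hj := intertwines_indMk_one τ
  have hq := intertwines_indRetract τ
  have hqj := indRetract_comp_mk_one τ
  have hy := IsFixed.one.sub hx
  have hxN := (intertwines_self_iff.2 hx).restrict N
  have hyN := (intertwines_self_iff.2 hy).restrict N
  have hsum : (indRetract τ ∘ₗ x ∘ₗ Representation.IndV.mk N.subtype τ 1 : Module.End O V) +
      (indRetract τ ∘ₗ (1 - x : Module.End O (Representation.IndV N.subtype τ)) ∘ₗ
        Representation.IndV.mk N.subtype τ 1 : Module.End O V) = 1 := by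
    refine LinearMap.ext fun v => ?_
    refine Eq.trans ?_ (LinearMap.congr_fun hqj v)
    refine (map_add (indRetract τ) _ _).symm.trans ?_
    exact congrArg (indRetract τ) 
      (add_sub_cancel (x (Representation.IndV.mk N.subtype τ 1 v))
        (Representation.IndV.mk N.subtype τ 1 v))
  -- The compressions of $x$ and $1-x$ to $V$ add up to $1$ in the local ring
  -- $\mathrm{End}_{ON}(V)$; whichever is invertible puts the other idempotent in the ideal.
  rcases hτ.hasLocalFixed.isUnit_or _ _ (intertwines_self_iff.1 (hq.comp (hxN.comp hj)))
    (intertwines_self_iff.1 (hq.comp (hyN.comp hj))) hsum with hu | hu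
  · right
    refine mem_greenX_of_mem_greenY hPN' hc hc1 hy ?_
    refine mem_traceIdeal_of_isUnit_compression hj hq hqj h1 hyN hxN ?_ hu
    rw [sub_mul, one_mul, hxx, sub_self]
  · left
    refine mem_greenX_of_mem_greenY hPN' hc hc1 hx ?_
    refine mem_traceIdeal_of_isUnit_compression hj hq hqj h1 hxN hyN ?_ hu
    rw [mul_sub, mul_one, hxx, sub_self]

/-- $V$ is a summand of $\mathrm{Res}\,\mathrm{Ind}\,V$, and its vertex has order $|P|$. -/
theorem one_notMem_card_lt_ind (hPN : P ≤ N) {V : Type w}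
    [AddCommGroup V] [Module O V] [Module.Finite O V] {τ : Representation O N V}
    (hτ : IsIndecomposable τ) (hP : IsTraceVertex (A := Module.End O V) τ (P.subgroupOf N)) :
    (1 : Module.End O (Representation.IndV N.subtype τ)) ∉
      traceIdeal (A := Module.End O (Representation.IndV N.subtype τ))
        ((Representation.ind N.subtype τ).comp N.subtype) {R | Nat.card R < Nat.card P} := by
  intro h
  have h2 := hτ.hasLocalFixed.one_notMem_card_lt hP
  rw [Nat.card_congr (Subgroup.subgroupOfEquivOfLe hPN).toEquiv] at h2
  exact h2 (one_mem_traceIdeal_of_retract (intertwines_indMk_one τ) (intertwines_indRetract τ)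
    (indRetract_comp_mk_one τ) h)

variable {G₀ : Subgroup G} (hG₀ : G₀.index = 2)

theorem exists_hasIndDecomposition (hPN : Subgroup.normalizer (P : Set G) ≤ N)
    (V : AbsIndec O (G₀.subgroupOf N) (P.subgroupOf N)) :
    ∃ U : AbsIndec O G₀ P, HasIndDecomposition hG₀ P N U.1 V.1 := by
  have hPN' : P ≤ N := Subgroup.le_normalizer.trans hPN
  obtain ⟨V, hV, hVP⟩ := V
  rw [isVertex_iff] at hVP
  let M := V.ind hG₀
  have hsmall : (1 : Module.End O M.carrier) ∉ traceIdeal (A := Module.End O M.carrier)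
      (M.ρ.comp N.subtype) {R | Nat.card R < Nat.card P} := one_notMem_card_lt_ind hPN' hV hVP
  have hX : traceIdeal (A := Module.End O M.carrier) M.ρ (greenX P N) ≤
      traceIdeal (A := Module.End O M.carrier)
        (M.ρ.comp N.subtype) {R | Nat.card R < Nat.card P} :=
    traceIdeal_le_restrict_card_lt fun Q hQ => card_lt_of_mem_greenX hPN hQ
  obtain ⟨f, hf, hfp, -, hf1⟩ := exists_even_isPrimitiveIdem M.isSuperGrading
    (fun h => hsmall (hX h)) fun x hx hxx => mem_or_one_sub_mem_greenX hPN hV hVP hx hxx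
  obtain ⟨c, hc, hc1, -⟩ := exists_relTrace_ind hPN' V.ρ hVP.1
  have hfe : SuperModule.IsEvenHom (M := M) (M' := M) f := ⟨mem_fixedSubalgebra.1 hf.mem, hfp.symm⟩
  have hP1 : (1 : Module.End O M.carrier) ∈ traceIdeal (A := Module.End O M.carrier) M.ρ {P} :=
    mem_traceIdeal_singleton.2 ⟨c, hc, hc1⟩
  have hfP : f ∈ traceIdeal (A := Module.End O M.carrier) M.ρ {P} := by
    have := mul_mem_traceIdeal (intertwines_self_iff.1 hfe.intertwines) hP1
    rwa [mul_one] at this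
  have hff' : (1 - f) * (1 - f) = 1 - f := by simp [mul_sub, sub_mul, hf.idem]
  refine ⟨⟨M.ofIdem f hfe, hf.isIndecomposable, isVertex_iff.2
    ⟨one_mem_traceIdeal_rangeRep hfe.intertwines hf.idem hfP, fun Q hQ hQP => ?_⟩⟩,
    M.ofIdem (1 - f) hfe.one_sub, SuperModule.iso_directSum_ofIdem hfe hf.idem,
    isSumWithVertices_of_one_mem (fun Q hQ R hR => greenX_mono hQ hR)
      (one_mem_traceIdeal_rangeRep hfe.one_sub.intertwines hff' hf1)⟩
  -- If $f$ were a trace from a proper subgroup of $P$, then both $f$ and $1-f$ would restrict to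
  -- traces from subgroups of $N$ of order less than $|P|$.
  by_contra hPQ
  have hcard : Nat.card Q < Nat.card P := by
    by_contra! h
    exact hPQ (Subgroup.eq_of_le_of_card_ge hQP h).ge
  have h1 : f ∈ traceIdeal (A := Module.End O M.carrier) M.ρ {Q} :=
    mem_traceIdeal_of_one_mem_rangeRep hfe.intertwines hQ
  have h2 := traceIdeal_le_restrict_card_lt (N := N) (n := Nat.card P)
    (fun R hR => by rw [Set.mem_singleton_iff.1 hR]; exact hcard) h1
  have h3 := add_mem h2 (hX hf1)
  rw [add_sub_cancel] at h3
  exact hsmall h3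

/-! ### Idempotents on the restriction of an indecomposable module -/

section Restriction

variable {A : Type*} [Ring A] {ρ : G →* A}

/-- If $u=\mathrm{Tr}_N^G(b(1-x))$ is a unit, then $1-x\equiv u$; multiplying by $x$ gives $0\equiv
xu$. -/
theorem mem_greenY_of_isUnit (hPN : P ≤ N) {c x : A} (hc : IsFixed ρ P c)
    (h1 : relTrace ρ P c = 1) (hx : IsFixed ρ N x) (hxx : x * x = x)
    (hu : IsUnit (relTrace ρ N (relTrace (ρ.comp N.subtype) (P.subgroupOf N) c * (1 - x)))) :
    x ∈ traceIdeal (ρ.comp N.subtype) (greenY P N) := by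
  have hb : IsFixed ρ N (relTrace (ρ.comp N.subtype) (P.subgroupOf N) c) :=
    isFixed_relTrace_restrict hc.restrict
  have hy : IsFixed ρ N (1 - x) := IsFixed.one.sub hx
  have ht := isFixed_relTrace (hb.mul hy)
  have h2 := mul_mem_traceIdeal (isFixed_restrict_top.2 hx)
    (sub_relTrace_mul_mem_greenY hPN hc h1 hy)
  obtain ⟨u, hu⟩ := hu
  rw [← hu] at h2 ht
  have h0 : x * (1 - x) = 0 := by rw [mul_sub, mul_one, hxx, sub_self]
  rw [mul_sub, h0, zero_sub, neg_mem_iff] at h2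
  have h3 := traceIdeal_mul_mem (isFixed_restrict_top.2 (ht.units_inv.mono le_top)) h2
  rwa [Units.mul_inv_cancel_right] at h3

theorem relTrace_mul_add_relTrace_mul_one_sub (hPN : P ≤ N) {c : A} (hc : IsFixed ρ P c)
    (h1 : relTrace ρ P c = 1) (x : A) :
    relTrace ρ N (relTrace (ρ.comp N.subtype) (P.subgroupOf N) c * x) +
      relTrace ρ N (relTrace (ρ.comp N.subtype) (P.subgroupOf N) c * (1 - x)) = 1 := by
  rw [← relTrace_add, ← mul_add, add_sub_cancel, mul_one, relTrace_relTrace hPN hc, h1]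

theorem HasLocalFixed.mem_or_one_sub_mem_greenY (h : HasLocalFixed ρ) (hPN : P ≤ N) {c x : A}
    (hc : IsFixed ρ P c) (h1 : relTrace ρ P c = 1) (hx : IsFixed ρ N x) (hxx : x * x = x) :
    x ∈ traceIdeal (ρ.comp N.subtype) (greenY P N) ∨
      1 - x ∈ traceIdeal (ρ.comp N.subtype) (greenY P N) := by
  have hb : IsFixed ρ N (relTrace (ρ.comp N.subtype) (P.subgroupOf N) c) :=
    isFixed_relTrace_restrict hc.restrict
  have hy : IsFixed ρ N (1 - x) := IsFixed.one.sub hx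
  rcases h.isUnit_or _ _ (isFixed_relTrace (hb.mul hx)) (isFixed_relTrace (hb.mul hy))
    (relTrace_mul_add_relTrace_mul_one_sub hPN hc h1 x) with hu | hu
  · right
    refine mem_greenY_of_isUnit hPN hc h1 hy (by simp [mul_sub, sub_mul, hxx]) ?_
    rwa [sub_sub_cancel]
  · exact Or.inl (mem_greenY_of_isUnit hPN hc h1 hx hxx hu)

/-- The complementary term $\mathrm{Tr}_N^G(b(1-x))$ is a trace from `greenX`, hence not a unit, and
the two terms add up to $1$. -/
theorem HasLocalFixed.isUnit_relTrace_mul (h : HasLocalFixed ρ)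
    (hPN : Subgroup.normalizer (P : Set G) ≤ N) (hP : IsTraceVertex ρ P) {c x : A}
    (hc : IsFixed ρ P c) (h1 : relTrace ρ P c = 1) (hx : IsFixed ρ N x)
    (hx1 : 1 - x ∈ traceIdeal (ρ.comp N.subtype) (greenY P N)) :
    IsUnit (relTrace ρ N (relTrace (ρ.comp N.subtype) (P.subgroupOf N) c * x)) := by
  have hPN' : P ≤ N := Subgroup.le_normalizer.trans hPN
  have hb : IsFixed ρ N (relTrace (ρ.comp N.subtype) (P.subgroupOf N) c) :=
    isFixed_relTrace_restrict hc.restrict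
  refine (h.isUnit_or _ _ (isFixed_relTrace (hb.mul hx))
    (isFixed_relTrace (hb.mul (IsFixed.one.sub hx)))
    (relTrace_mul_add_relTrace_mul_one_sub hPN' hc h1 x)).resolve_right fun hu => ?_
  exact h.one_notMem_greenX hPN hP
    (one_mem_traceIdeal_of_isUnit (relTrace_mul_mem_greenX hc hx1) hu)

end Restriction

theorem exists_hasResDecomposition (hPN : Subgroup.normalizer (P : Set G) ≤ N)
    (U : AbsIndec O G₀ P) : ∃ V : AbsIndec O (G₀.subgroupOf N) (P.subgroupOf N),
      HasResDecomposition P N U.1 V.1 := by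
  have hPN' : P ≤ N := Subgroup.le_normalizer.trans hPN
  obtain ⟨U, hU, hUP⟩ := U
  rw [isVertex_iff] at hUP
  have hloc := hU.hasLocalFixed
  let M := U.res N
  obtain ⟨c, hc, hc1⟩ := mem_traceIdeal_singleton.1 hUP.1
  have hb : IsFixed (A := Module.End O U.carrier) U.ρ N
      (relTrace (A := Module.End O U.carrier) (U.ρ.comp N.subtype) (P.subgroupOf N) c) :=
    isFixed_relTrace_restrict hc.restrict
  have h1 : (1 : Module.End O M.carrier) ∉ traceIdeal (A := Module.End O M.carrier) M.ρ
      (greenY P N) := fun h => hloc.one_notMem_greenX hPN hUP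
    (mem_greenX_of_mem_greenY hPN' hc hc1 IsFixed.one h)
  obtain ⟨f, hf, hfp, hfY, hf1⟩ := exists_even_isPrimitiveIdem M.isSuperGrading h1
    fun x hx hxx => hloc.mem_or_one_sub_mem_greenY hPN' hc hc1 (isFixed_restrict_top.1 hx) hxx
  have hfe : SuperModule.IsEvenHom (M := M) (M' := M) f := ⟨mem_fixedSubalgebra.1 hf.mem, hfp.symm⟩
  have hff' : (1 - f) * (1 - f) = 1 - f := by simp [mul_sub, sub_mul, hf.idem]
  have hfN := isFixed_restrict_top.1 (intertwines_self_iff.1 hfe.intertwines)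
  refine ⟨⟨M.ofIdem f hfe, hf.isIndecomposable, isVertex_iff.2 ⟨?_, fun R hR hRP => ?_⟩⟩,
    M.ofIdem (1 - f) hfe.one_sub, SuperModule.iso_directSum_ofIdem hfe hf.idem,
    isSumWithVertices_of_one_mem (fun Q hQ R hR => greenY_mono hQ hR)
      (one_mem_traceIdeal_rangeRep hfe.one_sub.intertwines hff' hf1)⟩
  -- From $1=b+(1-b)$, Rosenberg's lemma makes the summand projective relative to $P$ or to a member
  -- of `greenY`; the latter would put $f$ in the excluded ideal.
  · have h2 : (1 : Module.End O M.carrier) ∈ traceIdeal (A := Module.End O M.carrier) M.ρ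
        ({P.subgroupOf N} ∪ greenY P N) := by
      have h3 := add_mem
        (traceIdeal_mono (Set.subset_union_left (t := greenY P N))
          (relTrace_mem_traceIdeal (Set.mem_singleton (P.subgroupOf N)) hc.restrict))
        (traceIdeal_mono (Set.subset_union_right (s := {P.subgroupOf N}))
          (one_sub_relTrace_mem_greenY (N := N) hc hc1))
      rwa [add_sub_cancel] at h3
    have h3 := mul_mem_traceIdeal (intertwines_self_iff.1 hfe.intertwines) h2
    rw [mul_one] at h3
    obtain ⟨Q, hQ | hQ, hQ1⟩ := hf.isIndecomposable.hasLocalFixed.exists_one_mem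
      (one_mem_traceIdeal_rangeRep hfe.intertwines hf.idem h3)
    · rw [Set.mem_singleton_iff.1 hQ] at hQ1
      exact hQ1
    · exact (hfY (traceIdeal_mono (Set.singleton_subset_iff.2 hQ)
        (mem_traceIdeal_of_one_mem_rangeRep hfe.intertwines hQ1))).elim
  -- If $f$ is a trace from $R\le P$, then the unit $\mathrm{Tr}_N^G(bf)$ is a trace from $R$ to
  -- $G$, so minimality of $P$ for $U$ gives $P\le R$.
  · have h2 : f ∈ traceIdeal (A := Module.End O M.carrier) M.ρ {R} :=
      mem_traceIdeal_of_one_mem_rangeRep hfe.intertwines hR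
    have h3 := relTrace_mem_of_mem_restrict (𝒬 := {R.map N.subtype})
      (fun S hS => by rw [Set.mem_singleton_iff.1 hS]; exact Set.mem_singleton _)
      (mul_mem_traceIdeal (isFixed_restrict_top.2 hb) h2)
    have h4 : P ≤ R.map N.subtype := hUP.2
      (one_mem_traceIdeal_of_isUnit h3 (hloc.isUnit_relTrace_mul hPN hUP hc hc1 hfN hf1)) <| by
        rintro _ ⟨y, hy, rfl⟩
        exact hRP hy
    intro x hx
    obtain ⟨y, hy, hyx⟩ := h4 hx
    rwa [← Subtype.ext hyx]

end Existence

/-! ### Uniqueness of the correspondents -/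

namespace SuperModule

/-! ### Evenness of the maps between induction and restriction -/

section InductionMaps

open Representation

variable {O : Type u} [CommRing O] {G : Type v} [Group G] {G₀ N : Subgroup G}
  {U : SuperModule O G₀}
  {V : SuperModule O (G₀.subgroupOf N)}

theorem indRetract_mem {ε : ZMod 2} {x : IndV N.subtype V.ρ} (hx : x ∈ indGrade V ε) :
    indRetract V.ρ x ∈ V.grade ε := by
  induction hx using Submodule.span_induction with
  | mem x hx =>
    obtain ⟨g, δ, m, hm, rfl, rfl⟩ := hx
    by_cases hg : g ∈ N
    · rw [indRetract_mk_of_mem V.ρ hg]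
      have := V.apply_mem (⟨g, hg⟩ : N)⁻¹ hm
      rwa [parity_inv, parity_subgroupOf] at this
    · rw [indRetract_mk_of_notMem V.ρ hg]
      exact zero_mem _
  | zero => rw [map_zero]; exact zero_mem _
  | add x y _ _ hx hy => rw [map_add]; exact add_mem hx hy
  | smul c x _ hx => rw [map_smul]; exact Submodule.smul_mem _ c hx

theorem res_directSum_iso (M M' : SuperModule O G₀) (N : Subgroup G) :
    ((M.directSum M').res N).Iso ((M.res N).directSum (M'.res N)) :=
  iso_of_inverse (M := (M.directSum M').res N) (M' := (M.res N).directSum (M'.res N))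
    (f := LinearMap.id) (f' := LinearMap.id)
    (isEvenHom_of_mem (fun _ => rfl) fun _ _ hm => hm)
    (isEvenHom_of_mem (fun _ => rfl) fun _ _ hm => hm) rfl rfl

variable [Finite G] (hG₀ : G₀.index = 2)

theorem indMk_one_mem {ε : ZMod 2} {m : V.carrier} (hm : m ∈ V.grade ε) :
    IndV.mk N.subtype V.ρ 1 m ∈ (V.ind hG₀).grade ε := by
  have h := mk_mem_indGrade V 1 hm
  have h0 : parity G₀ (1 : G) = 0 := if_pos G₀.one_mem
  rwa [h0, zero_add] at h

theorem isEvenRetract_res_ind : V.IsEvenRetract ((V.ind hG₀).res N) :=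
  ⟨IndV.mk N.subtype V.ρ 1, indRetract V.ρ,
    isEvenHom_of_mem (M' := (V.ind hG₀).res N) (intertwines_indMk_one V.ρ)
      fun _ _ hm => indMk_one_mem hG₀ hm,
    isEvenHom_of_mem (M := (V.ind hG₀).res N) (intertwines_indRetract V.ρ)
      fun _ _ hm => indRetract_mem hm,
    indRetract_comp_mk_one V.ρ⟩

theorem isEvenHom_indCounit {f : V.carrier →ₗ[O] U.carrier}
    (hf : IsEvenHom (M := V) (M' := U.res N) f) :
    IsEvenHom (M := V.ind hG₀) (M' := U) (indCounit V.ρ f hf.intertwines) := by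
  refine isEvenHom_of_mem (M := V.ind hG₀) (intertwines_indCounit V.ρ f hf.intertwines)
    fun ε x hx => ?_
  replace hx : x ∈ indGrade V ε := hx
  induction hx using Submodule.span_induction with
  | mem x hx =>
    obtain ⟨g, δ, m, hm, rfl, rfl⟩ := hx
    have h1 : f m ∈ U.grade δ := (map_mem_grade_iff (M := V) (M' := U.res N)).2 hf.even δ m hm
    have h2 := U.apply_mem g⁻¹ h1
    rw [parity_inv] at h2
    exact (congrArg (· ∈ U.grade (parity G₀ g + δ))
      (indCounit_mk V.ρ f hf.intertwines g m)).mpr h2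
  | zero => exact (congrArg (· ∈ U.grade ε) (map_zero _)).mpr (zero_mem _)
  | add x y _ _ hx hy => exact (congrArg (· ∈ U.grade ε) (map_add _ x y)).mpr (add_mem hx hy)
  | smul c x _ hx =>
    exact (congrArg (· ∈ U.grade ε) (map_smul _ c x)).mpr (Submodule.smul_mem _ c hx)

/-- Each term of the average shifts the degree by $|g|$ twice, which cancels modulo $2$. -/
theorem isEvenHom_homTrace {M M' : SuperModule O G₀} {a : M.carrier →ₗ[O] M'.carrier}
    (ha : IsEvenHom (M := M.res N) (M' := M'.res N) a) :
    IsEvenHom (M := M) (M' := M') (homTrace M.ρ M'.ρ N a) := by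
  refine isEvenHom_of_mem (intertwines_homTrace fun q hq => ha.intertwines ⟨q, hq⟩)
    fun ε m hm => ?_
  let := Fintype.ofFinite (G ⧸ N)
  rw [homTrace, LinearMap.sum_apply]
  refine Submodule.sum_mem _ fun x _ => ?_
  have h1 : a (M.ρ x.out⁻¹ m) ∈ M'.grade (parity G₀ x.out⁻¹ + ε) :=
    map_mem_grade_iff.2 ha.even _ _ (M.apply_mem x.out⁻¹ hm)
  have h2 := M'.apply_mem x.out h1
  have key : ∀ α β : ZMod 2, α + (α + β) = β := by decide
  rwa [parity_inv, key] at h2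

end InductionMaps

/-! ### Cancellation between the two decompositions -/

section Uniqueness

variable {O : Type u} [CommRing O] {G : Type v} [Group G] {G₀ P N : Subgroup G}

theorem hasResDecomposition_congr {U : SuperModule O G₀} {V V' : SuperModule O (G₀.subgroupOf N)}
    (h : HasResDecomposition P N U V) (hV : V.Iso V') : HasResDecomposition P N U V' := by
  obtain ⟨M, hM, hMP⟩ := h
  exact ⟨M, hM.trans (hV.directSum_congr (.refl M)), hMP⟩

theorem hasResDecomposition_congr_left {U U' : SuperModule O G₀}
    {V : SuperModule O (G₀.subgroupOf N)} (h : HasResDecomposition P N U V) (hU : U.Iso U') :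
    HasResDecomposition P N U' V := by
  obtain ⟨M, hM, hMP⟩ := h
  exact ⟨M, (hU.res N).symm.trans hM, hMP⟩

variable [Finite G] {hG₀ : G₀.index = 2}

theorem hasIndDecomposition_congr {U U' : SuperModule O G₀}
    {V : SuperModule O (G₀.subgroupOf N)} (h : HasIndDecomposition hG₀ P N U V) (hU : U.Iso U') :
    HasIndDecomposition hG₀ P N U' V := by
  obtain ⟨M, hM, hMP⟩ := h
  exact ⟨M, hM.trans (hU.directSum_congr (.refl M)), hMP⟩

/-- The complement of a summand, as an endomorphism, lies in any trace ideal which contains the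
identity of the complement. -/
theorem Iso.exists_one_sub_mem_traceIdeal {M M' M'' : SuperModule O G₀}
    (h : M.Iso (M'.directSum M'')) {𝒬 : Set (Subgroup G)}
    (h1 : (1 : Module.End O M''.carrier) ∈ traceIdeal (A := Module.End O M''.carrier) M''.ρ 𝒬) :
    ∃ (i : M'.carrier →ₗ[O] M.carrier) (r : M.carrier →ₗ[O] M'.carrier),
      IsEvenHom i ∧ IsEvenHom r ∧
      (1 - i ∘ₗ r : Module.End O M.carrier) ∈ traceIdeal (A := Module.End O M.carrier) M.ρ 𝒬 := by
  obtain ⟨φ, ψ, hφ, hψ, -, hψφ⟩ := h.exists_inverse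
  refine ⟨_, _, hψ.comp isEvenHom_inl, isEvenHom_fst.comp hφ, ?_⟩
  have h2 := comp_mem_traceIdeal (isEvenHom_snd.comp hφ).intertwines
    (hψ.comp isEvenHom_inr).intertwines h1
  refine (congrArg (· ∈ traceIdeal (A := Module.End O M.carrier) M.ρ 𝒬) ?_).mp h2
  rw [eq_sub_iff_add_eq]
  refine LinearMap.ext fun m => Eq.trans ?_ (LinearMap.congr_fun hψφ m)
  change ψ (0, (φ m).2) + ψ ((φ m).1, 0) = ψ (φ m)
  refine (map_add ψ _ _).symm.trans (congrArg ψ (Prod.ext ?_ ?_))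
  · exact zero_add _
  · exact add_zero _

/-- A module with a relative trace generating its unit ideal has an even such trace. -/
theorem exists_even_relTrace (M : SuperModule O G₀) {Q : Subgroup G}
    (h : (1 : Module.End O M.carrier) ∈ traceIdeal (A := Module.End O M.carrier) M.ρ {Q}) :
    ∃ c : Module.End O M.carrier, IsFixed (A := Module.End O M.carrier) M.ρ Q c ∧
      relTrace (A := Module.End O M.carrier) M.ρ Q c = 1 ∧
      evenPart M.evenProj c = c := by
  obtain ⟨c, hc, hc1⟩ := mem_traceIdeal_singleton.1 h
  have hM := M.isSuperGrading
  refine ⟨evenPart M.evenProj c, hM.isFixed_evenPart hc, ?_,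
    evenPart_of_commute hM.idem (evenPart_commute hM.idem c)⟩
  rw [← hM.evenPart_relTrace, hc1, evenPart_of_commute hM.idem (by simp)]

variable [IsNoetherianRing O] [IsLocalRing O] [IsAdicComplete (IsLocalRing.maximalIdeal O) O]

/-- $V$ is a summand of $V'\oplus M_N$ but not projective relative to `greenY`, so $M_N$ cancels;
indecomposability then gives an isomorphism. -/
theorem IsEvenRetract.of_hasResDecomposition (hPN : Subgroup.normalizer (P : Set G) ≤ N)
    {U : SuperModule O G₀} {V V' : AbsIndec O (G₀.subgroupOf N) (P.subgroupOf N)}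
    (h : V.1.IsEvenRetract (U.res N)) (h' : HasResDecomposition P N U V'.1) : V.1.Iso V'.1 := by
  obtain ⟨M, hM, hMP⟩ := h'
  have hloc := V.2.1.hasLocalFixed
  exact ((h.trans hM.isEvenRetract).of_directSum hloc
    (hloc.one_notMem_greenY hPN (isVertex_iff.1 V.2.2)) hMP.one_mem_traceIdeal).iso V.2.1 V'.2.1

theorem iso_of_hasResDecomposition (hPN : Subgroup.normalizer (P : Set G) ≤ N)
    {U : SuperModule O G₀} {V V' : AbsIndec O (G₀.subgroupOf N) (P.subgroupOf N)}
    (h : HasResDecomposition P N U V.1) (h' : HasResDecomposition P N U V'.1) :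
    V.1.Iso V'.1 := by
  obtain ⟨M, hM, -⟩ := h
  exact (isEvenRetract_directSum_left.trans hM.symm.isEvenRetract).of_hasResDecomposition hPN h'

theorem iso_of_hasIndDecomposition_of_hasResDecomposition
    (hPN : Subgroup.normalizer (P : Set G) ≤ N) {U : SuperModule O G₀}
    {V V' : AbsIndec O (G₀.subgroupOf N) (P.subgroupOf N)}
    (h : HasIndDecomposition hG₀ P N U V.1) (h' : HasResDecomposition P N U V'.1) :
    V.1.Iso V'.1 := by
  obtain ⟨M, hM, hMP⟩ := h
  have hloc := V.2.1.hasLocalFixed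
  have hsmall := hloc.one_notMem_card_lt (isVertex_iff.1 V.2.2)
  rw [Nat.card_congr (Subgroup.subgroupOfEquivOfLe (Subgroup.le_normalizer.trans hPN)).toEquiv]
    at hsmall
  -- $V$ is an even summand of
  -- $\mathrm{Res}\,\mathrm{Ind}\,V\simeq\mathrm{Res}\,U\oplus\mathrm{Res}\,M_G$, and the last term
  -- cancels by the order bound.
  have h1 := (isEvenRetract_res_ind hG₀).trans
    ((hM.res N).trans (res_directSum_iso U M N)).isEvenRetract
  refine (h1.of_directSum hloc hsmall ?_).of_hasResDecomposition hPN h'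
  exact traceIdeal_le_restrict_card_lt (fun Q hQ => card_lt_of_mem_greenX hPN hQ)
    hMP.one_mem_traceIdeal

/-- Let $i,r$ be the inclusion and projection for $V$ in $\mathrm{Res}\,U$. Averaging
$u\mapsto1\otimes r(u)$ gives $\alpha\colon U\to\mathrm{Ind}\,V$, and Frobenius reciprocity for $bi$
gives $\beta$ back. Then $\beta\alpha=\mathrm{Tr}_N^G(b\,ir)$ is a unit since $1-ir$ is in the ideal
of `greenY`. -/
theorem isEvenRetract_ind_of_hasResDecomposition (hPN : Subgroup.normalizer (P : Set G) ≤ N)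
    {U : AbsIndec O G₀ P} {V : SuperModule O (G₀.subgroupOf N)}
    (h : HasResDecomposition P N U.1 V) : U.1.IsEvenRetract (V.ind hG₀) := by
  obtain ⟨U, hU, hUP⟩ := U
  rw [isVertex_iff] at hUP
  obtain ⟨M, hM, hMP⟩ := h
  replace hM : (U.res N).Iso (V.directSum M) := hM
  -- An even $c$ makes $b$ even, hence $\beta$ and the inverse of $\beta\alpha$ as well.
  obtain ⟨c, hc, hc1, hce⟩ := U.exists_even_relTrace hUP.1
  obtain ⟨i, r, hi, hr, he1⟩ : ∃ (i : V.carrier →ₗ[O] U.carrier) (r : U.carrier →ₗ[O] V.carrier),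
      IsEvenHom (M := V) (M' := U.res N) i ∧ IsEvenHom (M := U.res N) (M' := V) r ∧
      (1 - i ∘ₗ r : Module.End O U.carrier) ∈ traceIdeal (A := Module.End O U.carrier)
        (U.ρ.comp N.subtype) (greenY P N) :=
    hM.exists_one_sub_mem_traceIdeal hMP.one_mem_traceIdeal
  have heN : IsFixed (A := Module.End O U.carrier) U.ρ N (i ∘ₗ r) :=
    isFixed_restrict_top.1 (intertwines_self_iff.1 (hi.comp hr).intertwines)
  obtain ⟨u, hu⟩ := hU.hasLocalFixed.isUnit_relTrace_mul hPN hUP hc hc1 heN he1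
  obtain ⟨b, hb_def⟩ : ∃ b, b = relTrace (A := Module.End O U.carrier) (U.ρ.comp N.subtype)
    (P.subgroupOf N) c := ⟨_, rfl⟩
  have hb : IsEvenHom (M := U.res N) (M' := U.res N) b := by
    have hN := U.isSuperGrading.restrict N
    have hbe : evenPart U.evenProj b = b := by
      rw [hb_def, hN.evenPart_relTrace, hce]
    refine ⟨intertwines_self_iff.2 (isFixed_restrict_top.2
      (hb_def ▸ isFixed_relTrace_restrict hc.restrict)), ?_⟩
    have := evenPart_commute hN.idem b
    rw [hbe] at this
    exact this.symm
  rw [← hb_def] at hu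
  have hβ := isEvenHom_indCounit hG₀ (hb.comp hi)
  have hj : IsEvenHom (M := V) (M' := (V.ind hG₀).res N) (Representation.IndV.mk N.subtype V.ρ 1) :=
    isEvenHom_of_mem (M' := (V.ind hG₀).res N) (intertwines_indMk_one V.ρ)
      fun _ _ hm => indMk_one_mem hG₀ hm
  have hα := isEvenHom_homTrace (M := U) (M' := V.ind hG₀) (hj.comp hr)
  have hβα := comp_homTrace (ρ := U.ρ) (σ := (V.ind hG₀).ρ) (Q := N)
    (Representation.IndV.mk N.subtype V.ρ 1 ∘ₗ r) hβ.intertwines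
  have hβj : indCounit V.ρ (b ∘ₗ i) (hb.comp hi).intertwines ∘ₗ
      (Representation.IndV.mk N.subtype V.ρ 1 ∘ₗ r) = (b * (i ∘ₗ r) : Module.End O U.carrier) := by
    refine LinearMap.ext fun m => ?_
    refine (indCounit_mk V.ρ (b ∘ₗ i) (hb.comp hi).intertwines 1 (r m)).trans ?_
    rw [inv_one, map_one]
    rfl
  have hfin := hβα.trans
    ((congrArg (relTrace (A := Module.End O U.carrier) U.ρ N) hβj).trans hu.symm)
  have hue : IsEvenHom (M := U) (M' := U) (u : Module.End O U.carrier) := hfin ▸ hβ.comp hα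
  refine ⟨_, _, hα, hue.units_inv.comp hβ, ?_⟩
  exact (congrArg (fun z : Module.End O U.carrier =>
    ((u⁻¹ : (Module.End O U.carrier)ˣ) : Module.End O U.carrier) ∘ₗ z) hfin).trans u.inv_mul

theorem iso_of_hasResDecomposition_of_hasIndDecomposition
    (hPN : Subgroup.normalizer (P : Set G) ≤ N) {U U' : AbsIndec O G₀ P}
    {V : SuperModule O (G₀.subgroupOf N)} (h : HasResDecomposition P N U.1 V)
    (h' : HasIndDecomposition hG₀ P N U'.1 V) : U.1.Iso U'.1 := by
  obtain ⟨M, hM, hMP⟩ := h'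
  have hloc := U.2.1.hasLocalFixed
  exact (((isEvenRetract_ind_of_hasResDecomposition hPN h).trans hM.isEvenRetract).of_directSum
    hloc (hloc.one_notMem_greenX hPN (isVertex_iff.1 U.2.2)) hMP.one_mem_traceIdeal).iso
      U.2.1 U'.2.1

end Uniqueness

end SuperModule

/-! ### The bijection of isomorphism classes -/

theorem mainTheorem7 {O : Type u} [CommRing O] [IsDomain O] [IsDiscreteValuationRing O]
    [IsAdicComplete (IsLocalRing.maximalIdeal O) O] [CharZero O]
    (p : ℕ) [Fact p.Prime] (hp : p ≠ 2)
    [CharP (IsLocalRing.ResidueField O) p] [IsAlgClosed (IsLocalRing.ResidueField O)]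
    {G : Type v} [Group G] [Finite G] (G₀ : Subgroup G) (hG₀ : G₀.index = 2)
    (P N : Subgroup G) (hP : IsPGroup p P) (hPN : Subgroup.normalizer (P : Set G) ≤ N)
    (hN : ¬ N ≤ G₀) :
    ∃ Γ : AbsIndecClass O G₀ P ≃ AbsIndecClass O (G₀.subgroupOf N) (P.subgroupOf N),
      ∀ (U : AbsIndec O G₀ P) (V : AbsIndec O (G₀.subgroupOf N) (P.subgroupOf N)),
        (Γ (Quotient.mk _ U) = Quotient.mk _ V ↔ HasIndDecomposition hG₀ P N U.1 V.1) ∧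
        (Γ (Quotient.mk _ U) = Quotient.mk _ V ↔ HasResDecomposition P N U.1 V.1) := by
  -- The bijection is defined by restriction; induction then supplies injectivity, surjectivity and
  -- the other characterization.
  choose F hF using exists_hasResDecomposition (O := O) (G₀ := G₀) hPN
  let γ : AbsIndecClass O G₀ P → AbsIndecClass O (G₀.subgroupOf N) (P.subgroupOf N) :=
    Quotient.lift (fun U => Quotient.mk _ (F U)) fun U U' (h : U.1.Iso U'.1) =>
      Quotient.sound (SuperModule.iso_of_hasResDecomposition hPN
        (SuperModule.hasResDecomposition_congr_left (hF U) h) (hF U'))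
  have hres : ∀ (U : AbsIndec O G₀ P) (V : AbsIndec O (G₀.subgroupOf N) (P.subgroupOf N)),
      γ (Quotient.mk _ U) = Quotient.mk _ V ↔ HasResDecomposition P N U.1 V.1 := fun U V =>
    ⟨fun h => SuperModule.hasResDecomposition_congr (hF U) (Quotient.exact h),
      fun h => Quotient.sound (SuperModule.iso_of_hasResDecomposition hPN (hF U) h)⟩
  have hinj : Function.Injective γ := by
    intro x y
    induction x using Quotient.inductionOn with | _ U
    induction y using Quotient.inductionOn with | _ U'
    intro h
    have h1 := (hres U (F U')).1 h
    -- Both modules are isomorphic to the induction correspondent of their common restriction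
    -- correspondent.
    obtain ⟨U'', hU''⟩ := exists_hasIndDecomposition hG₀ hPN (F U')
    exact Quotient.sound
      ((SuperModule.iso_of_hasResDecomposition_of_hasIndDecomposition hPN h1 hU'').trans
        (SuperModule.iso_of_hasResDecomposition_of_hasIndDecomposition hPN (hF U') hU'').symm)
  have hsurj : Function.Surjective γ := by
    intro y
    induction y using Quotient.inductionOn with | _ V
    obtain ⟨U, hU⟩ := exists_hasIndDecomposition hG₀ hPN V
    exact ⟨Quotient.mk _ U, Quotient.sound
      (SuperModule.iso_of_hasIndDecomposition_of_hasResDecomposition hPN hU (hF U)).symm⟩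
  refine ⟨Equiv.ofBijective γ ⟨hinj, hsurj⟩, fun U V => ⟨?_, hres U V⟩⟩
  refine (hres U V).trans ⟨fun h => ?_, fun h => ?_⟩
  · obtain ⟨U', hU'⟩ := exists_hasIndDecomposition hG₀ hPN V
    exact SuperModule.hasIndDecomposition_congr hU'
      (SuperModule.iso_of_hasResDecomposition_of_hasIndDecomposition hPN h hU').symm
  · exact SuperModule.hasResDecomposition_congr (hF U)
      (SuperModule.iso_of_hasIndDecomposition_of_hasResDecomposition hPN h (hF U)).symm
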